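/- Let $\Sigma$ be a compact smooth three-dimensional manifold without boundary, let $\beta^*>0$, and let $\beta\mapsto g(\beta)$, $0\le\beta\le\beta^*$, be a solution of the Ricci flow $\partial_\beta g_{ab}=-2R_{ab}$ on $\Sigma$ that is smooth on $[0,\beta^*]\times\Sigma$ (it is then automatically of bounded geometry). For a metric $g$ with Levi-Civita connection $\nabla$ and rough Laplacian $\Delta=g^{ij}\nabla_i\nabla_j$, let $$\Delta_L H^{ab}=\Delta H^{ab}-R^a{}_sH^{sb}-R^b{}_sH^{as}+2R^a{}_s{}^b{}_t\,H^{st}$$ be the Lichnerowicz Laplacian on symmetric contravariant $2$-tensor fields; here $R_{asbt}=g_{ab}g_{st}-g_{at}g_{sb}$ on the round unit sphere, $R_{st}=g^{ab}R_{asbt}$, and $R=g^{st}R_{st}$. (1) Let $\operatorname{Ker}\delta_g$ be the space of symmetric $2$-tensor fields $H^{ab}(\beta)$, smooth on $[0,\beta^*]\times\Sigma$, with $\nabla_aH^{ab}(\beta)=0$ with respect to $g(\beta)$ for every $\beta\in[0,\beta^*]$, and let $$\bigcirc^*_L=-\frac{\partial}{\partial\beta}-\Delta_L+R,$$ where $\Delta_L$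 and $R$ at time $\beta$ are those of $g(\beta)$. Then $\bigcirc^*_L(\operatorname{Ker}\delta_g)\subset\operatorname{Ker}\delta_g$. (2) Put $\eta=\beta^*-\beta$, and let $H^{ab}(\eta)$, $0\le\eta\le\beta^*$, be a symmetric $2$-tensor field, smooth on $[0,\beta^*]\times\Sigma$, that solves $$\frac{\partial}{\partial\eta}H^{ab}=\Delta_LH^{ab}-R\,H^{ab}$$ along the backward Ricci flow $\eta\mapsto g(\beta^*-\eta)$. If $\nabla_aH^{ab}(0)=0$ with respect to $g(\beta^*)$, then $\nabla_aH^{ab}(\eta)=0$ with respect to $g(\beta^*-\eta)$ for all $\eta\in[0,\beta^*]$. -/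

import Mathlib

open scoped Manifold ContDiff
open Set Bundle

noncomputable section

/-! ### Tensor calculus in local coordinates

`G` is the matrix `g_{ij}` of a Riemannian metric on an open subset of `ℝⁿ` and `H` is the matrix
`H^{ab}` of a contravariant `2`-tensor field on the same open set. -/

namespace Coord

variable {n : ℕ}

/-- The partial derivative `∂ᵢ f`. -/
def pd (i : Fin n) (f : EuclideanSpace ℝ (Fin n) → ℝ) (y : EuclideanSpace ℝ (Fin n)) : ℝ :=
  fderiv ℝ f y (EuclideanSpace.single i 1)

/-- The Christoffel symbols
`Γ^k_{ij} = ½ g^{kl} (∂ᵢ g_{jl} + ∂ⱼ g_{il} - ∂ₗ g_{ij})` of the Levi-Civita connection. -/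
def christoffel (G : EuclideanSpace ℝ (Fin n) → Matrix (Fin n) (Fin n) ℝ)
    (k i j : Fin n) (y : EuclideanSpace ℝ (Fin n)) : ℝ :=
  (1 / 2 : ℝ) * ∑ l, (G y)⁻¹ k l *
    (pd i (fun z => G z j l) y + pd j (fun z => G z i l) y - pd l (fun z => G z i j) y)

/-- The curvature components `R^a_{sbt}`, defined by `R(∂_b, ∂_t) ∂_s = R^a_{sbt} ∂_a`, where
`R(X, Y) = ∇_X ∇_Y - ∇_Y ∇_X - ∇_{[X, Y]}`. Lowering the first index gives `R_{asbt}`, which on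
the round unit sphere is `g_{ab} g_{st} - g_{at} g_{sb}`. -/
def riemann (G : EuclideanSpace ℝ (Fin n) → Matrix (Fin n) (Fin n) ℝ)
    (a s b t : Fin n) (y : EuclideanSpace ℝ (Fin n)) : ℝ :=
  pd b (christoffel G a t s) y - pd t (christoffel G a b s) y +
    ∑ m, (christoffel G a b m y * christoffel G m t s y -
      christoffel G a t m y * christoffel G m b s y)

/-- The Ricci tensor `R_{st} = R^a_{sat}` (positive on round spheres). -/
def ricci (G : EuclideanSpace ℝ (Fin n) → Matrix (Fin n) (Fin n) ℝ)
    (s t : Fin n) (y : EuclideanSpace ℝ (Fin n)) : ℝ :=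
  ∑ a, riemann G a s a t y

/-- The scalar curvature `R = g^{st} R_{st}`. -/
def scalar (G : EuclideanSpace ℝ (Fin n) → Matrix (Fin n) (Fin n) ℝ)
    (y : EuclideanSpace ℝ (Fin n)) : ℝ :=
  ∑ s, ∑ t, (G y)⁻¹ s t * ricci G s t y

/-- The covariant derivative `∇_i H^{ab}`. -/
def cov (G H : EuclideanSpace ℝ (Fin n) → Matrix (Fin n) (Fin n) ℝ)
    (i a b : Fin n) (y : EuclideanSpace ℝ (Fin n)) : ℝ :=
  pd i (fun z => H z a b) y +
    ∑ k, (christoffel G a i k y * H y k b + christoffel G b i k y * H y a k)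

/-- The second covariant derivative `∇_j ∇_i H^{ab}`. -/
def covCov (G H : EuclideanSpace ℝ (Fin n) → Matrix (Fin n) (Fin n) ℝ)
    (j i a b : Fin n) (y : EuclideanSpace ℝ (Fin n)) : ℝ :=
  pd j (cov G H i a b) y +
    ∑ k, (christoffel G a j k y * cov G H i k b y + christoffel G b j k y * cov G H i a k y -
      christoffel G k j i y * cov G H k a b y)

/-- The divergence `∇_a H^{ab}`. -/
def divergence (G H : EuclideanSpace ℝ (Fin n) → Matrix (Fin n) (Fin n) ℝ)
    (b : Fin n) (y : EuclideanSpace ℝ (Fin n)) : ℝ :=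
  ∑ a, cov G H a a b y

/-- The rough Laplacian `Δ H^{ab} = g^{ij} ∇_i ∇_j H^{ab}`. -/
def roughLaplacian (G H : EuclideanSpace ℝ (Fin n) → Matrix (Fin n) (Fin n) ℝ)
    (a b : Fin n) (y : EuclideanSpace ℝ (Fin n)) : ℝ :=
  ∑ i, ∑ j, (G y)⁻¹ i j * covCov G H i j a b y

/-- The Lichnerowicz Laplacian
`Δ_L H^{ab} = Δ H^{ab} - R^a_s H^{sb} - R^b_s H^{as} + 2 R^a_s^b_t H^{st}`. -/
def lichnerowicz (G H : EuclideanSpace ℝ (Fin n) → Matrix (Fin n) (Fin n) ℝ)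
    (a b : Fin n) (y : EuclideanSpace ℝ (Fin n)) : ℝ :=
  roughLaplacian G H a b y
    - ∑ s, (∑ c, (G y)⁻¹ a c * ricci G c s y) * H y s b
    - ∑ s, (∑ c, (G y)⁻¹ b c * ricci G c s y) * H y a s
    + 2 * ∑ s, ∑ t, (∑ c, (G y)⁻¹ b c * riemann G a s c t y) * H y s t

end Coord

/-! ### Tensor fields on a manifold -/

section Manifold

variable {n : ℕ} {M : Type*} [TopologicalSpace M] [ChartedSpace (EuclideanSpace ℝ (Fin n)) M]

/-- The coordinate covector `dxⁱ` of the chart `e` at the point `x`. -/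
def coframe (e : OpenPartialHomeomorph M (EuclideanSpace ℝ (Fin n))) (x : M) (i : Fin n) :
    Module.Dual ℝ (TangentSpace (𝓡 n) x) :=
  ((EuclideanSpace.proj i : EuclideanSpace ℝ (Fin n) →L[ℝ] ℝ) ∘L
    (NormedSpace.fromTangentSpace (𝕜 := ℝ) (e x) :
      TangentSpace (𝓡 n) (e x) →L[ℝ] EuclideanSpace ℝ (Fin n)) ∘L
    mfderiv (𝓡 n) (𝓡 n) e x).toLinearMap

/-- The coordinate vector `∂ᵢ` of the chart `e` at the point `x`. -/
def frame (e : OpenPartialHomeomorph M (EuclideanSpace ℝ (Fin n))) (x : M) (i : Fin n) :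
    TangentSpace (𝓡 n) x :=
  (mfderiv (𝓡 n) (𝓡 n) e x).inverse
    ((NormedSpace.fromTangentSpace (𝕜 := ℝ) (e x)).symm (EuclideanSpace.single i 1))

variable (n M) in
/-- Contravariant `2`-tensor fields `H^{ab}`: at each point, a bilinear form on the cotangent
space. No regularity is imposed here. -/
abbrev TensorField : Type _ :=
  (x : M) → LinearMap.BilinForm ℝ (Module.Dual ℝ (TangentSpace (𝓡 n) x))

/-- The components `H^{ij} = H(dxⁱ, dxʲ)` in the chart `e`, as functions of the coordinates. -/
def TensorField.comp (e : OpenPartialHomeomorph M (EuclideanSpace ℝ (Fin n)))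
    (H : TensorField n M) (y : EuclideanSpace ℝ (Fin n)) : Matrix (Fin n) (Fin n) ℝ :=
  Matrix.of fun i j => H (e.symm y) (coframe e (e.symm y) i) (coframe e (e.symm y) j)

/-- The tensor `c^{ij} ∂ᵢ ⊗ ∂ⱼ` at the point `x`, where `∂ᵢ` are the coordinate vectors of the
chart `e`. -/
def tensorOfComp (e : OpenPartialHomeomorph M (EuclideanSpace ℝ (Fin n))) (x : M)
    (c : Fin n → Fin n → ℝ) : LinearMap.BilinForm ℝ (Module.Dual ℝ (TangentSpace (𝓡 n) x)) :=
  ∑ i, ∑ j, c i j • (LinearMap.BilinForm.linMulLin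
    (Module.Dual.eval ℝ (TangentSpace (𝓡 n) x) (frame e x i))
    (Module.Dual.eval ℝ (TangentSpace (𝓡 n) x) (frame e x j)))

variable [IsManifold (𝓡 n) ∞ M]

variable (n M) in
/-- Smooth Riemannian metrics on `M`. -/
abbrev SmoothMetric : Type _ :=
  ContMDiffRiemannianMetric (𝓡 n) ∞ (EuclideanSpace ℝ (Fin n))
    (fun x : M => TangentSpace (𝓡 n) x)

namespace SmoothMetric

/-- The components `g_{ij} = g(∂ᵢ, ∂ⱼ)` in the chart `e`, as functions of the coordinates. -/
def comp (e : OpenPartialHomeomorph M (EuclideanSpace ℝ (Fin n))) (g : SmoothMetric n M)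
    (y : EuclideanSpace ℝ (Fin n)) : Matrix (Fin n) (Fin n) ℝ :=
  Matrix.of fun i j => g.inner (e.symm y) (frame e (e.symm y) i) (frame e (e.symm y) j)

/-- The Ricci tensor `Ric(v, w) = R_{ij} dxⁱ(v) dxʲ(w)` at the point `x`. -/
def ricci (g : SmoothMetric n M) (x : M) (v w : TangentSpace (𝓡 n) x) : ℝ :=
  let e := chartAt (EuclideanSpace ℝ (Fin n)) x
  ∑ i, ∑ j, Coord.ricci (comp e g) i j (e x) * coframe e x i v * coframe e x j w

/-- The scalar curvature. -/
def scalar (g : SmoothMetric n M) (x : M) : ℝ :=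
  let e := chartAt (EuclideanSpace ℝ (Fin n)) x
  Coord.scalar (comp e g) (e x)

/-- The divergence `∇_a H^{ab}` of a contravariant `2`-tensor field, a vector field. -/
def divergence (g : SmoothMetric n M) (H : TensorField n M) (x : M) : TangentSpace (𝓡 n) x :=
  let e := chartAt (EuclideanSpace ℝ (Fin n)) x
  ∑ b, Coord.divergence (comp e g) (H.comp e) b (e x) • frame e x b

/-- The Lichnerowicz Laplacian `Δ_L H`. -/
def lichnerowicz (g : SmoothMetric n M) (H : TensorField n M) : TensorField n M := fun x =>
  let e := chartAt (EuclideanSpace ℝ (Fin n)) x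
  tensorOfComp e x fun a b => Coord.lichnerowicz (comp e g) (H.comp e) a b (e x)

end SmoothMetric

/-! ### Time-dependent objects on `[0, T] × M` -/

/-- The family of metrics `g(t)` is smooth on `[0, T] × M`, up to the end points. -/
def SmoothMetricFamily (T : ℝ) (g : ℝ → SmoothMetric n M) : Prop :=
  ∀ e ∈ atlas (EuclideanSpace ℝ (Fin n)) M, ∀ i j, ContDiffOn ℝ ∞
    (fun p : ℝ × EuclideanSpace ℝ (Fin n) => (g p.1).comp e p.2 i j) (Icc 0 T ×ˢ e.target)

/-- `g(t)`, `0 ≤ t ≤ T`, is a smooth solution of the Ricci flow `∂g/∂t = -2 Ric(g)`. -/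
def IsRicciFlow (T : ℝ) (g : ℝ → SmoothMetric n M) : Prop :=
  SmoothMetricFamily T g ∧ ∀ t ∈ Icc 0 T, ∀ (x : M) (v w : TangentSpace (𝓡 n) x),
    HasDerivWithinAt (fun s => (g s).inner x v w) (-2 * (g t).ricci x v w) (Icc 0 T) t

/-- The time-dependent tensor field `H(t)`, `0 ≤ t ≤ T`, is symmetric, and smooth on `[0, T] × M`
up to the end points. -/
def SmoothSymFamily (T : ℝ) (H : ℝ → TensorField n M) : Prop :=
  (∀ e ∈ atlas (EuclideanSpace ℝ (Fin n)) M, ∀ i j, ContDiffOn ℝ ∞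
    (fun p : ℝ × EuclideanSpace ℝ (Fin n) => (H p.1).comp e p.2 i j) (Icc 0 T ×ˢ e.target)) ∧
  ∀ t ∈ Icc 0 T, ∀ x, (H t x).IsSymm

/-- The time derivative `∂H/∂t` on `[0, T]`, one-sided at the end points. -/
def timeDeriv (T : ℝ) (H : ℝ → TensorField n M) (t : ℝ) : TensorField n M := fun x =>
  let e := chartAt (EuclideanSpace ℝ (Fin n)) x
  tensorOfComp e x fun a b =>
    derivWithin (fun s => H s x (coframe e x a) (coframe e x b)) (Icc 0 T) t

/-- The space `Ker δ_g` of smooth time-dependent symmetric `2`-tensor fields `H^{ab}(t)`,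
`0 ≤ t ≤ T`, with `∇_a H^{ab}(t) = 0` with respect to `g(t)` for all `t`. -/
def divFree (T : ℝ) (g : ℝ → SmoothMetric n M) : Set (ℝ → TensorField n M) :=
  {H | SmoothSymFamily T H ∧ ∀ t ∈ Icc 0 T, ∀ x, (g t).divergence (H t) x = 0}

/-- The operator `-∂/∂t - Δ_L + R` acting on time-dependent `2`-tensor fields `H^{ab}(t)`. -/
def conjOp (T : ℝ) (g : ℝ → SmoothMetric n M) (H : ℝ → TensorField n M) : ℝ → TensorField n M :=
  fun t x => - timeDeriv T H t x - (g t).lichnerowicz (H t) x + (g t).scalar x • H t x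

/-- `H(η)`, `0 ≤ η ≤ T`, is a smooth symmetric solution of `∂H/∂η = Δ_L H - R H` along the
backward flow of metrics `gb(η)`. -/
def IsConjugateFlow (T : ℝ) (gb : ℝ → SmoothMetric n M) (H : ℝ → TensorField n M) : Prop :=
  SmoothSymFamily T H ∧ ∀ η ∈ Icc 0 T, ∀ (x : M) (ξ θ : Module.Dual ℝ (TangentSpace (𝓡 n) x)),
    HasDerivWithinAt (fun s => H s x ξ θ)
      ((gb η).lichnerowicz (H η) x ξ θ - (gb η).scalar x * H η x ξ θ) (Icc 0 T) η

end Manifold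

end

/-! The heart of the matter is a commutation identity. If `W^b = ∇_a H^{ab}`, then along the Ricci
flow the divergence of `(-∂_β - Δ_L + R) H` equals `-∂_β W - ΔW + Ric W + R W`, where `Ric` acts on
vectors. Every term on the right is linear in `W` and its derivatives, so `W = 0` on all of
space-time forces the left side to vanish; together with preservation of smoothness and symmetry
this is (1).

For (2), reverse time, so that `H` is annihilated by the conjugate operator and `W` vanishes at the
final time. The identity then reads `∂_β W = -ΔW + Ric W + R W`. In the evolution of `u = |W|²` the
Ricci terms cancel against the variation of the metric, leaving `∂_β u + Δu = 2|∇W|² + 2R u ≥ 2R u`.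
On a compact manifold `R` is bounded, and the maximum principle applied to `exp(cβ) u` with `c`
large propagates `u = 0` from the final time back to every earlier time.

The identity is a pointwise statement, proved in a frame that is normal at one point: there the
metric is the identity and the Christoffel symbols vanish, both sides become polynomials in partial
derivatives of `G` and `H`, and in dimension three they are compared term by term
(`IsNormalAt.ev_div_conj`, and `IsNormalAt.ev_energy` for `|W|²`).

To make this legitimate, tensor calculus is carried out over a commutative ring with commuting
derivations. `FrameChange` contains the transformation laws, which give both independence of the
chart and the passage to a normal frame; `Realizes` identifies the ring formulas with the coordinate
formulas. The ring used is `SmoothFn (Icc 0 T ×ˢ O)`, functions smooth up to the end times, on which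
the time and space derivatives commute. `exists_normal_frame` supplies a time-independent frame
normal at a given point of space-time. The analytic conclusion is `divergence_eq_zero_of_final`. -/

noncomputable section

/-! ### Tensor calculus over a commutative ring with derivations -/

namespace FrameCalculus

open Matrix

variable {A ι : Type*} [CommRing A] [Algebra ℝ A] [Fintype ι]

/-- The connection matrices `(conn i)^k_j = Γ^k_{ij}` of the metric `G` with inverse `Gi`. -/
def conn (d : ι → Derivation ℝ A A) (G Gi : Matrix ι ι A) (i : ι) : Matrix ι ι A :=
  Matrix.of fun k j =>
    (1 / 2 : ℝ) • ∑ l, Gi k l * (d i (G j l) + d j (G i l) - d l (G i j))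

/-- The curvature matrices of the connection with matrices `C`. -/
def curv (d : ι → Derivation ℝ A A) (C : ι → Matrix ι ι A) (i j : ι) : Matrix ι ι A :=
  (C j).map (d i) - (C i).map (d j) + C i * C j - C j * C i

/-- The Ricci contraction of the curvature. -/
def ricci (d : ι → Derivation ℝ A A) (C : ι → Matrix ι ι A) : Matrix ι ι A :=
  Matrix.of fun s t => ∑ a, curv d C a t a s

/-- The scalar curvature. -/
def scalar (d : ι → Derivation ℝ A A) (C : ι → Matrix ι ι A) (Gi : Matrix ι ι A) : A :=
  ∑ s, ∑ t, Gi s t * ricci d C s t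

/-- The covariant derivative of a contravariant `2`-tensor. -/
def nabla (d : ι → Derivation ℝ A A) (C : ι → Matrix ι ι A) (H : Matrix ι ι A) (i : ι) :
    Matrix ι ι A :=
  H.map (d i) + C i * H + H * (C i)ᵀ

/-- The second covariant derivative of a contravariant `2`-tensor. -/
def nabla2 (d : ι → Derivation ℝ A A) (C : ι → Matrix ι ι A) (H : Matrix ι ι A) (j i : ι) :
    Matrix ι ι A :=
  nabla d C (nabla d C H i) j - ∑ k, C j k i • nabla d C H k

/-- The divergence of a contravariant `2`-tensor. -/
def div (d : ι → Derivation ℝ A A) (C : ι → Matrix ι ι A) (H : Matrix ι ι A) (b : ι) : A :=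
  ∑ a, nabla d C H a a b

/-- The rough Laplacian of a contravariant `2`-tensor. -/
def rough (d : ι → Derivation ℝ A A) (C : ι → Matrix ι ι A) (Gi H : Matrix ι ι A) :
    Matrix ι ι A :=
  ∑ i, ∑ j, Gi i j • nabla2 d C H i j

/-- The action `R^a_s^b_t H^{st}` of the curvature on contravariant `2`-tensors. -/
def riem (d : ι → Derivation ℝ A A) (C : ι → Matrix ι ι A) (Gi H : Matrix ι ι A) :
    Matrix ι ι A :=
  Matrix.of fun a b => ∑ c, ∑ t, Gi b c * (curv d C c t * H) a t

/-- The Lichnerowicz Laplacian of a contravariant `2`-tensor. -/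
def lich (d : ι → Derivation ℝ A A) (C : ι → Matrix ι ι A) (Gi H : Matrix ι ι A) :
    Matrix ι ι A :=
  rough d C Gi H - Gi * ricci d C * H - H * (Gi * ricci d C)ᵀ + 2 • riem d C Gi H

theorem map_mul (D : Derivation ℝ A A) (M N : Matrix ι ι A) :
    (M * N).map D = M.map D * N + M * N.map D := by
  ext i j
  simp only [Matrix.map_apply, Matrix.mul_apply, Matrix.add_apply, map_sum, Derivation.leibniz,
    smul_eq_mul, ← Finset.sum_add_distrib]
  exact Finset.sum_congr rfl fun k _ => by ring

omit [Fintype ι] in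
theorem map_add' (D : Derivation ℝ A A) (M N : Matrix ι ι A) :
    (M + N).map D = M.map D + N.map D := by
  ext i j; simp

omit [Fintype ι] in
theorem map_smul' (D : Derivation ℝ A A) (a : A) (M : Matrix ι ι A) :
    (a • M).map D = D a • M + a • M.map D := by
  ext i j; simp; ring

theorem map_sum' (D : Derivation ℝ A A) (M : ι → Matrix ι ι A) :
    (∑ i, M i).map D = ∑ i, (M i).map D := by
  ext i j; simp [Matrix.sum_apply]

omit [Fintype ι] in
theorem map_one' [DecidableEq ι] (D : Derivation ℝ A A) : (1 : Matrix ι ι A).map D = 0 := by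
  ext i j
  by_cases h : i = j <;> simp [h]

theorem conn_symm (d : ι → Derivation ℝ A A) {G : Matrix ι ι A} (hG : Gᵀ = G) (Gi : Matrix ι ι A)
    (i k j : ι) : conn d G Gi i k j = conn d G Gi j k i := by
  have h : ∀ i j, G i j = G j i := fun i j => congrFun (congrFun hG j) i
  simp only [conn, Matrix.of_apply]
  congr 1
  refine Finset.sum_congr rfl fun l _ => ?_
  rw [h i j]; ring

variable [DecidableEq ι]

/-- Multiplying by `G` gives the Christoffel symbols of the first kind; adding such a matrix to its
transpose cancels everything except two copies of `d k (G i j)`. -/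
theorem conn_compat (d : ι → Derivation ℝ A A) {G Gi : Matrix ι ι A} (hG : Gᵀ = G)
    (hGi : G * Gi = 1) (k : ι) :
    G.map (d k) = (conn d G Gi k)ᵀ * G + G * conn d G Gi k := by
  have h : ∀ i j, G i j = G j i := fun i j => congrFun (congrFun hG j) i
  have key : ∀ i m j, (G * conn d G Gi i) m j =
      (1 / 2 : ℝ) • (d i (G j m) + d j (G i m) - d m (G i j)) := by
    intro i m j
    have : conn d G Gi i =
        (1 / 2 : ℝ) • (Gi * Matrix.of fun l j => d i (G j l) + d j (G i l) - d l (G i j)) := by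
      ext k j
      simp [conn, Matrix.mul_apply]
    rw [this, Matrix.mul_smul, ← Matrix.mul_assoc, hGi, Matrix.one_mul]
    simp
  have key2 : (conn d G Gi k)ᵀ * G = (G * conn d G Gi k)ᵀ := by
    rw [Matrix.transpose_mul, hG]
  ext i j
  rw [Matrix.add_apply, key2, Matrix.transpose_apply, key, key, ← smul_add, h j i, h k i, h k j]
  have : d k (G i j) + d i (G j k) - d j (G i k) + (d k (G i j) + d j (G i k) - d i (G j k))
      = (2 : ℝ) • d k (G i j) := by
    rw [two_smul]; ring
  rw [this, smul_smul]
  simp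

/-- Uniqueness of the Levi-Civita connection by Koszul's argument: metric compatibility turns the
three derivatives of `G` into six sums, of which the torsion-free condition cancels four and
identifies the other two with `G * C i`. -/
theorem eq_conn (d : ι → Derivation ℝ A A) {G Gi : Matrix ι ι A} (hG : Gᵀ = G)
    (hGi : Gi * G = 1) {C : ι → Matrix ι ι A} (hC : ∀ i k j, C i k j = C j k i)
    (hc : ∀ k, G.map (d k) = (C k)ᵀ * G + G * C k) : conn d G Gi = C := by
  have h : ∀ i j, G i j = G j i := fun i j => congrFun (congrFun hG j) i
  have e : ∀ k i j, d k (G i j) = ∑ m, C k m i * G m j + ∑ m, G i m * C k m j := by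
    intro k i j
    have := congrFun (congrFun (hc k) i) j
    simpa [Matrix.mul_apply] using this
  funext i
  have : conn d G Gi i = Gi * (G * C i) := by
    ext k j
    rw [Matrix.mul_apply]
    simp only [conn, Matrix.of_apply]
    rw [Finset.smul_sum]
    refine Finset.sum_congr rfl fun l _ => ?_
    have : d i (G j l) + d j (G i l) - d l (G i j) = (2 : ℝ) • (G * C i) l j := by
      rw [e, e, e, Matrix.mul_apply, two_smul]
      have e1 : ∑ m, C i m j * G m l = ∑ m, G l m * C i m j :=
        Finset.sum_congr rfl fun m _ => by rw [h l m, mul_comm]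
      have e2 : ∑ m, C j m i * G m l = ∑ m, G l m * C i m j :=
        Finset.sum_congr rfl fun m _ => by rw [h l m, mul_comm, hC]
      have e3 : ∑ m, C l m i * G m j = ∑ m, G j m * C i m l :=
        Finset.sum_congr rfl fun m _ => by rw [h j m, mul_comm, hC]
      have e4 : ∑ m, G i m * C l m j = ∑ m, G i m * C j m l :=
        Finset.sum_congr rfl fun m _ => by rw [hC]
      rw [e1, e2, e3, e4]; ring
    rw [this, mul_smul_comm, smul_smul]
    simp
  rw [this, ← Matrix.mul_assoc, hGi, Matrix.one_mul]

/-! ### Changes of commuting frames and the transformation laws of the tensor operations. -/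

/-- `d' i = ∑ p, P p i * d p` is another commuting frame of derivations, and `Q = P⁻¹`. -/
structure FrameChange (d d' : ι → Derivation ℝ A A) (P Q : Matrix ι ι A) : Prop where
  mul_inv : P * Q = 1
  inv_mul : Q * P = 1
  frame : ∀ i f, d' i f = ∑ p, P p i * d p f
  symm : ∀ i j l, d' i (P l j) = d' j (P l i)
  comm : ∀ i j f, d' i (d' j f) = d' j (d' i f)

namespace FrameChange

variable {d d' : ι → Derivation ℝ A A} {P Q : Matrix ι ι A}

/-- Coordinate functions `x` with invertible Jacobian define a change of commuting frames. -/
theorem of_coordinates (hd : ∀ i j f, d i (d j f) = d j (d i f)) (x : ι → A)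
    (hPQ : P * (Matrix.of fun i j => d j (x i)) = 1)
    (hf : ∀ i f, d' i f = ∑ p, P p i * d p f) :
    FrameChange d d' P (Matrix.of fun i j => d j (x i)) := by
  set K : Matrix ι ι A := Matrix.of fun i j => d j (x i) with hK
  have hQP : K * P = 1 := mul_eq_one_comm.mp hPQ
  have hsymm : ∀ i j l, d' i (P l j) = d' j (P l i) := by
    have e : ∀ D : Derivation ℝ A A, P.map D = - (P * K.map D * P) := by
      intro D
      have h1 : P.map D * K + P * K.map D = 0 := by rw [← map_mul, hPQ, map_one']
      calc P.map D = (P.map D * K) * P := by rw [Matrix.mul_assoc, hQP, Matrix.mul_one]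
        _ = (-(P * K.map D)) * P := by rw [eq_neg_of_add_eq_zero_left h1]
        _ = _ := by rw [Matrix.neg_mul]
    intro i j l
    have e1 : ∀ i j, d' i (P l j) =
        -∑ n, (∑ m, P l m * ∑ p, P p i * d p (d n (x m))) * P n j := by
      intro i j
      have := congrFun (congrFun (e (d' i)) l) j
      simp only [Matrix.map_apply, Matrix.neg_apply, Matrix.mul_apply] at this
      rw [this]
      simp only [hf, hK, Matrix.of_apply]
    rw [e1, e1]
    congr 1
    simp only [Finset.sum_mul, Finset.mul_sum]
    -- The expression contracts second derivatives of the coordinates with three factors of `P`.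
    -- Reversing the order of summation exchanges the roles of `i` and `j`, and `hd` absorbs the
    -- exchange.
    have r : ∀ F : ι → ι → ι → A, ∑ a, ∑ b, ∑ c, F a b c = ∑ c, ∑ b, ∑ a, F a b c := by
      intro F
      rw [Finset.sum_comm_cycle]
      exact Finset.sum_congr rfl fun _ _ => Finset.sum_comm
    rw [r]
    refine Finset.sum_congr rfl fun a _ => Finset.sum_congr rfl fun b _ =>
      Finset.sum_congr rfl fun c _ => ?_
    rw [hd a c]; ring
  refine ⟨hPQ, hQP, hf, hsymm, ?_⟩
  intro i j f
  have e : ∀ i j, d' i (d' j f) =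
      ∑ p, d' i (P p j) * d p f + ∑ p, ∑ q, P p j * P q i * d q (d p f) := by
    intro i j
    rw [hf j f, map_sum, ← Finset.sum_add_distrib]
    refine Finset.sum_congr rfl fun p _ => ?_
    rw [Derivation.leibniz, hf i (d p f), smul_eq_mul, smul_eq_mul, Finset.mul_sum, add_comm]
    congr 1
    · ring
    · exact Finset.sum_congr rfl fun q _ => by ring
  rw [e, e]
  congr 1
  · exact Finset.sum_congr rfl fun p _ => by rw [hsymm]
  · rw [Finset.sum_comm]
    refine Finset.sum_congr rfl fun p _ => Finset.sum_congr rfl fun q _ => ?_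
    rw [hd p q]; ring

variable (h : FrameChange d d' P Q)
include h

theorem map_frame (M : Matrix ι ι A) (i : ι) : M.map (d' i) = ∑ p, P p i • M.map (d p) := by
  ext a b
  simp [Matrix.sum_apply, h.frame]

/-- The transformation law of the connection matrices. -/
theorem mul_conn {G Gi : Matrix ι ι A} (hG : Gᵀ = G) (hGi : G * Gi = 1) (i : ι) :
    P * conn d' (Pᵀ * G * P) (Q * Gi * Qᵀ) i =
      (∑ p, P p i • conn d G Gi p) * P + P.map (d' i) := by
  have hPQt : Pᵀ * Qᵀ = 1 := by rw [← Matrix.transpose_mul, h.inv_mul, Matrix.transpose_one]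
  have hQPt : Qᵀ * Pᵀ = 1 := by rw [← Matrix.transpose_mul, h.mul_inv, Matrix.transpose_one]
  have hGi' : Gi * G = 1 := mul_eq_one_comm.mp hGi
  set C := conn d G Gi
  -- The candidate is the transformed connection. By uniqueness of the Levi-Civita connection it
  -- suffices that it be torsion-free, which uses `h.symm`, and compatible with the transformed
  -- metric.
  have main : conn d' (Pᵀ * G * P) (Q * Gi * Qᵀ) =
      fun i => Q * ((∑ p, P p i • C p) * P + P.map (d' i)) := by
    refine eq_conn d' ?_ ?_ ?_ ?_
    · simp [Matrix.transpose_mul, hG, Matrix.mul_assoc]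
    · calc Q * Gi * Qᵀ * (Pᵀ * G * P) = Q * Gi * (Qᵀ * Pᵀ) * G * P := by
            simp only [Matrix.mul_assoc]
        _ = Q * (Gi * G) * P := by rw [hQPt]; simp only [Matrix.mul_assoc, Matrix.one_mul]
        _ = 1 := by rw [hGi', Matrix.mul_one, h.inv_mul]
    · intro i k j
      rw [Matrix.mul_apply, Matrix.mul_apply]
      refine Finset.sum_congr rfl fun l _ => ?_
      congr 1
      rw [Matrix.add_apply, Matrix.add_apply, Matrix.map_apply, Matrix.map_apply, h.symm i j]
      congr 1
      simp only [Matrix.mul_apply, Matrix.sum_apply, Matrix.smul_apply, smul_eq_mul,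
        Finset.sum_mul]
      rw [Finset.sum_comm]
      refine Finset.sum_congr rfl fun p _ => Finset.sum_congr rfl fun q _ => ?_
      rw [show C q l p = C p l q from conn_symm d hG Gi q l p]; ring
    · intro k
      have e : G.map (d' k) = (∑ p, P p k • C p)ᵀ * G + G * ∑ p, P p k • C p := by
        rw [h.map_frame]
        simp only [C, conn_compat d hG hGi, Matrix.transpose_sum, Finset.sum_mul, Finset.mul_sum,
          smul_add, Finset.sum_add_distrib, Matrix.transpose_smul, Matrix.smul_mul,
          Matrix.mul_smul]
      set X := ∑ p, P p k • C p
      have e1 : Pᵀ * G * P * (Q * (X * P + P.map (d' k))) = Pᵀ * G * (X * P + P.map (d' k)) := by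
        rw [Matrix.mul_assoc, ← Matrix.mul_assoc P, h.mul_inv, Matrix.one_mul]
      have e2 : (Q * (X * P + P.map (d' k)))ᵀ * (Pᵀ * G * P) =
          (X * P + P.map (d' k))ᵀ * (G * P) := by
        rw [Matrix.transpose_mul, Matrix.mul_assoc, Matrix.mul_assoc Pᵀ, ← Matrix.mul_assoc Qᵀ,
          hQPt, Matrix.one_mul]
      rw [e1, e2, map_mul, map_mul, e]
      have : (Pᵀ).map (d' k) = (P.map (d' k))ᵀ := rfl
      rw [this]
      simp only [Matrix.transpose_add, Matrix.transpose_mul, Matrix.mul_add, Matrix.add_mul,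
        Matrix.mul_assoc]
      abel
  rw [main, ← Matrix.mul_assoc, h.mul_inv, Matrix.one_mul]

variable {C C' : ι → Matrix ι ι A}

/-- The transformation law of the curvature. -/
theorem mul_curv (hC : ∀ i, P * C' i = (∑ p, P p i • C p) * P + P.map (d' i)) (i j : ι) :
    P * curv d' C' i j = (∑ p, ∑ q, (P p i * P q j) • curv d C p q) * P := by
  have e : ∀ i j, P * (C' j).map (d' i) + P * (C' i * C' j) =
      (∑ q, P q j • C q).map (d' i) * P + (∑ q, P q j • C q) * P.map (d' i) +
      (P.map (d' j)).map (d' i) + (∑ q, P q i • C q) * ((∑ q, P q j • C q) * P + P.map (d' j)) := by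
    intro i j
    have h1 : P * (C' j).map (d' i) = (P * C' j).map (d' i) - P.map (d' i) * C' j := by
      rw [map_mul]; abel
    rw [h1, hC, ← Matrix.mul_assoc P, hC, map_add', map_mul, Matrix.add_mul, Matrix.mul_assoc _ P,
      hC]
    abel
  -- Differentiating the law for `C'` produces second derivatives of `P` and terms with `d' i (P q
  -- j)`. Both are symmetric in `i` and `j`, so they disappear on antisymmetrization; this is `hs`
  -- and `hs2`.
  have hs : (P.map (d' j)).map (d' i) = (P.map (d' i)).map (d' j) := by
    ext a b; simp [h.comm i j]
  have e2 : ∀ i j, (∑ q, P q j • C q).map (d' i) =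
      ∑ q, d' i (P q j) • C q + ∑ p, ∑ q, (P p i * P q j) • (C q).map (d p) := by
    intro i j
    rw [map_sum', Finset.sum_comm, ← Finset.sum_add_distrib]
    refine Finset.sum_congr rfl fun q _ => ?_
    rw [map_smul', h.map_frame, Finset.smul_sum]
    congr 1
    refine Finset.sum_congr rfl fun p _ => ?_
    rw [smul_smul, mul_comm]
  have e3 : ∀ i j, (∑ q, P q i • C q) * (∑ q, P q j • C q) =
      ∑ p, ∑ q, (P p i * P q j) • (C p * C q) := by
    intro i j
    simp only [Matrix.sum_mul, Matrix.mul_sum, Matrix.smul_mul, Matrix.mul_smul, Finset.smul_sum,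
      smul_smul]
    rw [Finset.sum_comm]
    exact Finset.sum_congr rfl fun p _ => Finset.sum_congr rfl fun q _ => by rw [mul_comm]
  have hs2 : ∑ q, d' i (P q j) • C q = ∑ q, d' j (P q i) • C q :=
    Finset.sum_congr rfl fun q _ => by rw [h.symm]
  have lhs : P * curv d' C' i j = (P * (C' j).map (d' i) + P * (C' i * C' j)) -
      (P * (C' i).map (d' j) + P * (C' j * C' i)) := by
    simp only [curv, Matrix.mul_add, Matrix.mul_sub]; abel
  have rhs : (∑ p, ∑ q, (P p i * P q j) • curv d C p q) =
      (∑ p, ∑ q, (P p i * P q j) • (C q).map (d p)) - (∑ p, ∑ q, (P p j * P q i) • (C q).map (d p))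
      + (∑ p, ∑ q, (P p i * P q j) • (C p * C q)) - (∑ p, ∑ q, (P p j * P q i) • (C p * C q)) := by
    rw [Finset.sum_comm (f := fun p q => (P p j * P q i) • (C q).map (d p)),
      Finset.sum_comm (f := fun p q => (P p j * P q i) • (C p * C q))]
    simp only [curv, ← Finset.sum_add_distrib, ← Finset.sum_sub_distrib]
    refine Finset.sum_congr rfl fun p _ => Finset.sum_congr rfl fun q _ => ?_
    rw [mul_comm (P q j)]
    simp only [smul_add, smul_sub]
  rw [lhs, e, e, rhs, ← e3, ← e3, hs]
  rw [e2 i j, e2 j i, hs2]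
  simp only [Matrix.mul_add, Matrix.add_mul, Matrix.sub_mul, ← Matrix.mul_assoc]
  abel

/-- The transformation law of the Ricci tensor. -/
theorem ricci_eq (hC : ∀ i, P * C' i = (∑ p, P p i • C p) * P + P.map (d' i)) :
    ricci d' C' = Pᵀ * ricci d C * P := by
  have e : ∀ i j, curv d' C' i j = ∑ p, ∑ q, (P p i * P q j) • (Q * curv d C p q * P) := by
    intro i j
    have := congrArg (Q * ·) (h.mul_curv hC i j)
    simp only [← Matrix.mul_assoc, h.inv_mul, Matrix.one_mul] at this
    rw [this]
    simp only [Matrix.mul_sum, Matrix.sum_mul, Matrix.smul_mul, Matrix.mul_smul]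
  have tr : ∀ (M : Matrix ι ι A) (p s : ι), ∑ a, P p a * (Q * M) a s = M p s := by
    intro M p s
    rw [← Matrix.mul_apply, ← Matrix.mul_assoc, h.mul_inv, Matrix.one_mul]
  ext s t
  simp only [ricci, Matrix.of_apply, e, Matrix.sum_apply, Matrix.smul_apply, smul_eq_mul]
  rw [Finset.sum_comm]
  have : ∀ p, ∑ a, ∑ q, P p a * P q t * (Q * curv d C p q * P) a s =
      ∑ q, P q t * (curv d C p q * P) p s := by
    intro p
    rw [Finset.sum_comm]
    refine Finset.sum_congr rfl fun q _ => ?_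
    rw [← tr (curv d C p q * P), Finset.mul_sum]
    refine Finset.sum_congr rfl fun a _ => ?_
    rw [Matrix.mul_assoc]; ring
  simp only [this]
  simp only [Matrix.mul_apply, Matrix.transpose_apply, Matrix.of_apply, Finset.sum_mul,
    Finset.mul_sum]
  rw [Finset.sum_comm]
  refine Finset.sum_congr rfl fun q _ => ?_
  rw [Finset.sum_comm]
  refine Finset.sum_congr rfl fun m _ => Finset.sum_congr rfl fun p _ => ?_
  ring

/-- The transformation law of the covariant derivative. -/
theorem nabla_eq (hC : ∀ i, P * C' i = (∑ p, P p i • C p) * P + P.map (d' i))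
    (H : Matrix ι ι A) (i : ι) :
    P * nabla d' C' H i * Pᵀ = ∑ p, P p i • nabla d C (P * H * Pᵀ) p := by
  have e : ∑ p, P p i • nabla d C (P * H * Pᵀ) p = (P * H * Pᵀ).map (d' i) +
      (∑ p, P p i • C p) * (P * H * Pᵀ) + (P * H * Pᵀ) * (∑ p, P p i • C p)ᵀ := by
    rw [h.map_frame]
    simp only [nabla, smul_add, Finset.sum_add_distrib, Matrix.sum_mul, Matrix.mul_sum,
      Matrix.transpose_sum, Matrix.transpose_smul, Matrix.smul_mul, Matrix.mul_smul]
  have hCt : (C' i)ᵀ * Pᵀ = Pᵀ * (∑ p, P p i • C p)ᵀ + (P.map (d' i))ᵀ := by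
    rw [← Matrix.transpose_mul, hC, Matrix.transpose_add, Matrix.transpose_mul]
  rw [e, map_mul, map_mul]
  have : (Pᵀ).map (d' i) = (P.map (d' i))ᵀ := rfl
  rw [this]
  have l : P * nabla d' C' H i * Pᵀ = P * H.map (d' i) * Pᵀ + (P * C' i) * H * Pᵀ +
      P * H * ((C' i)ᵀ * Pᵀ) := by
    simp only [nabla, Matrix.mul_add, Matrix.add_mul, Matrix.mul_assoc]
  rw [l, hC, hCt]
  simp only [Matrix.mul_add, Matrix.add_mul, Matrix.mul_assoc]
  abel

/-- The transformation law of the second covariant derivative. -/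
theorem nabla2_eq (hC : ∀ i, P * C' i = (∑ p, P p i • C p) * P + P.map (d' i))
    (H : Matrix ι ι A) (j i : ι) :
    P * nabla2 d' C' H j i * Pᵀ =
      ∑ p, ∑ q, (P p j * P q i) • nabla2 d C (P * H * Pᵀ) p q := by
  have e1 : P * nabla d' C' (nabla d' C' H i) j * Pᵀ =
      ∑ q, d' j (P q i) • nabla d C (P * H * Pᵀ) q +
      ∑ p, ∑ q, (P p j * P q i) • nabla d C (nabla d C (P * H * Pᵀ) q) p := by
    rw [h.nabla_eq hC, h.nabla_eq hC]
    have r : ∀ p, nabla d C (∑ q, P q i • nabla d C (P * H * Pᵀ) q) p =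
        ∑ q, (d p (P q i) • nabla d C (P * H * Pᵀ) q +
          P q i • nabla d C (nabla d C (P * H * Pᵀ) q) p) := by
      intro p
      conv_lhs => rw [nabla, map_sum']
      simp only [Matrix.sum_mul, Matrix.mul_sum, Matrix.smul_mul, Matrix.mul_smul, map_smul',
        ← Finset.sum_add_distrib]
      refine Finset.sum_congr rfl fun q _ => ?_
      conv_rhs => rw [nabla.eq_1 d C (nabla d C (P * H * Pᵀ) q) p]
      simp only [smul_add]
      abel
    simp only [r, h.frame j, smul_add, Finset.smul_sum, Finset.sum_add_distrib, smul_smul,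
      Finset.sum_smul]
    congr 1
    rw [Finset.sum_comm]
  have e2 : P * (∑ k, C' j k i • nabla d' C' H k) * Pᵀ =
      ∑ q, (P * C' j) q i • nabla d C (P * H * Pᵀ) q := by
    rw [Matrix.mul_sum, Matrix.sum_mul]
    simp only [Matrix.mul_smul, Matrix.smul_mul, h.nabla_eq hC, Finset.smul_sum, smul_smul]
    rw [Finset.sum_comm]
    refine Finset.sum_congr rfl fun q _ => ?_
    rw [Matrix.mul_apply, Finset.sum_smul]
    refine Finset.sum_congr rfl fun k _ => ?_
    rw [mul_comm]
  rw [nabla2, Matrix.mul_sub, Matrix.sub_mul, e1, e2]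
  -- The inhomogeneous term of the connection law, applied to the differentiation index `i`, cancels
  -- the derivatives of `P` that appear in `e1`.
  simp only [hC, Matrix.add_apply, Matrix.map_apply, add_smul, Finset.sum_add_distrib]
  have e3 : ∑ q, ((∑ p, P p j • C p) * P) q i • nabla d C (P * H * Pᵀ) q =
      ∑ p, ∑ q, (P p j * P q i) • ∑ k, C p k q • nabla d C (P * H * Pᵀ) k := by
    simp only [Matrix.mul_apply, Matrix.sum_apply, Matrix.smul_apply, Finset.sum_smul,
      Finset.sum_mul, Finset.smul_sum, smul_smul, smul_eq_mul]
    rw [Finset.sum_comm_cycle]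
    refine Finset.sum_congr rfl fun p _ => ?_
    rw [Finset.sum_comm]
    refine Finset.sum_congr rfl fun q _ => Finset.sum_congr rfl fun k _ => ?_
    congr 1; ring
  rw [e3]
  simp only [nabla2, smul_sub, Finset.sum_sub_distrib]
  abel

end FrameChange

end FrameCalculus

namespace FrameCalculus
open Matrix
variable {A ι : Type*} [CommRing A] [Algebra ℝ A] [Fintype ι] [DecidableEq ι]
namespace FrameChange

variable {d d' : ι → Derivation ℝ A A} {P Q : Matrix ι ι A} (h : FrameChange d d' P Q)
  {C C' : ι → Matrix ι ι A}
include h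

/-- The transformation law of the rough Laplacian. -/
theorem rough_eq (hC : ∀ i, P * C' i = (∑ p, P p i • C p) * P + P.map (d' i))
    (Gi H : Matrix ι ι A) :
    P * rough d' C' Gi H * Pᵀ = rough d C (P * Gi * Pᵀ) (P * H * Pᵀ) := by
  have e : P * rough d' C' Gi H * Pᵀ = ∑ i, ∑ j, ∑ p, ∑ q,
      (Gi i j * (P p i * P q j)) • nabla2 d C (P * H * Pᵀ) p q := by
    simp only [rough, Matrix.mul_sum, Matrix.sum_mul, Matrix.mul_smul, Matrix.smul_mul,
      h.nabla2_eq hC, Finset.smul_sum, smul_smul]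
  have e2 : ∀ p q, (P * Gi * Pᵀ) p q = ∑ i, ∑ j, Gi i j * (P p i * P q j) := by
    intro p q
    simp only [Matrix.mul_apply, Matrix.transpose_apply, Finset.sum_mul]
    rw [Finset.sum_comm]
    exact Finset.sum_congr rfl fun i _ => Finset.sum_congr rfl fun j _ => by ring
  rw [e, rough]
  simp only [e2, Finset.sum_smul]
  rw [Finset.sum_comm_cycle]
  refine Finset.sum_congr rfl fun p _ => ?_
  rw [Finset.sum_comm_cycle]

/-- The transformation law of the curvature action on `2`-tensors. -/
theorem riem_eq (hC : ∀ i, P * C' i = (∑ p, P p i • C p) * P + P.map (d' i))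
    (Gi H : Matrix ι ι A) :
    P * riem d' C' Gi H * Pᵀ = riem d C (P * Gi * Pᵀ) (P * H * Pᵀ) := by
  have e : ∀ c t, P * (curv d' C' c t * H) = ∑ p, ∑ q, (P p c * P q t) • (curv d C p q * P * H) := by
    intro c t
    rw [← Matrix.mul_assoc, h.mul_curv hC]
    simp only [Matrix.sum_mul, Matrix.smul_mul]
  ext a b
  have l : (P * riem d' C' Gi H * Pᵀ) a b =
      ∑ n, ∑ c, ∑ t, P b n * Gi n c * (P * (curv d' C' c t * H)) a t := by
    rw [Matrix.mul_apply]
    refine Finset.sum_congr rfl fun n _ => ?_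
    rw [Matrix.mul_apply]
    simp only [riem, Matrix.of_apply, Matrix.mul_apply (M := P) (N := curv d' C' _ _ * H),
      Finset.sum_mul, Finset.mul_sum, Matrix.transpose_apply]
    rw [Finset.sum_comm_cycle]
    rw [Finset.sum_comm_cycle]
    exact Finset.sum_congr rfl fun c _ => Finset.sum_congr rfl fun t _ =>
      Finset.sum_congr rfl fun m _ => by ring
  have l2 : ∀ c, ∑ t, (P * (curv d' C' c t * H)) a t =
      ∑ p, ∑ q, P p c * (curv d C p q * (P * H * Pᵀ)) a q := by
    intro c
    simp only [e, Matrix.sum_apply, Matrix.smul_apply, smul_eq_mul]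
    rw [Finset.sum_comm]
    refine Finset.sum_congr rfl fun p _ => ?_
    rw [Finset.sum_comm]
    refine Finset.sum_congr rfl fun q _ => ?_
    rw [← Matrix.mul_assoc, ← Matrix.mul_assoc, Matrix.mul_apply (N := Pᵀ), Finset.mul_sum]
    exact Finset.sum_congr rfl fun m _ => by rw [Matrix.transpose_apply]; ring
  rw [l]
  simp only [← Finset.mul_sum, l2]
  simp only [riem, Matrix.of_apply]
  have r : ∀ p, (P * Gi * Pᵀ) b p = ∑ n, ∑ c, P b n * Gi n c * P p c := by
    intro p
    simp only [Matrix.mul_apply, Matrix.transpose_apply, Finset.sum_mul]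
    rw [Finset.sum_comm]
  simp only [r, ← Finset.mul_sum]
  simp only [Finset.mul_sum, Finset.sum_mul]
  have c1 : ∀ n, ∑ c, ∑ p, ∑ q, P b n * Gi n c * (P p c * (curv d C p q * (P * H * Pᵀ)) a q) =
      ∑ p, ∑ q, ∑ c, P b n * Gi n c * P p c * (curv d C p q * (P * H * Pᵀ)) a q := by
    intro n
    rw [← Finset.sum_comm_cycle]
    rw [← Finset.sum_comm_cycle]
    rw [← Finset.sum_comm_cycle]
    rw [← Finset.sum_comm_cycle]
    exact Finset.sum_congr rfl fun c _ => Finset.sum_congr rfl fun t _ =>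
      Finset.sum_congr rfl fun m _ => by ring
  simp only [c1]
  rw [Finset.sum_comm]
  refine Finset.sum_congr rfl fun p _ => ?_
  rw [Finset.sum_comm]

/-- The transformation law of the Lichnerowicz Laplacian. -/
theorem lich_eq (hC : ∀ i, P * C' i = (∑ p, P p i • C p) * P + P.map (d' i))
    (Gi H : Matrix ι ι A) :
    P * lich d' C' Gi H * Pᵀ = lich d C (P * Gi * Pᵀ) (P * H * Pᵀ) := by
  have e : P * (Gi * ricci d' C' * H) * Pᵀ = (P * Gi * Pᵀ) * ricci d C * (P * H * Pᵀ) := by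
    rw [h.ricci_eq hC]; simp only [Matrix.mul_assoc]
  have e2 : P * (H * (Gi * ricci d' C')ᵀ) * Pᵀ =
      (P * H * Pᵀ) * ((P * Gi * Pᵀ) * ricci d C)ᵀ := by
    rw [h.ricci_eq hC]
    simp only [Matrix.mul_assoc, Matrix.transpose_mul, Matrix.transpose_transpose]
  rw [lich, lich, ← h.rough_eq hC, ← h.riem_eq hC, ← e, ← e2]
  simp only [Matrix.mul_add, Matrix.mul_sub, Matrix.add_mul, Matrix.sub_mul, two_smul]

/-- The transformation law of the scalar curvature. -/
theorem scalar_eq (hC : ∀ i, P * C' i = (∑ p, P p i • C p) * P + P.map (d' i))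
    (Gi : Matrix ι ι A) : scalar d' C' Gi = scalar d C (P * Gi * Pᵀ) := by
  have e : ∀ (M N : Matrix ι ι A), ∑ s, ∑ t, M s t * N s t = (M * Nᵀ).trace := by
    intro M N; simp [Matrix.trace, Matrix.mul_apply]
  rw [scalar, scalar, e, e, h.ricci_eq hC, Matrix.transpose_mul, Matrix.transpose_mul,
    Matrix.transpose_transpose, Matrix.mul_assoc P, Matrix.mul_assoc P, Matrix.trace_mul_comm P]
  simp only [Matrix.mul_assoc]

/-- The transformation law of the divergence. -/
theorem div_eq (hC : ∀ i, P * C' i = (∑ p, P p i • C p) * P + P.map (d' i))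
    (H : Matrix ι ι A) (b : ι) :
    ∑ c, P b c * div d' C' H c = div d C (P * H * Pᵀ) b := by
  have e : ∀ a, P * nabla d' C' H a = ∑ p, P p a • (nabla d C (P * H * Pᵀ) p * Qᵀ) := by
    intro a
    have := congrArg (· * Qᵀ) (h.nabla_eq hC H a)
    simp only [Matrix.mul_assoc, ← Matrix.transpose_mul, h.inv_mul] at this
    rw [Matrix.transpose_one, Matrix.mul_one] at this
    rw [this]
    simp only [Matrix.sum_mul, Matrix.smul_mul, Matrix.mul_assoc]
  have e1 : ∀ a, nabla d' C' H a = ∑ p, P p a • (Q * nabla d C (P * H * Pᵀ) p * Qᵀ) := by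
    intro a
    have := congrArg (Q * ·) (e a)
    simp only [← Matrix.mul_assoc, h.inv_mul, Matrix.one_mul] at this
    rw [this]
    simp only [Matrix.mul_sum, Matrix.mul_smul, Matrix.mul_assoc]
  have e2 : ∀ c, div d' C' H c = ∑ p, (nabla d C (P * H * Pᵀ) p * Qᵀ) p c := by
    intro c
    simp only [div, e1, Matrix.sum_apply, Matrix.smul_apply, smul_eq_mul]
    rw [Finset.sum_comm]
    refine Finset.sum_congr rfl fun p _ => ?_
    rw [← Matrix.mul_apply, Matrix.mul_assoc Q, ← Matrix.mul_assoc P, h.mul_inv, Matrix.one_mul]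
  simp only [e2, Finset.mul_sum]
  rw [Finset.sum_comm]
  refine Finset.sum_congr rfl fun p _ => ?_
  have : (nabla d C (P * H * Pᵀ) p * Qᵀ * Pᵀ) p b = nabla d C (P * H * Pᵀ) p p b := by
    rw [Matrix.mul_assoc, ← Matrix.transpose_mul, h.mul_inv, Matrix.transpose_one, Matrix.mul_one]
  rw [← this, Matrix.mul_apply (N := Pᵀ)]
  exact Finset.sum_congr rfl fun c _ => by rw [Matrix.transpose_apply, mul_comm]

theorem conj_inv (B : Matrix ι ι A) : P * (Q * B * Qᵀ) * Pᵀ = B := by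
  calc P * (Q * B * Qᵀ) * Pᵀ = (P * Q) * B * (P * Q)ᵀ := by
        simp only [Matrix.mul_assoc, Matrix.transpose_mul]
    _ = B := by rw [h.mul_inv, Matrix.one_mul, Matrix.transpose_one, Matrix.mul_one]

theorem conj_inv' (B : Matrix ι ι A) : Q * (P * B * Pᵀ) * Qᵀ = B := by
  calc Q * (P * B * Pᵀ) * Qᵀ = (Q * P) * B * (Q * P)ᵀ := by
        simp only [Matrix.mul_assoc, Matrix.transpose_mul]
    _ = B := by rw [h.inv_mul, Matrix.one_mul, Matrix.transpose_one, Matrix.mul_one]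

/-- The law is solved for the new frame, so that the inverse metric and the tensor occur there as `Q
* Gi * Qᵀ` and `Q * H * Qᵀ`, the form used in `mul_conn`. -/
theorem lich_eq' (hC : ∀ i, P * C' i = (∑ p, P p i • C p) * P + P.map (d' i))
    (Gi H : Matrix ι ι A) :
    lich d' C' (Q * Gi * Qᵀ) (Q * H * Qᵀ) = Q * lich d C Gi H * Qᵀ := by
  rw [← h.conj_inv' (lich d' C' (Q * Gi * Qᵀ) (Q * H * Qᵀ)), h.lich_eq hC, h.conj_inv, h.conj_inv]

theorem div_eq' (hC : ∀ i, P * C' i = (∑ p, P p i • C p) * P + P.map (d' i))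
    (H : Matrix ι ι A) (b : ι) :
    div d' C' (Q * H * Qᵀ) b = ∑ c, Q b c * div d C H c := by
  have e : P.mulVec (div d' C' (Q * H * Qᵀ)) = div d C H := by
    funext c
    rw [Matrix.mulVec, dotProduct, h.div_eq hC, h.conj_inv]
  change _ = Q.mulVec (div d C H) b
  rw [← e, Matrix.mulVec_mulVec, h.inv_mul, Matrix.one_mulVec]

end FrameChange

end FrameCalculus

/-! ### Normal frames: values of the tensor operations at the distinguished point. -/

namespace FrameCalculus
open Matrix

/-- At the point `ev` the commuting frame `d` is normal for the metric `G`: the metric is the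
identity there, and its first derivatives vanish. -/
structure IsNormalAt {A ι : Type*} [CommRing A] [Algebra ℝ A] [Fintype ι] [DecidableEq ι]
    (ev : A →ₐ[ℝ] ℝ) (d : ι → Derivation ℝ A A) (G Gi : Matrix ι ι A) : Prop where
  comm : ∀ i j f, d i (d j f) = d j (d i f)
  symm : Gᵀ = G
  mul_inv : G * Gi = 1
  ev_metric : ∀ i j, ev (G i j) = (1 : Matrix ι ι ℝ) i j
  ev_deriv : ∀ k i j, ev (d k (G i j)) = 0

namespace IsNormalAt

variable {A ι : Type*} [CommRing A] [Algebra ℝ A] [Fintype ι] [DecidableEq ι]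
  {ev : A →ₐ[ℝ] ℝ} {d : ι → Derivation ℝ A A} {G Gi : Matrix ι ι A}
  (h : IsNormalAt ev d G Gi)
include h

theorem ev_inv (i j : ι) : ev (Gi i j) = (1 : Matrix ι ι ℝ) i j := by
  have h1 : G.map ev = 1 := by ext i j; exact h.ev_metric i j
  have h2 : (G * Gi).map ev = 1 := by
    rw [h.mul_inv]; exact Matrix.map_one _ (map_zero ev) (map_one ev)
  have h3 : (G * Gi).map ev = G.map ev * Gi.map ev := by
    ext i j; simp [Matrix.mul_apply]
  rw [h3, h1, Matrix.one_mul] at h2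
  exact congrFun (congrFun h2 i) j

theorem ev_deriv_inv (k i j : ι) : ev (d k (Gi i j)) = 0 := by
  have h1 : G.map (d k) * Gi + G * Gi.map (d k) = 0 := by
    rw [← map_mul, h.mul_inv, map_one']
  have h2 := congrArg ev (congrFun (congrFun h1 i) j)
  simpa [Matrix.mul_apply, h.ev_deriv, h.ev_metric, Matrix.one_apply] using h2

theorem ev_conn (i k j : ι) : ev (conn d G Gi i k j) = 0 := by
  simp [conn, h.ev_deriv]

theorem ev_d_conn (l i k j : ι) : ev (d l (conn d G Gi i k j)) =
    (1 / 2) * (ev (d l (d i (G j k))) + ev (d l (d j (G i k))) - ev (d l (d k (G i j)))) := by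
  simp [conn, h.ev_deriv, h.ev_inv, Matrix.one_apply]

/-- Every Leibniz term in which `Gi` is differentiated contains a first derivative of `G` or of
`Gi`, hence vanishes at the point; only third derivatives of `G` survive. -/
theorem ev_d_d_conn (m l i k j : ι) : ev (d m (d l (conn d G Gi i k j))) =
    (1 / 2) * (ev (d m (d l (d i (G j k)))) + ev (d m (d l (d j (G i k))))
      - ev (d m (d l (d k (G i j))))) := by
  simp [conn, h.ev_deriv, h.ev_inv, h.ev_deriv_inv, Matrix.one_apply]

/-- The time derivative of `Gi` is multiplied by first derivatives of `G`, which vanish at the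
point, so it never has to be computed. -/
theorem ev_tau_conn {τ : Derivation ℝ A A} (hτ : ∀ i f, τ (d i f) = d i (τ f)) (i k j : ι) :
    ev (τ (conn d G Gi i k j)) =
    (1 / 2) * (ev (d i (τ (G j k))) + ev (d j (τ (G i k))) - ev (d k (τ (G i j)))) := by
  simp [conn, h.ev_deriv, h.ev_inv, Matrix.one_apply, hτ]

theorem ev_nabla (H : Matrix ι ι A) (i a b : ι) :
    ev (nabla d (conn d G Gi) H i a b) = ev (d i (H a b)) := by
  simp [nabla, Matrix.mul_apply, h.ev_conn]

theorem ev_d_nabla (H : Matrix ι ι A) (l i a b : ι) :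
    ev (d l (nabla d (conn d G Gi) H i a b)) = ev (d l (d i (H a b))) +
      ∑ k, (ev (d l (conn d G Gi i a k)) * ev (H k b) +
        ev (d l (conn d G Gi i b k)) * ev (H a k)) := by
  simp [nabla, Matrix.mul_apply, h.ev_conn, Finset.sum_add_distrib, mul_comm, add_assoc]

theorem ev_d_d_nabla (H : Matrix ι ι A) (m l i a b : ι) :
    ev (d m (d l (nabla d (conn d G Gi) H i a b))) = ev (d m (d l (d i (H a b)))) +
      ∑ k, (ev (d m (d l (conn d G Gi i a k))) * ev (H k b) +
        ev (d l (conn d G Gi i a k)) * ev (d m (H k b)) +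
        ev (d m (conn d G Gi i a k)) * ev (d l (H k b)) +
        ev (d m (d l (conn d G Gi i b k))) * ev (H a k) +
        ev (d l (conn d G Gi i b k)) * ev (d m (H a k)) +
        ev (d m (conn d G Gi i b k)) * ev (d l (H a k))) := by
  simp [nabla, Matrix.mul_apply, h.ev_conn, Finset.sum_add_distrib, mul_comm]
  ring

theorem ev_curv (i j a s : ι) : ev (curv d (conn d G Gi) i j a s) =
    ev (d i (conn d G Gi j a s)) - ev (d j (conn d G Gi i a s)) := by
  simp [curv, Matrix.mul_apply, h.ev_conn]

theorem ev_d_curv (m i j a s : ι) : ev (d m (curv d (conn d G Gi) i j a s)) =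
    ev (d m (d i (conn d G Gi j a s))) - ev (d m (d j (conn d G Gi i a s))) := by
  simp [curv, Matrix.mul_apply, h.ev_conn]

omit [DecidableEq ι] h in
theorem ev_ricci (s t : ι) : ev (ricci d (conn d G Gi) s t) =
    ∑ a, ev (curv d (conn d G Gi) a t a s) := by
  simp [ricci]

omit [DecidableEq ι] h in
theorem ev_d_ricci (m s t : ι) : ev (d m (ricci d (conn d G Gi) s t)) =
    ∑ a, ev (d m (curv d (conn d G Gi) a t a s)) := by
  simp [ricci]

theorem ev_scalar : ev (scalar d (conn d G Gi) Gi) = ∑ s, ev (ricci d (conn d G Gi) s s) := by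
  simp [scalar, h.ev_inv, Matrix.one_apply]

theorem ev_d_scalar (m : ι) : ev (d m (scalar d (conn d G Gi) Gi)) =
    ∑ s, ev (d m (ricci d (conn d G Gi) s s)) := by
  simp [scalar, h.ev_inv, h.ev_deriv_inv, Matrix.one_apply]

theorem ev_d_nabla2 (H : Matrix ι ι A) (m j i a b : ι) :
    ev (d m (nabla2 d (conn d G Gi) H j i a b)) =
      ev (d m (d j (nabla d (conn d G Gi) H i a b))) +
      ∑ k, (ev (d m (conn d G Gi j a k)) * ev (d i (H k b)) +
        ev (d m (conn d G Gi j b k)) * ev (d i (H a k)) -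
        ev (d m (conn d G Gi j k i)) * ev (d k (H a b))) := by
  simp only [nabla2, Matrix.sub_apply, Matrix.sum_apply, Matrix.smul_apply, map_sub, h.ev_d_nabla,
    map_sum, smul_eq_mul, Derivation.leibniz, map_add, _root_.map_mul, h.ev_conn, h.ev_nabla,
    zero_mul, zero_add, Finset.sum_const_zero, Finset.sum_add_distrib, Finset.sum_sub_distrib]
  rw [add_sub_assoc]
  simp only [mul_comm]

theorem ev_rough (H : Matrix ι ι A) (a b : ι) :
    ev (rough d (conn d G Gi) Gi H a b) = ∑ i, ev (d i (nabla d (conn d G Gi) H i a b)) := by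
  simp [rough, nabla2, Matrix.sum_apply, h.ev_inv, Matrix.one_apply, h.ev_conn, h.ev_nabla]

theorem ev_d_rough (H : Matrix ι ι A) (m a b : ι) :
    ev (d m (rough d (conn d G Gi) Gi H a b)) =
      ∑ i, ev (d m (nabla2 d (conn d G Gi) H i i a b)) := by
  simp [rough, Matrix.sum_apply, h.ev_inv, h.ev_deriv_inv, Matrix.one_apply]

theorem ev_d_ricci_mul (H : Matrix ι ι A) (m a b : ι) :
    ev (d m ((Gi * ricci d (conn d G Gi) * H) a b)) =
      ∑ s, (ev (ricci d (conn d G Gi) a s) * ev (d m (H s b)) +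
        ev (d m (ricci d (conn d G Gi) a s)) * ev (H s b)) := by
  have e : ∀ x y, ev ((Gi * ricci d (conn d G Gi)) x y) = ev (ricci d (conn d G Gi) x y) := by
    intro x y
    simp [Matrix.mul_apply, h.ev_inv, Matrix.one_apply]
  have e1 : ∀ x y, ev (d m ((Gi * ricci d (conn d G Gi)) x y)) =
      ev (d m (ricci d (conn d G Gi) x y)) := by
    intro x y
    simp [Matrix.mul_apply, h.ev_inv, h.ev_deriv_inv, Matrix.one_apply]
  rw [Matrix.mul_apply]
  simp only [Derivation.leibniz, map_sum, smul_eq_mul, map_add, _root_.map_mul, e, e1]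
  exact Finset.sum_congr rfl fun s _ => by ring

theorem ev_riem (H : Matrix ι ι A) (a b : ι) :
    ev (riem d (conn d G Gi) Gi H a b) =
      ∑ t, ∑ s, ev (curv d (conn d G Gi) b t a s) * ev (H s t) := by
  simp [riem, Matrix.mul_apply, h.ev_inv, Matrix.one_apply]

theorem ev_d_riem (H : Matrix ι ι A) (m a b : ι) :
    ev (d m (riem d (conn d G Gi) Gi H a b)) =
      ∑ t, ∑ s, (ev (curv d (conn d G Gi) b t a s) * ev (d m (H s t)) +
        ev (d m (curv d (conn d G Gi) b t a s)) * ev (H s t)) := by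
  simp [riem, Matrix.mul_apply, h.ev_inv, h.ev_deriv_inv, Matrix.one_apply,
    Finset.sum_add_distrib, mul_comm]
  exact add_comm _ _

theorem ev_div (H : Matrix ι ι A) (b : ι) :
    ev (div d (conn d G Gi) H b) = ∑ a, ev (d a (H a b)) := by
  simp [div, h.ev_nabla]

omit [DecidableEq ι] h in
theorem ev_d_d_div (H : Matrix ι ι A) (m l b : ι) :
    ev (d m (d l (div d (conn d G Gi) H b))) =
      ∑ a, ev (d m (d l (nabla d (conn d G Gi) H a a b))) := by
  simp [div]

theorem ev_tau_div {τ : Derivation ℝ A A} (hτ : ∀ i f, τ (d i f) = d i (τ f))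
    (H : Matrix ι ι A) (b : ι) :
    ev (τ (div d (conn d G Gi) H b)) = ∑ a, (ev (d a (τ (H a b))) +
      ∑ k, (ev (τ (conn d G Gi a a k)) * ev (H k b) +
        ev (τ (conn d G Gi a b k)) * ev (H a k))) := by
  simp [div, nabla, Matrix.mul_apply, h.ev_conn, hτ, Finset.sum_add_distrib, mul_comm, add_assoc]

/-- Symmetry of `H` makes the second Ricci term the transpose of the first, so one formula serves
for both. -/
theorem ev_d_lich {H : Matrix ι ι A} (hH : Hᵀ = H) (m a b : ι) :
    ev (d m (lich d (conn d G Gi) Gi H a b)) =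
      ∑ i, ev (d m (nabla2 d (conn d G Gi) H i i a b)) -
      ∑ s, (ev (ricci d (conn d G Gi) a s) * ev (d m (H s b)) +
        ev (d m (ricci d (conn d G Gi) a s)) * ev (H s b)) -
      ∑ s, (ev (ricci d (conn d G Gi) b s) * ev (d m (H s a)) +
        ev (d m (ricci d (conn d G Gi) b s)) * ev (H s a)) +
      2 * ∑ t, ∑ s, (ev (curv d (conn d G Gi) b t a s) * ev (d m (H s t)) +
        ev (d m (curv d (conn d G Gi) b t a s)) * ev (H s t)) := by
  have e : (H * (Gi * ricci d (conn d G Gi))ᵀ) a b = (Gi * ricci d (conn d G Gi) * H) b a := by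
    conv_lhs => rw [← hH, ← Matrix.transpose_mul, Matrix.transpose_apply]
  rw [lich, two_smul, Matrix.add_apply, Matrix.sub_apply, Matrix.sub_apply, e, Matrix.add_apply]
  simp only [map_add, map_sub, h.ev_d_rough, h.ev_d_ricci_mul, h.ev_d_riem]
  ring

end IsNormalAt

end FrameCalculus

/-! ### The commutation identity for the divergence in dimension three. -/

namespace FrameCalculus
open Matrix
namespace IsNormalAt
variable {A : Type*} [CommRing A] [Algebra ℝ A]
  {ev : A →ₐ[ℝ] ℝ} {d : Fin 3 → Derivation ℝ A A} {G Gi : Matrix (Fin 3) (Fin 3) A}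
  (h : IsNormalAt ev d G Gi)
include h

set_option maxHeartbeats 4000000 in
/-- The divergence of `-∂H/∂τ - Δ_L H + R H` along the Ricci flow, in a normal frame. -/
theorem ev_div_conj {τ : Derivation ℝ A A} (hτ : ∀ i f, τ (d i f) = d i (τ f))
    (hG : ∀ i j, τ (G i j) = (-2 : ℝ) • ricci d (conn d G Gi) i j)
    {H : Matrix (Fin 3) (Fin 3) A} (hH : Hᵀ = H) (b : Fin 3) :
    ev (div d (conn d G Gi) (-(H.map τ) - lich d (conn d G Gi) Gi H +
        scalar d (conn d G Gi) Gi • H) b) =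
      -ev (τ (div d (conn d G Gi) H b)) -
      ∑ i, (ev (d i (d i (div d (conn d G Gi) H b))) +
        ∑ k, ev (d i (conn d G Gi i b k)) * ev (div d (conn d G Gi) H k)) +
      ∑ k, ev (ricci d (conn d G Gi) b k) * ev (div d (conn d G Gi) H k) +
      ev (scalar d (conn d G Gi) Gi) * ev (div d (conn d G Gi) H b) := by
  have hs : ∀ i j, G i j = G j i := fun i j => congrFun (congrFun h.symm j) i
  have hHs : ∀ i j, H i j = H j i := fun i j => congrFun (congrFun hH j) i
  -- Everything is expanded into values at the point of partial derivatives, of order at most three,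
  -- of `G`, `H` and `τ H`. The Ricci flow enters through `hG`, which replaces the time derivative
  -- of the Christoffel symbols by derivatives of the Ricci tensor.
  simp only [h.ev_div, Matrix.add_apply, Matrix.sub_apply, Matrix.neg_apply, Matrix.smul_apply,
    Matrix.map_apply, map_add, map_sub, map_neg, smul_eq_mul, Derivation.leibniz, _root_.map_mul,
    h.ev_d_lich hH, h.ev_tau_div hτ, ev_d_d_div, h.ev_d_nabla2, h.ev_d_d_nabla, h.ev_tau_conn hτ,
    hG, map_smul, Derivation.map_smul, ev_d_ricci, ev_ricci, h.ev_scalar, h.ev_d_scalar,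
    h.ev_d_curv, h.ev_curv, h.ev_d_d_conn, h.ev_d_conn]
  simp only [Fin.sum_univ_three]
  -- Symmetry of `G` and `H` and commutation of the derivations bring indices into a fixed order, so
  -- that equal derivatives become the same atom and the identity is polynomial.
  have e := h.comm 1 0
  have e' := h.comm 2 0
  have e'' := h.comm 2 1
  fin_cases b <;> simp only [Fin.reduceFinMk, Fin.mk_one, Fin.zero_eta, Fin.isValue] <;>
    rw [hs 1 0, hs 2 0, hs 2 1, hHs 1 0, hHs 2 0, hHs 2 1] <;>
    simp only [e, e', e''] <;>
    ring
end IsNormalAt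
end FrameCalculus

/-! ### Symmetry of the Lichnerowicz Laplacian and the energy identity at a normal point. -/

namespace FrameCalculus
open Matrix
namespace IsNormalAt

/-- At a normal point the curvature is an alternating combination of second derivatives of the
metric, where the pair symmetry is visible. -/
theorem ev_curv_swap {A ι : Type*} [CommRing A] [Algebra ℝ A] [Fintype ι] [DecidableEq ι]
    {ev : A →ₐ[ℝ] ℝ} {d : ι → Derivation ℝ A A} {G Gi : Matrix ι ι A}
    (h : IsNormalAt ev d G Gi) (b t a s : ι) :
    ev (curv d (conn d G Gi) b t a s) = ev (curv d (conn d G Gi) a s b t) := by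
  have hs : ∀ i j, G i j = G j i := fun i j => congrFun (congrFun h.symm j) i
  rw [h.ev_curv, h.ev_curv]
  simp only [h.ev_d_conn]
  rw [h.comm t b, h.comm s a, hs t s, hs b a, h.comm s t, h.comm t a, h.comm s b, h.comm b a,
    hs s b, hs t a]
  ring

/-- The rough Laplacian preserves symmetry, the two Ricci terms are transposes of each other, and
the curvature term is symmetric by `ev_curv_swap`. -/
theorem ev_lich_symm {A ι : Type*} [CommRing A] [Algebra ℝ A] [Fintype ι] [DecidableEq ι]
    {ev : A →ₐ[ℝ] ℝ} {d : ι → Derivation ℝ A A} {G Gi : Matrix ι ι A}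
    (h : IsNormalAt ev d G Gi) {H : Matrix ι ι A} (hH : Hᵀ = H) (a b : ι) :
    ev (lich d (conn d G Gi) Gi H a b) = ev (lich d (conn d G Gi) Gi H b a) := by
  have hs : ∀ i j, H i j = H j i := fun i j => congrFun (congrFun hH j) i
  have e1 : (H * (Gi * ricci d (conn d G Gi))ᵀ) = (Gi * ricci d (conn d G Gi) * H)ᵀ := by
    rw [Matrix.transpose_mul (_ * _) H, hH]
  have e2 : ev (rough d (conn d G Gi) Gi H a b) = ev (rough d (conn d G Gi) Gi H b a) := by
    rw [h.ev_rough, h.ev_rough]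
    refine Finset.sum_congr rfl fun i _ => ?_
    have : ∀ x y, nabla d (conn d G Gi) H i x y = nabla d (conn d G Gi) H i y x := by
      intro x y
      simp only [nabla, Matrix.add_apply, Matrix.map_apply, hs x y, Matrix.mul_apply,
        Matrix.transpose_apply]
      rw [add_assoc, add_assoc]
      congr 1
      rw [add_comm]
      congr 1 <;> exact Finset.sum_congr rfl fun k _ => by rw [mul_comm, hs]
    rw [this]
  have e3 : ev (riem d (conn d G Gi) Gi H a b) = ev (riem d (conn d G Gi) Gi H b a) := by
    rw [h.ev_riem, h.ev_riem, Finset.sum_comm]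
    refine Finset.sum_congr rfl fun t _ => Finset.sum_congr rfl fun s _ => ?_
    rw [h.ev_curv_swap, hs]
  rw [lich, e1, two_smul]
  simp only [Matrix.add_apply, Matrix.sub_apply, map_add, map_sub, Matrix.transpose_apply, e2, e3]
  ring

variable {A : Type*} [CommRing A] [Algebra ℝ A]
  {ev : A →ₐ[ℝ] ℝ} {d : Fin 3 → Derivation ℝ A A} {G Gi : Matrix (Fin 3) (Fin 3) A}
  (h : IsNormalAt ev d G Gi)
include h

/-- The evolution of the squared norm of the divergence of a solution of the conjugate heat
equation along the Ricci flow, in a normal frame. -/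
theorem ev_energy {τ : Derivation ℝ A A} (hτ : ∀ i f, τ (d i f) = d i (τ f))
    (hG : ∀ i j, τ (G i j) = (-2 : ℝ) • ricci d (conn d G Gi) i j)
    {H : Matrix (Fin 3) (Fin 3) A} (hH : Hᵀ = H)
    (hev : -(H.map τ) - lich d (conn d G Gi) Gi H + scalar d (conn d G Gi) Gi • H = 0) :
    ev (τ (∑ b, ∑ c, G b c * (div d (conn d G Gi) H b * div d (conn d G Gi) H c))) +
      ∑ i, ev (d i (d i
        (∑ b, ∑ c, G b c * (div d (conn d G Gi) H b * div d (conn d G Gi) H c)))) =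
      2 * ∑ i, ∑ b, ev (d i (div d (conn d G Gi) H b)) ^ 2 +
      2 * ev (scalar d (conn d G Gi) Gi) *
        ev (∑ b, ∑ c, G b c * (div d (conn d G Gi) H b * div d (conn d G Gi) H c)) := by
  have hs : ∀ i j, G i j = G j i := fun i j => congrFun (congrFun h.symm j) i
  -- Since the conjugate operator annihilates `H`, the commutation identity becomes an evolution
  -- equation for `W`, recorded as `e4`.
  have key := h.ev_div_conj hτ hG hH
  rw [hev] at key
  have z : ∀ b, ev (div d (conn d G Gi) 0 b) = 0 := by intro b; rw [h.ev_div]; simp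
  simp only [z] at key
  generalize scalar d (conn d G Gi) Gi = R at *
  generalize div d (conn d G Gi) H = W at *
  have e1 : ev (τ (∑ b, ∑ c, G b c * (W b * W c))) =
      ∑ b, 2 * ev (W b) * ev (τ (W b)) -
        2 * ∑ b, ∑ c, ev (ricci d (conn d G Gi) b c) * (ev (W b) * ev (W c)) := by
    simp only [map_sum, Derivation.leibniz, smul_eq_mul, map_add, _root_.map_mul, h.ev_metric, hG,
      map_smul, Finset.sum_add_distrib, Matrix.one_apply, ite_mul, one_mul, zero_mul,
      Finset.sum_ite_eq, Finset.mem_univ, if_true, Finset.mul_sum]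
    rw [sub_eq_add_neg, ← Finset.sum_neg_distrib]
    congr 1
    · rw [← Finset.sum_add_distrib]
      exact Finset.sum_congr rfl fun b _ => by ring
    · refine Finset.sum_congr rfl fun b _ => ?_
      rw [← Finset.sum_neg_distrib]
      exact Finset.sum_congr rfl fun c _ => by ring
  have e2 : ∀ i, ev (d i (d i (∑ b, ∑ c, G b c * (W b * W c)))) =
      ∑ b, 2 * ev (W b) * ev (d i (d i (W b))) + 2 * ∑ b, ev (d i (W b)) ^ 2 +
        ∑ b, ∑ c, ev (d i (d i (G b c))) * (ev (W b) * ev (W c)) := by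
    intro i
    simp only [map_sum, Derivation.leibniz, smul_eq_mul, map_add, _root_.map_mul, h.ev_metric,
      h.ev_deriv, Finset.sum_add_distrib, Matrix.one_apply, ite_mul, one_mul, zero_mul,
      Finset.sum_ite_eq, Finset.mem_univ, if_true, Finset.mul_sum, mul_zero, add_zero,
      Finset.sum_const_zero, mul_add]
    simp only [← Finset.sum_add_distrib]
    refine Finset.sum_congr rfl fun b _ => ?_
    have : ∑ c, ev (W b) * ev (W c) * ev (d i (d i (G b c))) =
        ∑ c, ev (d i (d i (G b c))) * (ev (W b) * ev (W c)) :=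
      Finset.sum_congr rfl fun c _ => by ring
    rw [this]; ring
  have e3 : ev (∑ b, ∑ c, G b c * (W b * W c)) = ∑ b, ev (W b) ^ 2 := by
    simp [h.ev_metric, Matrix.one_apply, sq]
  have e4 : ∀ b, ev (τ (W b)) = - ∑ i, (ev (d i (d i (W b))) +
      ∑ k, ev (d i (conn d G Gi i b k)) * ev (W k)) +
      ∑ k, ev (ricci d (conn d G Gi) b k) * ev (W k) + ev R * ev (W b) := by
    intro b
    linarith [key b]
  -- Two cancellations occur: the Ricci term of the metric evolution in `e1` against the one in
  -- `e4`, and the second derivatives of `G` in `e2` against the derivatives of the Christoffel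
  -- symbols in `e4`.
  rw [e1, e3]
  simp only [e2, e4, h.ev_d_conn]
  simp only [Fin.sum_univ_three]
  rw [hs 1 0, hs 2 0, hs 2 1]
  simp only [h.comm 1 0, h.comm 2 0, h.comm 2 1]
  ring
end IsNormalAt
end FrameCalculus

namespace FrameCalculus
open Matrix

/-! ### Identification of the coordinate formulas with the ring calculus. -/

variable {n : ℕ} {A X : Type*} [CommRing A] [Algebra ℝ A]

/-- The points `σ x` of a coordinate space carry the elements of `A` as functions, through the
evaluations `ev x`, and the partial derivatives are given by the derivations `d`. -/
def Realizes (ev : X → A →ₐ[ℝ] ℝ) (σ : X → EuclideanSpace ℝ (Fin n))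
    (d : Fin n → Derivation ℝ A A) : Prop :=
  ∀ (f : EuclideanSpace ℝ (Fin n) → ℝ) (F : A), (∀ x, f (σ x) = ev x F) →
    ∀ i x, Coord.pd i f (σ x) = ev x (d i F)

namespace Realizes

variable {ev : X → A →ₐ[ℝ] ℝ} {σ : X → EuclideanSpace ℝ (Fin n)}
  {d : Fin n → Derivation ℝ A A} (h : Realizes ev σ d)
  {g : EuclideanSpace ℝ (Fin n) → Matrix (Fin n) (Fin n) ℝ} {G Gi : Matrix (Fin n) (Fin n) A}
  (hg : ∀ x i j, g (σ x) i j = ev x (G i j)) (hGi : G * Gi = 1)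

include hg hGi in
theorem inv_eq (x : X) (i j : Fin n) : (g (σ x))⁻¹ i j = ev x (Gi i j) := by
  have h1 : g (σ x) = G.map (ev x) := by ext i j; exact hg x i j
  have h2 : G.map (ev x) * Gi.map (ev x) = 1 := by
    have : (G * Gi).map (ev x) = 1 := by
      rw [hGi]; exact Matrix.map_one _ (map_zero _) (map_one _)
    rw [← this]; ext i j; simp [Matrix.mul_apply]
  rw [h1, Matrix.inv_eq_right_inv h2, Matrix.map_apply]

include h hg hGi

theorem christoffel_eq (x : X) (k i j : Fin n) :
    Coord.christoffel g k i j (σ x) = ev x (conn d G Gi i k j) := by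
  simp only [Coord.christoffel, conn, Matrix.of_apply, map_smul, map_sum, _root_.map_mul, map_add,
    map_sub, smul_eq_mul, inv_eq hg hGi]
  congr 1
  refine Finset.sum_congr rfl fun l _ => ?_
  rw [h _ (G j l) (fun x => hg x j l), h _ (G i l) (fun x => hg x i l),
    h _ (G i j) (fun x => hg x i j)]

theorem riemann_eq (x : X) (a s b t : Fin n) :
    Coord.riemann g a s b t (σ x) = ev x (curv d (conn d G Gi) b t a s) := by
  have e := h.christoffel_eq hg hGi
  simp only [Coord.riemann, curv, Matrix.sub_apply, Matrix.add_apply, Matrix.map_apply,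
    Matrix.mul_apply, map_add, map_sub, map_sum, _root_.map_mul, e, Finset.sum_sub_distrib]
  rw [h _ _ (fun x => e x a t s), h _ _ (fun x => e x a b s)]
  ring

theorem ricci_eq (x : X) (s t : Fin n) :
    Coord.ricci g s t (σ x) = ev x (ricci d (conn d G Gi) s t) := by
  simp only [Coord.ricci, ricci, Matrix.of_apply, map_sum, h.riemann_eq hg hGi]

theorem scalar_eq (x : X) :
    Coord.scalar g (σ x) = ev x (scalar d (conn d G Gi) Gi) := by
  simp only [Coord.scalar, scalar, map_sum, _root_.map_mul, h.ricci_eq hg hGi, inv_eq hg hGi]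

variable {k : EuclideanSpace ℝ (Fin n) → Matrix (Fin n) (Fin n) ℝ} {H : Matrix (Fin n) (Fin n) A}
  (hk : ∀ x i j, k (σ x) i j = ev x (H i j))
include hk

theorem cov_eq (x : X) (i a b : Fin n) :
    Coord.cov g k i a b (σ x) = ev x (nabla d (conn d G Gi) H i a b) := by
  simp only [Coord.cov, nabla, Matrix.add_apply, Matrix.map_apply, Matrix.mul_apply,
    Matrix.transpose_apply, map_add, map_sum, _root_.map_mul, h.christoffel_eq hg hGi, hk,
    Finset.sum_add_distrib]
  rw [h _ _ (fun x => hk x a b), add_assoc]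
  congr 2
  exact Finset.sum_congr rfl fun _ _ => mul_comm _ _

theorem covCov_eq (x : X) (j i a b : Fin n) :
    Coord.covCov g k j i a b (σ x) = ev x (nabla2 d (conn d G Gi) H j i a b) := by
  have e := h.cov_eq hg hGi hk
  simp only [Coord.covCov, nabla2, h.christoffel_eq hg hGi, e]
  rw [h _ _ (fun x => e x i a b)]
  generalize nabla d (conn d G Gi) H = T
  simp only [nabla]
  simp only [Matrix.add_apply, Matrix.sub_apply, Matrix.map_apply, Matrix.mul_apply,
    Matrix.transpose_apply, map_add, map_sub, map_sum, _root_.map_mul, Matrix.sum_apply,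
    Matrix.smul_apply, smul_eq_mul, Finset.sum_add_distrib, Finset.sum_sub_distrib]
  have sw : ∑ k, ev x (T i a k) * ev x (conn d G Gi j b k) =
      ∑ k, ev x (conn d G Gi j b k) * ev x (T i a k) :=
    Finset.sum_congr rfl fun _ _ => mul_comm _ _
  rw [sw]
  ring

theorem divergence_eq (x : X) (b : Fin n) :
    Coord.divergence g k b (σ x) = ev x (div d (conn d G Gi) H b) := by
  simp only [Coord.divergence, div, map_sum, h.cov_eq hg hGi hk]

theorem roughLaplacian_eq (x : X) (a b : Fin n) :
    Coord.roughLaplacian g k a b (σ x) = ev x (rough d (conn d G Gi) Gi H a b) := by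
  simp only [Coord.roughLaplacian, rough, Matrix.sum_apply, Matrix.smul_apply, smul_eq_mul,
    map_sum, _root_.map_mul, inv_eq hg hGi, h.covCov_eq hg hGi hk]

theorem lichnerowicz_eq (x : X) (a b : Fin n) :
    Coord.lichnerowicz g k a b (σ x) = ev x (lich d (conn d G Gi) Gi H a b) := by
  have e : ∑ s, ∑ t, (∑ c, (g (σ x))⁻¹ b c * Coord.riemann g a s c t (σ x)) * k (σ x) s t =
      ev x (riem d (conn d G Gi) Gi H a b) := by
    simp only [riem, Matrix.of_apply, map_sum, _root_.map_mul, Matrix.mul_apply, Finset.mul_sum,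
      Finset.sum_mul, inv_eq hg hGi, h.riemann_eq hg hGi, hk]
    rw [Finset.sum_comm_cycle]
    refine Finset.sum_congr rfl fun c _ => ?_
    rw [Finset.sum_comm]
    exact Finset.sum_congr rfl fun t _ => Finset.sum_congr rfl fun s _ => by ring
  rw [Coord.lichnerowicz, e, h.roughLaplacian_eq hg hGi hk, lich, two_smul]
  simp only [Matrix.add_apply, Matrix.sub_apply, Matrix.mul_apply, Matrix.transpose_apply,
    map_add, map_sub, map_sum, _root_.map_mul, inv_eq hg hGi, h.ricci_eq hg hGi, hk]
  simp only [mul_comm (ev x (H a _))]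
  ring

end Realizes
end FrameCalculus

/-! ### The ring of smooth functions on a set -/

section SmoothFunctions

variable {F : Type*} [NormedAddCommGroup F] [NormedSpace ℝ F]

/-- The extension by zero of a function on `S`. -/
def extendZero {S : Set F} (f : S → ℝ) : F → ℝ := Function.extend Subtype.val f 0

omit [NormedAddCommGroup F] [NormedSpace ℝ F] in
@[simp]
theorem extendZero_coe {S : Set F} (f : S → ℝ) (p : S) : extendZero f p = f p :=
  Subtype.val_injective.extend_apply f 0 p

omit [NormedAddCommGroup F] [NormedSpace ℝ F] in
theorem extendZero_congr {S : Set F} {f : S → ℝ} {f' : F → ℝ} (h : ∀ p : S, f' p = f p) :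
    EqOn (extendZero f) f' S := fun p hp => by
  rw [h ⟨p, hp⟩, ← extendZero_coe f ⟨p, hp⟩]

/-- The ring of functions on `S` that are smooth up to the boundary. -/
def SmoothFn (S : Set F) : Subalgebra ℝ (S → ℝ) where
  carrier := {f | ContDiffOn ℝ ∞ (extendZero f) S}
  mul_mem' {f g} hf hg := (hf.mul hg).congr (extendZero_congr fun p => by simp)
  add_mem' {f g} hf hg := (hf.add hg).congr (extendZero_congr fun p => by simp)
  algebraMap_mem' r := (contDiffOn_const (c := r)).congr (extendZero_congr fun p => by simp)

namespace SmoothFn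

variable {S : Set F}

/-- The restriction to `S` of a function that is smooth on `S`. -/
def ofFun (f : F → ℝ) (hf : ContDiffOn ℝ ∞ f S) : SmoothFn S :=
  ⟨fun p => f p, hf.congr (extendZero_congr fun _ => rfl)⟩

theorem contDiffOn (f : SmoothFn S) : ContDiffOn ℝ ∞ (extendZero f.1) S := f.2

/-- Evaluation at a point. -/
def eval (p : S) : SmoothFn S →ₐ[ℝ] ℝ :=
  (Pi.evalAlgHom ℝ (fun _ : S => ℝ) p).comp (SmoothFn S).val

@[simp]
theorem eval_ofFun (f : F → ℝ) (hf : ContDiffOn ℝ ∞ f S) (p : S) : eval p (ofFun f hf) = f p := rfl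

theorem extendZero_eq_eval (f : SmoothFn S) (p : S) : extendZero f.1 p = eval p f :=
  extendZero_coe _ _

@[ext]
theorem ext_eval {f g : SmoothFn S} (h : ∀ p, eval p f = eval p g) : f = g :=
  Subtype.ext (funext h)

/-- Applied to determinants, this makes metrics and Jacobians invertible as matrices over the ring.
-/
theorem isUnit_of_ne_zero (f : SmoothFn S) (h : ∀ p, eval p f ≠ 0) : IsUnit f := by
  have hc : ContDiffOn ℝ ∞ (fun p => (extendZero f.1 p)⁻¹) S :=
    (contDiffOn f).inv fun p hp => by rw [extendZero_eq_eval f ⟨p, hp⟩]; exact h _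
  refine IsUnit.of_mul_eq_one (ofFun _ hc) ?_
  ext p
  rw [map_mul, eval_ofFun, extendZero_eq_eval, map_one, mul_inv_cancel₀ (h p)]

/-- The derivative in the direction of the constant vector field `v`. -/
def deriv (hS : UniqueDiffOn ℝ S) (v : F) : Derivation ℝ (SmoothFn S) (SmoothFn S) :=
  Derivation.mk'
    { toFun := fun f => ofFun (fun p => fderivWithin ℝ (extendZero f.1) S p v)
        (((contDiffOn f).fderivWithin hS (by simp)).clm_apply contDiffOn_const)
      map_add' := fun f g => by
        ext p
        have hf := (contDiffOn f).differentiableOn (by simp) p p.2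
        have hg := (contDiffOn g).differentiableOn (by simp) p p.2
        have : EqOn (extendZero (f + g).1) (fun q => extendZero f.1 q + extendZero g.1 q) S :=
          extendZero_congr fun q => by simp
        simp only [map_add, eval_ofFun]
        rw [fderivWithin_congr this (this p.2), fderivWithin_fun_add (hS p p.2) hf hg]
        rfl
      map_smul' := fun r f => by
        ext p
        have hf := (contDiffOn f).differentiableOn (by simp) p p.2
        have : EqOn (extendZero (r • f).1) (fun q => r • extendZero f.1 q) S :=
          extendZero_congr fun q => by simp
        simp only [map_smul, eval_ofFun, RingHom.id_apply]
        rw [fderivWithin_congr this (this p.2), fderivWithin_fun_const_smul (hS p p.2) hf]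
        rfl }
    fun f g => by
      ext p
      have hf := (contDiffOn f).differentiableOn (by simp) p p.2
      have hg := (contDiffOn g).differentiableOn (by simp) p p.2
      have : EqOn (extendZero (f * g).1) (fun q => extendZero f.1 q * extendZero g.1 q) S :=
        extendZero_congr fun q => by simp
      simp only [LinearMap.coe_mk, AddHom.coe_mk, eval_ofFun, map_add, smul_eq_mul, map_mul]
      rw [fderivWithin_congr this (this p.2), fderivWithin_fun_mul (hS p p.2) hf hg]
      simp
      rfl

theorem eval_deriv (hS : UniqueDiffOn ℝ S) (v : F) (f : SmoothFn S) (p : S) :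
    eval p (deriv hS v f) = fderivWithin ℝ (extendZero f.1) S p v := rfl

theorem hasFDerivWithinAt (f : SmoothFn S) (p : S) :
    HasFDerivWithinAt (extendZero f.1) (fderivWithin ℝ (extendZero f.1) S p) S p :=
  ((contDiffOn f).differentiableOn (by simp) p p.2).hasFDerivWithinAt

/-- The second derivative within `S` is symmetric at points of `S` that are limits of interior
points. In particular derivatives commute at the end times as well. -/
theorem deriv_comm (hS : UniqueDiffOn ℝ S) (hS' : S ⊆ closure (interior S)) (v w : F)
    (f : SmoothFn S) : deriv hS v (deriv hS w f) = deriv hS w (deriv hS v f) := by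
  ext p
  have e : ∀ v w, eval p (deriv hS v (deriv hS w f)) =
      fderivWithin ℝ (fderivWithin ℝ (extendZero f.1) S) S p v w := by
    intro v w
    have h1 : EqOn (extendZero (deriv hS w f).1)
        (fun q => fderivWithin ℝ (extendZero f.1) S q w) S := extendZero_congr fun q => rfl
    rw [eval_deriv, fderivWithin_congr h1 (h1 p.2), fderivWithin_clm_apply (hS p p.2)
      (((contDiffOn f).fderivWithin (m := 1) hS (by norm_cast)).differentiableOn (by simp) p p.2)
      (differentiableWithinAt_const _)]
    simp
  rw [e, e]
  exact ((contDiffOn f) p p.2).isSymmSndFDerivWithinAt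
    (by rw [minSmoothness_of_isRCLikeNormedField]; exact ENat.LEInfty.out) hS (hS' p.2) p.2 v w

end SmoothFn

end SmoothFunctions

/-! ### Smooth functions on a time interval times an open set -/

namespace Spacetime

open FrameCalculus

variable {n : ℕ} {T : ℝ} {O : Set (EuclideanSpace ℝ (Fin n))}

theorem uniqueDiffOn (hT : 0 < T) (hO : IsOpen O) : UniqueDiffOn ℝ (Icc 0 T ×ˢ O) :=
  (uniqueDiffOn_Icc hT).prod hO.uniqueDiffOn

theorem subset_closure_interior (hT : 0 < T) (hO : IsOpen O) :
    Icc 0 T ×ˢ O ⊆ closure (interior (Icc 0 T ×ˢ O)) := by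
  rw [interior_prod_eq, closure_prod_eq, hO.interior_eq, closure_interior_Icc hT.ne]
  exact prod_mono le_rfl subset_closure

/-- The point `(t, y)`. -/
def pt {t : ℝ} (ht : t ∈ Icc 0 T) (y : O) : ↥(Icc 0 T ×ˢ O) := ⟨(t, y), ht, y.2⟩

/-- The spatial coordinate derivations. -/
def dx (hT : 0 < T) (hO : IsOpen O) (i : Fin n) :
    Derivation ℝ (SmoothFn (Icc 0 T ×ˢ O)) (SmoothFn (Icc 0 T ×ˢ O)) :=
  SmoothFn.deriv (uniqueDiffOn hT hO) (0, EuclideanSpace.single i 1)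

/-- The time derivation. -/
def dt (hT : 0 < T) (hO : IsOpen O) :
    Derivation ℝ (SmoothFn (Icc 0 T ×ˢ O)) (SmoothFn (Icc 0 T ×ˢ O)) :=
  SmoothFn.deriv (uniqueDiffOn hT hO) (1, 0)

variable (hT : 0 < T) (hO : IsOpen O)

theorem dx_comm (i j : Fin n) (f : SmoothFn (Icc 0 T ×ˢ O)) :
    dx hT hO i (dx hT hO j f) = dx hT hO j (dx hT hO i f) :=
  SmoothFn.deriv_comm _ (subset_closure_interior hT hO) _ _ _

theorem dt_dx (i : Fin n) (f : SmoothFn (Icc 0 T ×ˢ O)) :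
    dt hT hO (dx hT hO i f) = dx hT hO i (dt hT hO f) :=
  SmoothFn.deriv_comm _ (subset_closure_interior hT hO) _ _ _

include hO in
/-- The slice of a smooth function at a fixed time is differentiable. -/
theorem hasFDerivAt_slice {t : ℝ} (ht : t ∈ Icc 0 T) (f : EuclideanSpace ℝ (Fin n) → ℝ)
    (F : SmoothFn (Icc 0 T ×ˢ O)) (h : ∀ y : O, f y = SmoothFn.eval (pt ht y) F) (y : O) :
    HasFDerivAt f ((fderivWithin ℝ (extendZero F.1) (Icc 0 T ×ˢ O) (t, y)).comp
      (ContinuousLinearMap.inr ℝ ℝ (EuclideanSpace ℝ (Fin n)))) y := by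
  have h1 := SmoothFn.hasFDerivWithinAt F (pt ht y)
  have h2 : HasFDerivWithinAt (fun z : EuclideanSpace ℝ (Fin n) => (t, z))
      (ContinuousLinearMap.inr ℝ ℝ (EuclideanSpace ℝ (Fin n))) O y :=
    (hasFDerivAt_prodMk_right t (y : EuclideanSpace ℝ (Fin n))).hasFDerivWithinAt
  have h3 := HasFDerivWithinAt.comp (y : EuclideanSpace ℝ (Fin n)) h1 h2
    (fun z hz => ⟨ht, hz⟩)
  refine (h3.hasFDerivAt (hO.mem_nhds y.2)).congr_of_eventuallyEq ?_
  filter_upwards [hO.mem_nhds y.2] with z hz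
  rw [h ⟨z, hz⟩, ← SmoothFn.extendZero_eq_eval]
  rfl

/-- Because `O` is open, partial derivatives of a function at fixed time depend only on its values
on the slice; its behaviour off `O` is irrelevant. -/
theorem realizes {t : ℝ} (ht : t ∈ Icc 0 T) :
    Realizes (fun y : O => SmoothFn.eval (pt ht y)) (fun y : O => (y : EuclideanSpace ℝ (Fin n)))
      (dx hT hO) := by
  intro f F h i y
  rw [Coord.pd, (hasFDerivAt_slice hO ht f F h y).fderiv]
  rfl

theorem hasDerivWithinAt_slice {t : ℝ} (ht : t ∈ Icc 0 T) (y : O) (f : ℝ → ℝ)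
    (F : SmoothFn (Icc 0 T ×ˢ O))
    (h : ∀ s (hs : s ∈ Icc 0 T), f s = SmoothFn.eval (pt hs y) F) :
    HasDerivWithinAt f (SmoothFn.eval (pt ht y) (dt hT hO F)) (Icc 0 T) t := by
  have h1 := SmoothFn.hasFDerivWithinAt F (pt ht y)
  have h2 : HasFDerivWithinAt (fun s : ℝ => (s, (y : EuclideanSpace ℝ (Fin n))))
      (ContinuousLinearMap.inl ℝ ℝ (EuclideanSpace ℝ (Fin n))) (Icc 0 T) t :=
    (hasFDerivAt_prodMk_left t (y : EuclideanSpace ℝ (Fin n))).hasFDerivWithinAt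
  have hm : MapsTo (fun s : ℝ => (s, (y : EuclideanSpace ℝ (Fin n)))) (Icc 0 T)
      (Icc 0 T ×ˢ O) := fun s hs => ⟨hs, y.2⟩
  have h3 := (HasFDerivWithinAt.comp t h1 h2 hm).hasDerivWithinAt
  have e : EqOn f (extendZero F.1 ∘ fun s => (s, (y : EuclideanSpace ℝ (Fin n)))) (Icc 0 T) := by
    intro s hs
    rw [h s hs, ← SmoothFn.extendZero_eq_eval]
    rfl
  exact h3.congr e (e ht)

theorem eval_dt_eq_zero {F : SmoothFn (Icc 0 T ×ˢ O)} {f : EuclideanSpace ℝ (Fin n) → ℝ}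
    (h : ∀ s (hs : s ∈ Icc 0 T) (y : O), SmoothFn.eval (pt hs y) F = f y) : dt hT hO F = 0 := by
  ext p
  obtain ⟨⟨t, y⟩, ht, hy⟩ := p
  have h1 := hasDerivWithinAt_slice hT hO ht ⟨y, hy⟩ (fun _ => f y) F
    (fun s hs => (h s hs ⟨y, hy⟩).symm)
  have h2 := (hasDerivWithinAt_const t (Icc 0 T) (f y))
  have := (uniqueDiffOn_Icc hT t ht).eq_deriv _ h1 h2
  simpa [pt] using this

/-- A smooth function of the space variable. -/
def lift (f : EuclideanSpace ℝ (Fin n) → ℝ) (hf : ContDiffOn ℝ ∞ f O) :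
    SmoothFn (Icc 0 T ×ˢ O) :=
  SmoothFn.ofFun (fun p => f p.2) (hf.comp contDiff_snd.contDiffOn fun _ hp => hp.2)

theorem dt_lift (f : EuclideanSpace ℝ (Fin n) → ℝ) (hf : ContDiffOn ℝ ∞ f O) :
    dt hT hO (lift f hf) = 0 :=
  eval_dt_eq_zero hT hO (f := f) fun _ _ _ => rfl

theorem eval_dx_lift (f : EuclideanSpace ℝ (Fin n) → ℝ) (hf : ContDiffOn ℝ ∞ f O) {t : ℝ}
    (ht : t ∈ Icc 0 T) (y : O) (i : Fin n) :
    SmoothFn.eval (pt ht y) (dx hT hO i (lift f hf)) = Coord.pd i f y :=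
  (realizes hT hO ht f (lift f hf) (fun _ => rfl) i y).symm

end Spacetime

/-! ### Partial derivatives and the chain rule. -/

namespace Coord

variable {n : ℕ}

theorem sum_apply_single (v : EuclideanSpace ℝ (Fin n)) :
    v = ∑ i, v i • EuclideanSpace.single i (1 : ℝ) := by
  ext j
  simp [Pi.single_apply]

theorem fderiv_eq_sum_pd (f : EuclideanSpace ℝ (Fin n) → ℝ) (y v : EuclideanSpace ℝ (Fin n)) :
    fderiv ℝ f y v = ∑ i, v i * pd i f y := by
  conv_lhs => rw [sum_apply_single v]
  simp [pd]

theorem fderiv_apply_eq_pd {φ : EuclideanSpace ℝ (Fin n) → EuclideanSpace ℝ (Fin n)}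
    {y : EuclideanSpace ℝ (Fin n)} (hφ : DifferentiableAt ℝ φ y) (i j : Fin n) :
    (fderiv ℝ φ y (EuclideanSpace.single j 1)) i = pd j (fun z => φ z i) y := by
  have := ((EuclideanSpace.proj i : EuclideanSpace ℝ (Fin n) →L[ℝ] ℝ).hasFDerivAt.comp y
    hφ.hasFDerivAt).fderiv
  rw [pd]
  change _ = fderiv ℝ (⇑(EuclideanSpace.proj i : EuclideanSpace ℝ (Fin n) →L[ℝ] ℝ) ∘ φ) y _
  rw [this]
  rfl

theorem pd_comp {φ : EuclideanSpace ℝ (Fin n) → EuclideanSpace ℝ (Fin n)}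
    {f : EuclideanSpace ℝ (Fin n) → ℝ} {y : EuclideanSpace ℝ (Fin n)}
    (hφ : DifferentiableAt ℝ φ y) (hf : DifferentiableAt ℝ f (φ y)) (j : Fin n) :
    pd j (f ∘ φ) y = ∑ i, pd j (fun z => φ z i) y * pd i f (φ y) := by
  rw [pd, fderiv_comp y hf hφ, ContinuousLinearMap.comp_apply, fderiv_eq_sum_pd]
  simp only [fderiv_apply_eq_pd hφ]

theorem pd_coord (p j : Fin n) (y : EuclideanSpace ℝ (Fin n)) :
    pd j (fun z => z p) y = (1 : Matrix (Fin n) (Fin n) ℝ) p j := by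
  have := (EuclideanSpace.proj p : EuclideanSpace ℝ (Fin n) →L[ℝ] ℝ).hasFDerivAt (x := y)
  rw [pd]
  change fderiv ℝ (⇑(EuclideanSpace.proj p : EuclideanSpace ℝ (Fin n) →L[ℝ] ℝ)) y _ = _
  rw [this.fderiv]
  simp [Matrix.one_apply, PiLp.single_apply]

theorem pd_congr {f g : EuclideanSpace ℝ (Fin n) → ℝ} {y : EuclideanSpace ℝ (Fin n)}
    (h : f =ᶠ[nhds y] g) (j : Fin n) : pd j f y = pd j g y := by
  rw [pd, pd, h.fderiv_eq]

theorem contDiffOn_pd {f : EuclideanSpace ℝ (Fin n) → ℝ} {O : Set (EuclideanSpace ℝ (Fin n))}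
    (hO : IsOpen O) (hf : ContDiffOn ℝ ∞ f O) (j : Fin n) : ContDiffOn ℝ ∞ (pd j f) O :=
  (hf.fderiv_of_isOpen hO (by simp)).clm_apply contDiffOn_const

end Coord

/-! ### A change of coordinates as a change of frame on space-time. -/

namespace Spacetime

open FrameCalculus Coord

variable {n : ℕ} {T : ℝ} (hT : 0 < T)

/-- The derivations `∑ p, P p i * d p`. -/
def newFrame {A ι : Type*} [CommRing A] [Algebra ℝ A] [Fintype ι] (d : ι → Derivation ℝ A A)
    (P : Matrix ι ι A) (i : ι) : Derivation ℝ A A := ∑ p, P p i • d p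

theorem newFrame_apply {A ι : Type*} [CommRing A] [Algebra ℝ A] [Fintype ι]
    (d : ι → Derivation ℝ A A) (P : Matrix ι ι A) (i : ι) (f : A) :
    newFrame d P i f = ∑ p, P p i * d p f := by
  change Derivation.coeFnAddMonoidHom (∑ p, P p i • d p) f = _
  rw [map_sum, Finset.sum_apply]
  rfl

variable (φ : OpenPartialHomeomorph (EuclideanSpace ℝ (Fin n)) (EuclideanSpace ℝ (Fin n)))
  (hφ : ContDiffOn ℝ ∞ φ φ.source) (hψ : ContDiffOn ℝ ∞ φ.symm φ.target)

/-- The components of a change of coordinates. -/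
def coordFn (i : Fin n) : SmoothFn (Icc 0 T ×ˢ φ.source) :=
  lift (fun y => φ y i) ((contDiffOn_euclidean.mp hφ) i)

/-- The Jacobian of a change of coordinates. -/
def jac : Matrix (Fin n) (Fin n) (SmoothFn (Icc 0 T ×ˢ φ.source)) :=
  Matrix.of fun i j => dx hT φ.open_source j (coordFn φ hφ i)

/-- The inverse of the Jacobian of a change of coordinates. -/
def jacInv : Matrix (Fin n) (Fin n) (SmoothFn (Icc 0 T ×ˢ φ.source)) :=
  Matrix.of fun p i => lift (fun y => pd i (fun z => φ.symm z p) (φ y))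
    ((contDiffOn_pd φ.open_target ((contDiffOn_euclidean.mp hψ) p) i).comp hφ φ.mapsTo)

theorem eval_jac {t : ℝ} (ht : t ∈ Icc 0 T) (y : φ.source) (i j : Fin n) :
    SmoothFn.eval (pt ht y) (jac hT φ hφ i j) = pd j (fun z => φ z i) y :=
  eval_dx_lift hT φ.open_source _ _ ht y j

theorem eval_jacInv {t : ℝ} (ht : t ∈ Icc 0 T) (y : φ.source) (p i : Fin n) :
    SmoothFn.eval (pt ht y) (jacInv (T := T) φ hφ hψ p i) =
      pd i (fun z => φ.symm z p) (φ y) := rfl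

theorem jacInv_mul_jac : jacInv φ hφ hψ * jac hT φ hφ = 1 := by
  ext p j q
  obtain ⟨⟨t, y⟩, ht, hy⟩ := q
  change SmoothFn.eval (pt ht ⟨y, hy⟩) _ = SmoothFn.eval (pt ht ⟨y, hy⟩) _
  have d1 : DifferentiableAt ℝ φ y :=
    (hφ.differentiableOn (by simp)).differentiableAt (φ.open_source.mem_nhds hy)
  have d2 : DifferentiableAt ℝ (fun z => φ.symm z p) (φ y) :=
    (((contDiffOn_euclidean.mp hψ) p).differentiableOn (by simp)).differentiableAt
      (φ.open_target.mem_nhds (φ.map_source hy))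
  have e := pd_comp d1 d2 j
  have e2 : pd j ((fun z => φ.symm z p) ∘ φ) y = pd j (fun z => z p) y := by
    refine pd_congr ?_ j
    filter_upwards [φ.open_source.mem_nhds hy] with z hz
    simp [φ.left_inv hz]
  rw [e2, pd_coord] at e
  rw [Matrix.mul_apply, map_sum]
  simp only [_root_.map_mul, eval_jac, eval_jacInv]
  have : SmoothFn.eval (pt ht ⟨y, hy⟩) ((1 : Matrix (Fin n) (Fin n) _) p j) =
      (1 : Matrix (Fin n) (Fin n) ℝ) p j := by
    by_cases h : p = j <;> simp [Matrix.one_apply, h]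
  rw [this, e]
  exact Finset.sum_congr rfl fun _ _ => mul_comm _ _

theorem frameChange : FrameChange (dx hT φ.open_source)
    (newFrame (dx hT φ.open_source) (jacInv φ hφ hψ)) (jacInv φ hφ hψ) (jac hT φ hφ) :=
  FrameChange.of_coordinates (dx_comm hT φ.open_source) (coordFn φ hφ)
    (jacInv_mul_jac hT φ hφ hψ) (newFrame_apply _ _)

/-- The new coordinates realize the new frame. -/
theorem realizes_newFrame {t : ℝ} (ht : t ∈ Icc 0 T) :
    Realizes (fun y : φ.source => SmoothFn.eval (pt ht y)) (fun y : φ.source => φ y)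
      (newFrame (dx hT φ.open_source) (jacInv φ hφ hψ)) := by
  intro f F h i y
  have d1 : DifferentiableAt ℝ φ y :=
    (hφ.differentiableOn (by simp)).differentiableAt (φ.open_source.mem_nhds y.2)
  have hd := hasFDerivAt_slice φ.open_source ht (f ∘ φ) F h
  have d2 : DifferentiableAt ℝ f (φ y) := by
    have hs : DifferentiableAt ℝ φ.symm (φ y) :=
      (hψ.differentiableOn (by simp)).differentiableAt (φ.open_target.mem_nhds (φ.map_source y.2))
    have h1 : DifferentiableAt ℝ (f ∘ φ) (φ.symm (φ y)) := by
      rw [φ.left_inv y.2]; exact (hd y).differentiableAt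
    refine (h1.comp (φ y) hs).congr_of_eventuallyEq ?_
    filter_upwards [φ.open_target.mem_nhds (φ.map_source y.2)] with z hz
    simp [φ.right_inv hz]
  -- By the chain rule the old derivatives of `F` are the Jacobian applied to the partial
  -- derivatives of `f`; contraction with the inverse Jacobian isolates the latter.
  have e : ∀ j, SmoothFn.eval (pt ht y) (dx hT φ.open_source j F) =
      ∑ i, SmoothFn.eval (pt ht y) (jac hT φ hφ i j) * pd i f (φ y) := by
    intro j
    rw [← realizes hT φ.open_source ht (f ∘ φ) F h j y, pd_comp d1 d2]
    simp only [eval_jac]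
  rw [newFrame_apply, map_sum]
  simp only [_root_.map_mul, e, Finset.mul_sum]
  rw [Finset.sum_comm]
  have hone : ∀ i', ∑ j, SmoothFn.eval (pt ht y) (jac hT φ hφ i' j) *
      SmoothFn.eval (pt ht y) (jacInv φ hφ hψ j i) = (1 : Matrix (Fin n) (Fin n) ℝ) i' i := by
    intro i'
    have := congrArg (SmoothFn.eval (pt ht y))
      (congrFun (congrFun (frameChange hT φ hφ hψ).inv_mul i') i)
    rw [Matrix.mul_apply, map_sum] at this
    simp only [_root_.map_mul] at this
    rw [this]
    by_cases h : i' = i <;> simp [Matrix.one_apply, h]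
  have : ∀ i', ∑ j, SmoothFn.eval (pt ht y) (jacInv φ hφ hψ j i) *
      (SmoothFn.eval (pt ht y) (jac hT φ hφ i' j) * pd i' f (φ y)) =
      (1 : Matrix (Fin n) (Fin n) ℝ) i' i * pd i' f (φ y) := by
    intro i'
    rw [← hone, Finset.sum_mul]
    exact Finset.sum_congr rfl fun _ _ => by ring
  simp only [this, Matrix.one_apply, ite_mul, one_mul, zero_mul, Finset.sum_ite_eq',
    Finset.mem_univ, if_true]

end Spacetime

/-! ### Coordinate frames and coframes on the manifold. -/

section Frames

variable {n : ℕ} {M : Type*} [TopologicalSpace M] [ChartedSpace (EuclideanSpace ℝ (Fin n)) M]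
  [IsManifold (𝓡 n) ∞ M] {e e' : OpenPartialHomeomorph M (EuclideanSpace ℝ (Fin n))}

omit [IsManifold (𝓡 n) ∞ M] in
theorem coframe_apply (e : OpenPartialHomeomorph M (EuclideanSpace ℝ (Fin n))) (x : M) (i : Fin n)
    (v : TangentSpace (𝓡 n) x) :
    coframe e x i v = (show EuclideanSpace ℝ (Fin n) from mfderiv (𝓡 n) (𝓡 n) e x v) i := rfl

theorem mfderiv_frame (he : e ∈ atlas (EuclideanSpace ℝ (Fin n)) M) {x : M} (hx : x ∈ e.source)
    (i : Fin n) : mfderiv (𝓡 n) (𝓡 n) e x (frame e x i) = EuclideanSpace.single i (1 : ℝ) := by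
  have hm := mdifferentiable_of_mem_atlas (I := 𝓡 n) he
  have : mfderiv (𝓡 n) (𝓡 n) e x = (hm.mfderiv hx : TangentSpace (𝓡 n) x →L[ℝ] _) := rfl
  rw [frame, this, ContinuousLinearMap.inverse_equiv]
  exact (hm.mfderiv hx).apply_symm_apply _

theorem coframe_frame (he : e ∈ atlas (EuclideanSpace ℝ (Fin n)) M) {x : M} (hx : x ∈ e.source)
    (i j : Fin n) : coframe e x i (frame e x j) = (1 : Matrix (Fin n) (Fin n) ℝ) i j := by
  rw [coframe_apply, mfderiv_frame he hx]
  simp [Matrix.one_apply]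

theorem eq_sum_frame (he : e ∈ atlas (EuclideanSpace ℝ (Fin n)) M) {x : M} (hx : x ∈ e.source)
    (v : TangentSpace (𝓡 n) x) : v = ∑ i, coframe e x i v • frame e x i := by
  have hm := mdifferentiable_of_mem_atlas (I := 𝓡 n) he
  refine hm.mfderiv_injective hx ?_
  rw [map_sum]
  simp only [map_smul, mfderiv_frame he hx]
  exact Coord.sum_apply_single (n := n) _

theorem ext_coframe (he : e ∈ atlas (EuclideanSpace ℝ (Fin n)) M) {x : M} (hx : x ∈ e.source)
    {v w : TangentSpace (𝓡 n) x} (h : ∀ i, coframe e x i v = coframe e x i w) : v = w := by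
  rw [eq_sum_frame he hx v, eq_sum_frame he hx w]
  simp only [h]

theorem dual_eq_sum_coframe (he : e ∈ atlas (EuclideanSpace ℝ (Fin n)) M) {x : M}
    (hx : x ∈ e.source) (ξ : Module.Dual ℝ (TangentSpace (𝓡 n) x)) :
    ξ = ∑ i, ξ (frame e x i) • coframe e x i := by
  ext v
  conv_lhs => rw [eq_sum_frame he hx v]
  simp [mul_comm]

variable (e e') in
/-- The change of coordinates from `e` to `e'`. -/
abbrev transition : OpenPartialHomeomorph (EuclideanSpace ℝ (Fin n)) (EuclideanSpace ℝ (Fin n)) :=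
  e.symm.trans e'

omit [ChartedSpace (EuclideanSpace ℝ (Fin n)) M] [IsManifold (𝓡 n) ∞ M] in
theorem mem_transition_source {x : M} (hx : x ∈ e.source) (hx' : x ∈ e'.source) :
    e x ∈ (transition e e').source := by
  simp [hx, hx']

theorem contDiffOn_transition (he : e ∈ atlas (EuclideanSpace ℝ (Fin n)) M)
    (he' : e' ∈ atlas (EuclideanSpace ℝ (Fin n)) M) :
    ContDiffOn ℝ ∞ (transition e e') (transition e e').source := by
  have := HasGroupoid.compatible (G := contDiffGroupoid ∞ (𝓡 n)) he he'
  rw [contDiffGroupoid, mem_groupoid_of_pregroupoid] at this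
  simpa [contDiffPregroupoid] using this.1

theorem contDiffOn_transition_symm (he : e ∈ atlas (EuclideanSpace ℝ (Fin n)) M)
    (he' : e' ∈ atlas (EuclideanSpace ℝ (Fin n)) M) :
    ContDiffOn ℝ ∞ (transition e e').symm (transition e e').target := by
  have := HasGroupoid.compatible (G := contDiffGroupoid ∞ (𝓡 n)) he he'
  rw [contDiffGroupoid, mem_groupoid_of_pregroupoid] at this
  simpa [contDiffPregroupoid] using this.2

theorem coframe_change (he : e ∈ atlas (EuclideanSpace ℝ (Fin n)) M)
    (he' : e' ∈ atlas (EuclideanSpace ℝ (Fin n)) M) {x : M} (hx : x ∈ e.source)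
    (hx' : x ∈ e'.source) (i : Fin n) :
    coframe e' x i = ∑ j, Coord.pd j (fun z => transition e e' z i) (e x) • coframe e x j := by
  have hs := mem_transition_source hx hx'
  have hd : DifferentiableAt ℝ (transition e e') (e x) :=
    ((contDiffOn_transition he he').differentiableOn (by simp)).differentiableAt
      ((transition e e').open_source.mem_nhds hs)
  have hm := mdifferentiable_of_mem_atlas (I := 𝓡 n) he
  have h1 : HasMFDerivAt (𝓡 n) (𝓡 n) e x (mfderiv (𝓡 n) (𝓡 n) e x) :=
    (hm.mdifferentiableAt hx).hasMFDerivAt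
  have h2 : HasMFDerivAt (𝓡 n) (𝓡 n) (transition e e') (e x) (fderiv ℝ (transition e e') (e x)) :=
    hd.hasFDerivAt.hasMFDerivAt
  have h3 : HasMFDerivAt (𝓡 n) (𝓡 n) e' x
      ((fderiv ℝ (transition e e') (e x)).comp (mfderiv (𝓡 n) (𝓡 n) e x)) := by
    refine (h2.comp x h1).congr_of_eventuallyEq ?_
    filter_upwards [e.open_source.mem_nhds hx] with z hz
    simp [e.left_inv hz]
  ext v
  rw [coframe_apply, h3.mfderiv, LinearMap.sum_apply]
  set w : EuclideanSpace ℝ (Fin n) := mfderiv (𝓡 n) (𝓡 n) e x v with hw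
  change (fderiv ℝ (transition e e') (e x) w) i = _
  conv_lhs => rw [Coord.sum_apply_single w, map_sum]
  have : ∀ j, coframe e x j v = w j := fun j => rfl
  simp only [map_smul, LinearMap.smul_apply, this, ← Coord.fderiv_apply_eq_pd hd]
  simp [mul_comm]

theorem coframe_frame_change (he : e ∈ atlas (EuclideanSpace ℝ (Fin n)) M)
    (he' : e' ∈ atlas (EuclideanSpace ℝ (Fin n)) M) {x : M} (hx : x ∈ e.source)
    (hx' : x ∈ e'.source) (i j : Fin n) :
    coframe e' x i (frame e x j) = Coord.pd j (fun z => transition e e' z i) (e x) := by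
  rw [coframe_change he he' hx hx', LinearMap.sum_apply]
  simp [coframe_frame he hx, Matrix.one_apply]

omit [IsManifold (𝓡 n) ∞ M] in
theorem tensorOfComp_apply (e : OpenPartialHomeomorph M (EuclideanSpace ℝ (Fin n))) (x : M)
    (c : Fin n → Fin n → ℝ) (ξ θ : Module.Dual ℝ (TangentSpace (𝓡 n) x)) :
    tensorOfComp e x c ξ θ = ∑ i, ∑ j, c i j * (ξ (frame e x i) * θ (frame e x j)) := by
  simp [tensorOfComp, LinearMap.sum_apply, LinearMap.BilinForm.linMulLin]

theorem ext_bilin (he : e ∈ atlas (EuclideanSpace ℝ (Fin n)) M) {x : M} (hx : x ∈ e.source)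
    {B B' : LinearMap.BilinForm ℝ (Module.Dual ℝ (TangentSpace (𝓡 n) x))}
    (h : ∀ i j, B (coframe e x i) (coframe e x j) = B' (coframe e x i) (coframe e x j)) :
    B = B' := by
  ext ξ θ
  rw [dual_eq_sum_coframe he hx ξ, dual_eq_sum_coframe he hx θ]
  simp [h]

theorem bilin_change (he : e ∈ atlas (EuclideanSpace ℝ (Fin n)) M) {x : M} (hx : x ∈ e.source)
    (B : LinearMap.BilinForm ℝ (Module.Dual ℝ (TangentSpace (𝓡 n) x))) (i j : Fin n) :
    B (coframe e' x i) (coframe e' x j) =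
      ∑ p, ∑ q, coframe e' x i (frame e x p) * coframe e' x j (frame e x q) *
        B (coframe e x p) (coframe e x q) := by
  conv_lhs => rw [dual_eq_sum_coframe he hx (coframe e' x i),
    dual_eq_sum_coframe he hx (coframe e' x j)]
  simp only [map_sum, map_smul, LinearMap.sum_apply, LinearMap.smul_apply, smul_eq_mul,
    Finset.mul_sum]
  rw [Finset.sum_comm]
  exact Finset.sum_congr rfl fun _ _ => Finset.sum_congr rfl fun _ _ => by ring

namespace SmoothMetric

theorem comp_apply (e : OpenPartialHomeomorph M (EuclideanSpace ℝ (Fin n))) (g : SmoothMetric n M)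
    {x : M} (hx : x ∈ e.source) (i j : Fin n) :
    comp e g (e x) i j = g.inner x (frame e x i) (frame e x j) := by
  rw [comp, Matrix.of_apply, e.left_inv hx]

theorem comp_symm (e : OpenPartialHomeomorph M (EuclideanSpace ℝ (Fin n))) (g : SmoothMetric n M)
    (y : EuclideanSpace ℝ (Fin n)) (i j : Fin n) : comp e g y i j = comp e g y j i :=
  g.symm _ _ _

theorem inner_eq_sum (he : e ∈ atlas (EuclideanSpace ℝ (Fin n)) M) (g : SmoothMetric n M)
    {x : M} (hx : x ∈ e.source) (v w : TangentSpace (𝓡 n) x) :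
    g.inner x v w = ∑ i, ∑ j, comp e g (e x) i j * (coframe e x i v * coframe e x j w) := by
  conv_lhs => rw [eq_sum_frame he hx v, eq_sum_frame he hx w]
  simp only [comp_apply e g hx, map_sum, map_smul, _root_.sum_apply,
    _root_.smul_apply, smul_eq_mul, Finset.mul_sum]
  rw [Finset.sum_comm]
  exact Finset.sum_congr rfl fun _ _ => Finset.sum_congr rfl fun _ _ => by ring

theorem comp_posDef (he : e ∈ atlas (EuclideanSpace ℝ (Fin n)) M) (g : SmoothMetric n M)
    {y : EuclideanSpace ℝ (Fin n)} (hy : y ∈ e.target) : (comp e g y).PosDef := by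
  have hx := e.map_target hy
  refine Matrix.PosDef.of_dotProduct_mulVec_pos ?_ ?_
  · ext i j
    simp [comp_symm e g y i j]
  · intro v hv
    have e1 : ∀ i, coframe e (e.symm y) i (∑ j, v j • frame e (e.symm y) j) = v i := by
      intro i
      simp [coframe_frame he hx, Matrix.one_apply]
    have hpos := g.pos (e.symm y) (∑ j, v j • frame e (e.symm y) j) (fun h => hv (by
      funext i
      rw [← e1, h]; simp))
    rw [inner_eq_sum he g hx] at hpos
    simp only [e1, e.right_inv hy] at hpos
    have key : star v ⬝ᵥ (comp e g y).mulVec v =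
        ∑ i, ∑ j, comp e g y i j * (v i * v j) := by
      simp only [dotProduct, Matrix.mulVec, Finset.mul_sum, Pi.star_apply, star_trivial]
      exact Finset.sum_congr rfl fun _ _ => Finset.sum_congr rfl fun _ _ => by ring
    rw [key]
    exact hpos

theorem det_comp_ne_zero (he : e ∈ atlas (EuclideanSpace ℝ (Fin n)) M) (g : SmoothMetric n M)
    {y : EuclideanSpace ℝ (Fin n)} (hy : y ∈ e.target) : (comp e g y).det ≠ 0 :=
  (comp_posDef he g hy).det_pos.ne'

end SmoothMetric

end Frames

/-! ### Independence of the chart. -/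

section ChartIndependence

open FrameCalculus Spacetime Matrix

variable {n : ℕ} {M : Type*} [TopologicalSpace M] [ChartedSpace (EuclideanSpace ℝ (Fin n)) M]

/-- The time-dependent tensor field `H(t)` is smooth on `[0, T] × M` up to the end points. -/
def SmoothTensorFamily (T : ℝ) (H : ℝ → TensorField n M) : Prop :=
  ∀ e ∈ atlas (EuclideanSpace ℝ (Fin n)) M, ∀ i j, ContDiffOn ℝ ∞
    (fun p : ℝ × EuclideanSpace ℝ (Fin n) => (H p.1).comp e p.2 i j) (Icc 0 T ×ˢ e.target)

variable [IsManifold (𝓡 n) ∞ M] {e e' : OpenPartialHomeomorph M (EuclideanSpace ℝ (Fin n))}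
  (he : e ∈ atlas (EuclideanSpace ℝ (Fin n)) M) (he' : e' ∈ atlas (EuclideanSpace ℝ (Fin n)) M)
  {O : Set (EuclideanSpace ℝ (Fin n))} (hOe : O ⊆ e.target)
  {T : ℝ} (hT : 0 < T) {g : ℝ → SmoothMetric n M} (hg : SmoothMetricFamily T g)
  {H : ℝ → TensorField n M} (hH : SmoothTensorFamily T H)

/-- The components of a family of metrics, as smooth functions of time and space. -/
def metricFn : Matrix (Fin n) (Fin n) (SmoothFn (Icc 0 T ×ˢ O)) :=
  Matrix.of fun i j => SmoothFn.ofFun (fun p => (g p.1).comp e p.2 i j)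
    ((hg e he i j).mono (prod_mono le_rfl hOe))

omit [IsManifold (𝓡 n) ∞ M] in
/-- The components of a family of tensor fields, as smooth functions of time and space. -/
def tensorFn : Matrix (Fin n) (Fin n) (SmoothFn (Icc 0 T ×ˢ O)) :=
  Matrix.of fun i j => SmoothFn.ofFun (fun p => (H p.1).comp e p.2 i j)
    ((hH e he i j).mono (prod_mono le_rfl hOe))

theorem eval_metricFn {t : ℝ} (ht : t ∈ Icc 0 T) (y : O) (i j : Fin n) :
    (g t).comp e y i j = SmoothFn.eval (pt ht y) (metricFn he hOe hg i j) := rfl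

omit [IsManifold (𝓡 n) ∞ M] in
theorem eval_tensorFn {t : ℝ} (ht : t ∈ Icc 0 T) (y : O) (i j : Fin n) :
    (H t).comp e y i j = SmoothFn.eval (pt ht y) (tensorFn he hOe hH i j) := rfl

theorem metricFn_transpose : (metricFn he hOe hg)ᵀ = metricFn he hOe hg := by
  ext i j p
  exact SmoothMetric.comp_symm e (g p.1.1) p.1.2 j i

theorem isUnit_det_metricFn : IsUnit (metricFn he hOe hg).det := by
  refine SmoothFn.isUnit_of_ne_zero _ fun p => ?_
  rw [AlgHom.map_det]
  exact SmoothMetric.det_comp_ne_zero he (g p.1.1) (hOe p.2.2)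

theorem metricFn_mul_inv : metricFn he hOe hg * (metricFn he hOe hg)⁻¹ = 1 :=
  Matrix.mul_nonsing_inv _ (isUnit_det_metricFn he hOe hg)

omit [ChartedSpace (EuclideanSpace ℝ (Fin n)) M] [IsManifold (𝓡 n) ∞ M] in
theorem transition_source_subset : (transition e e').source ⊆ e.target := fun y hy => by
  simp only [OpenPartialHomeomorph.trans_source, mem_inter_iff] at hy
  exact hy.1

/-- The components of the metric in the chart `e'`, pulled back to the chart `e`. -/
def metricFn' : Matrix (Fin n) (Fin n) (SmoothFn (Icc 0 T ×ˢ (transition e e').source)) :=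
  (jacInv _ (contDiffOn_transition he he') (contDiffOn_transition_symm he he'))ᵀ *
    metricFn he transition_source_subset hg *
    jacInv _ (contDiffOn_transition he he') (contDiffOn_transition_symm he he')

/-- The components of the tensor in the chart `e'`, pulled back to the chart `e`. -/
def tensorFn' : Matrix (Fin n) (Fin n) (SmoothFn (Icc 0 T ×ˢ (transition e e').source)) :=
  jac hT _ (contDiffOn_transition he he') * tensorFn he transition_source_subset hH *
    (jac hT _ (contDiffOn_transition he he'))ᵀ

include hT in
theorem eval_jac_transition {t : ℝ} (ht : t ∈ Icc 0 T) {x : M} (hx : x ∈ e.source)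
    (hx' : x ∈ e'.source) (i j : Fin n) :
    SmoothFn.eval (pt ht ⟨e x, mem_transition_source hx hx'⟩)
      (jac hT _ (contDiffOn_transition he he') i j) = coframe e' x i (frame e x j) := by
  rw [eval_jac, coframe_frame_change he he' hx hx']

theorem eval_jacInv_transition {t : ℝ} (ht : t ∈ Icc 0 T) {x : M} (hx : x ∈ e.source)
    (hx' : x ∈ e'.source) (p i : Fin n) :
    SmoothFn.eval (pt ht ⟨e x, mem_transition_source hx hx'⟩)
      (jacInv _ (contDiffOn_transition he he') (contDiffOn_transition_symm he he') p i) =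
        coframe e x p (frame e' x i) := by
  rw [eval_jacInv, coframe_frame_change he' he hx' hx]
  simp [e.left_inv hx]

omit [ChartedSpace (EuclideanSpace ℝ (Fin n)) M] [IsManifold (𝓡 n) ∞ M] in
theorem point_eq (y : (transition e e').source) :
    ∃ x, ∃ (hx : x ∈ e.source) (hx' : x ∈ e'.source),
      y = ⟨e x, mem_transition_source hx hx'⟩ := by
  obtain ⟨y, hy⟩ := y
  have h := hy
  simp only [OpenPartialHomeomorph.trans_source, mem_inter_iff, mem_preimage] at h
  exact ⟨e.symm y, e.map_target h.1, h.2, Subtype.ext (e.right_inv h.1).symm⟩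

/-- This justifies the definition of `metricFn'`: the inverse Jacobian consists of the components of
the frame of `e'` in the frame of `e`. -/
theorem comp_metric_eq {t : ℝ} (ht : t ∈ Icc 0 T) (y : (transition e e').source) (i j : Fin n) :
    (g t).comp e' (transition e e' y) i j =
      SmoothFn.eval (pt ht y) (metricFn' he he' hg i j) := by
  obtain ⟨x, hx, hx', rfl⟩ := point_eq y
  have e1 : transition e e' (e x) = e' x := by simp [e.left_inv hx]
  change (g t).comp e' (transition e e' (e x)) i j = _
  rw [e1, SmoothMetric.comp_apply e' _ hx', SmoothMetric.inner_eq_sum he _ hx, metricFn']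
  simp only [Matrix.mul_apply, Matrix.transpose_apply, map_sum, _root_.map_mul,
    eval_jacInv_transition he he' ht hx hx', Finset.sum_mul]
  rw [Finset.sum_comm]
  refine Finset.sum_congr rfl fun q _ => Finset.sum_congr rfl fun p _ => ?_
  have hm : SmoothFn.eval (pt ht ⟨e x, mem_transition_source hx hx'⟩)
      (metricFn he transition_source_subset hg p q) = (g t).comp e (e x) p q := rfl
  rw [hm]
  ring

theorem comp_tensor_eq {t : ℝ} (ht : t ∈ Icc 0 T) (y : (transition e e').source) (i j : Fin n) :
    (H t).comp e' (transition e e' y) i j =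
      SmoothFn.eval (pt ht y) (tensorFn' he he' hT hH i j) := by
  obtain ⟨x, hx, hx', rfl⟩ := point_eq y
  have e1 : e'.symm (e' x) = x := e'.left_inv hx'
  have e2 : transition e e' (e x) = e' x := by simp [e.left_inv hx]
  change (H t).comp e' (transition e e' (e x)) i j = _
  rw [e2, TensorField.comp, Matrix.of_apply, e1, bilin_change he hx, tensorFn']
  simp only [Matrix.mul_apply, Matrix.transpose_apply, map_sum, _root_.map_mul,
    eval_jac_transition he he' hT ht hx hx', Finset.sum_mul]
  rw [Finset.sum_comm]
  refine Finset.sum_congr rfl fun q _ => Finset.sum_congr rfl fun p _ => ?_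
  have hm : SmoothFn.eval (pt ht ⟨e x, mem_transition_source hx hx'⟩)
      (tensorFn he transition_source_subset hH p q) = (H t).comp e (e x) p q := rfl
  rw [hm, TensorField.comp, Matrix.of_apply, e.left_inv hx]
  ring

theorem metricFn'_mul_inv : metricFn' he he' hg *
    (jac hT _ (contDiffOn_transition he he') *
      (metricFn he (transition_source_subset (e' := e')) hg)⁻¹ *
      (jac hT _ (contDiffOn_transition he he'))ᵀ) = 1 := by
  have hF := frameChange hT _ (contDiffOn_transition he he') (contDiffOn_transition_symm he he')
  have h1 := metricFn_mul_inv he (transition_source_subset (e' := e')) hg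
  rw [metricFn']
  generalize metricFn he (transition_source_subset (e' := e')) hg = G at *
  generalize jacInv (T := T) _ (contDiffOn_transition he he')
    (contDiffOn_transition_symm he he') = P at *
  generalize jac hT _ (contDiffOn_transition he he') = K at *
  calc Pᵀ * G * P * (K * G⁻¹ * Kᵀ) = Pᵀ * (G * ((P * K) * G⁻¹)) * Kᵀ := by
        simp only [Matrix.mul_assoc]
    _ = 1 := by
      rw [hF.mul_inv, Matrix.one_mul, h1, Matrix.mul_one, ← Matrix.transpose_mul, hF.inv_mul,
        Matrix.transpose_one]

include he he' hT hg

/-- The coordinates of `e'` realize the frame `newFrame`, so the coordinate formula in `e'` is the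
ring formula for that frame, and the law of `FrameChange` compares it with the formula in `e`. The
next three results follow the same pattern. -/
theorem ricci_change {t : ℝ} (ht : t ∈ Icc 0 T) {x : M} (hx : x ∈ e.source) (hx' : x ∈ e'.source)
    (i j : Fin n) :
    Coord.ricci ((g t).comp e') i j (e' x) =
      ∑ p, ∑ q, Coord.ricci ((g t).comp e) p q (e x) * coframe e x p (frame e' x i) *
        coframe e x q (frame e' x j) := by
  have hF := frameChange hT _ (contDiffOn_transition he he') (contDiffOn_transition_symm he he')
  have hr' := realizes_newFrame hT _ (contDiffOn_transition he he')
    (contDiffOn_transition_symm he he') ht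
  have hr := realizes hT (transition e e').open_source ht
  have e1 : transition e e' (e x) = e' x := by simp [e.left_inv hx]
  have h1 := hr'.ricci_eq (comp_metric_eq he he' hg ht) (metricFn'_mul_inv he he' hT hg)
    ⟨e x, mem_transition_source hx hx'⟩ i j
  have h2 := fun p q => hr.ricci_eq (eval_metricFn he transition_source_subset hg ht)
    (metricFn_mul_inv he transition_source_subset hg) ⟨e x, mem_transition_source hx hx'⟩ p q
  simp only [e1] at h1 h2
  rw [h1, metricFn', hF.ricci_eq (hF.mul_conn (metricFn_transpose _ _ _)
    (metricFn_mul_inv he transition_source_subset hg))]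
  simp only [h2, Matrix.mul_apply, Matrix.transpose_apply, map_sum, _root_.map_mul,
    eval_jacInv_transition he he' ht hx hx', Finset.sum_mul]
  rw [Finset.sum_comm]
  exact Finset.sum_congr rfl fun _ _ => Finset.sum_congr rfl fun _ _ => by ring

theorem scalar_change {t : ℝ} (ht : t ∈ Icc 0 T) {x : M} (hx : x ∈ e.source)
    (hx' : x ∈ e'.source) :
    Coord.scalar ((g t).comp e') (e' x) = Coord.scalar ((g t).comp e) (e x) := by
  have hF := frameChange hT _ (contDiffOn_transition he he') (contDiffOn_transition_symm he he')
  have hr' := realizes_newFrame hT _ (contDiffOn_transition he he')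
    (contDiffOn_transition_symm he he') ht
  have hr := realizes hT (transition e e').open_source ht
  have e1 : transition e e' (e x) = e' x := by simp [e.left_inv hx]
  have h1 := hr'.scalar_eq (comp_metric_eq he he' hg ht) (metricFn'_mul_inv he he' hT hg)
    ⟨e x, mem_transition_source hx hx'⟩
  have h2 := hr.scalar_eq (eval_metricFn he transition_source_subset hg ht)
    (metricFn_mul_inv he transition_source_subset hg) ⟨e x, mem_transition_source hx hx'⟩
  simp only [e1] at h1 h2
  rw [h1, h2, metricFn', hF.scalar_eq (hF.mul_conn (metricFn_transpose _ _ _)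
    (metricFn_mul_inv he transition_source_subset hg)), hF.conj_inv]

include hH

theorem divergence_change {t : ℝ} (ht : t ∈ Icc 0 T) {x : M} (hx : x ∈ e.source)
    (hx' : x ∈ e'.source) (b : Fin n) :
    Coord.divergence ((g t).comp e') ((H t).comp e') b (e' x) =
      ∑ c, coframe e' x b (frame e x c) *
        Coord.divergence ((g t).comp e) ((H t).comp e) c (e x) := by
  have hF := frameChange hT _ (contDiffOn_transition he he') (contDiffOn_transition_symm he he')
  have hr' := realizes_newFrame hT _ (contDiffOn_transition he he')
    (contDiffOn_transition_symm he he') ht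
  have hr := realizes hT (transition e e').open_source ht
  have e1 : transition e e' (e x) = e' x := by simp [e.left_inv hx]
  have h1 := hr'.divergence_eq (comp_metric_eq he he' hg ht) (metricFn'_mul_inv he he' hT hg)
    (comp_tensor_eq he he' hT hH ht) ⟨e x, mem_transition_source hx hx'⟩ b
  have h2 := fun c => hr.divergence_eq (eval_metricFn he transition_source_subset hg ht)
    (metricFn_mul_inv he transition_source_subset hg)
    (eval_tensorFn he transition_source_subset hH ht) ⟨e x, mem_transition_source hx hx'⟩ c
  simp only [e1] at h1 h2
  rw [h1, metricFn', tensorFn', hF.div_eq' (hF.mul_conn (metricFn_transpose _ _ _)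
    (metricFn_mul_inv he transition_source_subset hg))]
  simp only [h2, map_sum, _root_.map_mul, eval_jac_transition he he' hT ht hx hx']

theorem lichnerowicz_change {t : ℝ} (ht : t ∈ Icc 0 T) {x : M} (hx : x ∈ e.source)
    (hx' : x ∈ e'.source) (i j : Fin n) :
    Coord.lichnerowicz ((g t).comp e') ((H t).comp e') i j (e' x) =
      ∑ p, ∑ q, Coord.lichnerowicz ((g t).comp e) ((H t).comp e) p q (e x) *
        (coframe e' x i (frame e x p) * coframe e' x j (frame e x q)) := by
  have hF := frameChange hT _ (contDiffOn_transition he he') (contDiffOn_transition_symm he he')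
  have hr' := realizes_newFrame hT _ (contDiffOn_transition he he')
    (contDiffOn_transition_symm he he') ht
  have hr := realizes hT (transition e e').open_source ht
  have e1 : transition e e' (e x) = e' x := by simp [e.left_inv hx]
  have h1 := hr'.lichnerowicz_eq (comp_metric_eq he he' hg ht) (metricFn'_mul_inv he he' hT hg)
    (comp_tensor_eq he he' hT hH ht) ⟨e x, mem_transition_source hx hx'⟩ i j
  have h2 := fun p q => hr.lichnerowicz_eq (eval_metricFn he transition_source_subset hg ht)
    (metricFn_mul_inv he transition_source_subset hg)
    (eval_tensorFn he transition_source_subset hH ht) ⟨e x, mem_transition_source hx hx'⟩ p q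
  simp only [e1] at h1 h2
  rw [h1, metricFn', tensorFn', hF.lich_eq' (hF.mul_conn (metricFn_transpose _ _ _)
    (metricFn_mul_inv he transition_source_subset hg))]
  simp only [h2, Matrix.mul_apply, Matrix.transpose_apply, map_sum, _root_.map_mul,
    eval_jac_transition he he' hT ht hx hx', Finset.sum_mul]
  rw [Finset.sum_comm]
  exact Finset.sum_congr rfl fun _ _ => Finset.sum_congr rfl fun _ _ => by ring

end ChartIndependence

/-! ### Existence criterion for normal frames, and transfer of the pointwise identities to arbitrary
frames. -/

namespace FrameCalculus

open Matrix

/-- The operator `-∂/∂τ - Δ_L + R` on contravariant `2`-tensors. -/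
def conj {A ι : Type*} [CommRing A] [Algebra ℝ A] [Fintype ι] (τ : Derivation ℝ A A)
    (d : ι → Derivation ℝ A A) (G Gi H : Matrix ι ι A) : Matrix ι ι A :=
  -(H.map τ) - lich d (conn d G Gi) Gi H + scalar d (conn d G Gi) Gi • H

namespace FrameChange

variable {A ι : Type*} [CommRing A] [Algebra ℝ A] [Fintype ι] [DecidableEq ι]
  {d d' : ι → Derivation ℝ A A} {P Q : Matrix ι ι A} (h : FrameChange d d' P Q)
  {G Gi : Matrix ι ι A} (hG : Gᵀ = G) (hGi : G * Gi = 1) {τ : Derivation ℝ A A}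
include h

theorem mul_inv_metric (hGi : G * Gi = 1) : (Pᵀ * G * P) * (Q * Gi * Qᵀ) = 1 := by
  calc Pᵀ * G * P * (Q * Gi * Qᵀ) = Pᵀ * (G * ((P * Q) * Gi)) * Qᵀ := by
        simp only [Matrix.mul_assoc]
    _ = 1 := by
      rw [h.mul_inv, Matrix.one_mul, hGi, Matrix.mul_one, ← Matrix.transpose_mul, h.inv_mul,
        Matrix.transpose_one]

theorem map_inv_frame (D : Derivation ℝ A A) : P.map D = -(P * Q.map D * P) := by
  have h1 : P.map D * Q + P * Q.map D = 0 := by rw [← map_mul, h.mul_inv, map_one']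
  calc P.map D = (P.map D * Q) * P := by rw [Matrix.mul_assoc, h.inv_mul, Matrix.mul_one]
    _ = (-(P * Q.map D)) * P := by rw [eq_neg_of_add_eq_zero_left h1]
    _ = _ := by rw [Matrix.neg_mul]

/-- If `Q` does not depend on time, neither does its inverse `P`, so the new derivations have
time-independent coefficients. -/
theorem tau_comm (hτ : ∀ i f, τ (d i f) = d i (τ f)) (hτQ : Q.map τ = 0) (i : ι) (f : A) :
    τ (d' i f) = d' i (τ f) := by
  have hP : P.map τ = 0 := by rw [h.map_inv_frame, hτQ]; simp
  have hP' : ∀ p, τ (P p i) = 0 := fun p => congrFun (congrFun hP p) i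
  simp [h.frame, hP', hτ]

include hG hGi

/-- The Ricci tensor transforms by the same conjugation as the metric, so under a time-independent
frame change the flow equation keeps its form. -/
theorem tau_metric (hτQ : Q.map τ = 0)
    (hflow : ∀ i j, τ (G i j) = (-2 : ℝ) • ricci d (conn d G Gi) i j) (i j : ι) :
    τ ((Pᵀ * G * P) i j) =
      (-2 : ℝ) • ricci d' (conn d' (Pᵀ * G * P) (Q * Gi * Qᵀ)) i j := by
  have hP : P.map τ = 0 := by rw [h.map_inv_frame, hτQ]; simp
  have hPt : Pᵀ.map τ = 0 := by
    have : Pᵀ.map τ = (P.map τ)ᵀ := rfl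
    rw [this, hP, Matrix.transpose_zero]
  have hf : G.map τ = (-2 : ℝ) • ricci d (conn d G Gi) := by ext i j; exact hflow i j
  have : (Pᵀ * G * P).map τ =
      (-2 : ℝ) • ricci d' (conn d' (Pᵀ * G * P) (Q * Gi * Qᵀ)) := by
    rw [map_mul, map_mul, hP, hPt, hf, h.ricci_eq (h.mul_conn hG hGi)]
    simp
  exact congrFun (congrFun this i) j

/-- The transformation law of the conjugate operator. -/
theorem conj_eq (hτQ : Q.map τ = 0) (H : Matrix ι ι A) :
    conj τ d' (Pᵀ * G * P) (Q * Gi * Qᵀ) (Q * H * Qᵀ) = Q * conj τ d G Gi H * Qᵀ := by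
  have hQt : Qᵀ.map τ = 0 := by
    have : Qᵀ.map τ = (Q.map τ)ᵀ := rfl
    rw [this, hτQ, Matrix.transpose_zero]
  rw [conj, conj, h.lich_eq' (h.mul_conn hG hGi), h.scalar_eq (h.mul_conn hG hGi), h.conj_inv,
    map_mul, map_mul, hτQ, hQt]
  simp only [Matrix.zero_mul, Matrix.mul_zero, zero_add, add_zero, Matrix.mul_add, Matrix.mul_sub,
    Matrix.add_mul, Matrix.sub_mul, Matrix.mul_neg, Matrix.neg_mul, Matrix.mul_smul,
    Matrix.smul_mul]

/-- A frame change whose Jacobian `Q` is an isometry at the point `ev` and absorbs the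
Christoffel symbols there leads to a normal frame. -/
theorem isNormalAt {ev : A →ₐ[ℝ] ℝ}
    (h1 : G.map ev = (Q.map ev)ᵀ * Q.map ev)
    (h2 : ∀ p, (Q.map (d p)).map ev = Q.map ev * (conn d G Gi p).map ev) :
    IsNormalAt ev d' (Pᵀ * G * P) (Q * Gi * Qᵀ) := by
  have mm : ∀ M N : Matrix ι ι A, (M * N).map ev = M.map ev * N.map ev := fun M N => by
    ext i j; simp [Matrix.mul_apply]
  have m1 : (1 : Matrix ι ι A).map ev = 1 := Matrix.map_one _ (map_zero ev) (map_one ev)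
  have hPQ : P.map ev * Q.map ev = 1 := by rw [← mm, h.mul_inv, m1]
  have hQP : Q.map ev * P.map ev = 1 := by rw [← mm, h.inv_mul, m1]
  have hGs : (Pᵀ * G * P)ᵀ = Pᵀ * G * P := by
    simp [Matrix.transpose_mul, hG, Matrix.mul_assoc]
  have hm : (Pᵀ * G * P).map ev = 1 := by
    rw [mm, mm, h1]
    have : Pᵀ.map ev = (P.map ev)ᵀ := rfl
    rw [this]
    calc (P.map ev)ᵀ * ((Q.map ev)ᵀ * Q.map ev) * P.map ev =
        (Q.map ev * P.map ev)ᵀ * (Q.map ev * P.map ev) := by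
          simp only [Matrix.transpose_mul, Matrix.mul_assoc]
      _ = 1 := by rw [hQP]; simp
  -- By `h2` the derivative of `Q` at the point equals `Q` times the old connection, so the
  -- inhomogeneous term of the transformation law exactly cancels the homogeneous one.
  have hC0 : ∀ i, (conn d' (Pᵀ * G * P) (Q * Gi * Qᵀ) i).map ev = 0 := by
    intro i
    set X := ∑ p, P p i • conn d G Gi p with hX
    have e1 : P * conn d' (Pᵀ * G * P) (Q * Gi * Qᵀ) i = X * P - P * Q.map (d' i) * P := by
      rw [h.mul_conn hG hGi, h.map_inv_frame, sub_eq_add_neg]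
    have e2 : (Q.map (d' i)).map ev = Q.map ev * X.map ev := by
      rw [h.map_frame]
      have l : ∀ (M : ι → Matrix ι ι A), (∑ p, P p i • M p).map ev =
          ∑ p, ev (P p i) • (M p).map ev := by
        intro M; ext a b; simp [Matrix.sum_apply]
      rw [l, hX, l]
      simp only [h2, Matrix.mul_sum, Matrix.mul_smul]
    have e3 : P.map ev * (conn d' (Pᵀ * G * P) (Q * Gi * Qᵀ) i).map ev = 0 := by
      have sm : ∀ M N : Matrix ι ι A, (M - N).map ev = M.map ev - N.map ev := fun M N => by
        ext i j; simp
      rw [← mm, e1, sm, mm, mm, mm, e2, ← Matrix.mul_assoc (P.map ev), hPQ, Matrix.one_mul,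
        sub_self]
    have := congrArg (Q.map ev * ·) e3
    simpa [← Matrix.mul_assoc, hQP] using this
  refine ⟨h.comm, hGs, h.mul_inv_metric hGi, fun i j => congrFun (congrFun hm i) j, ?_⟩
  intro k i j
  -- Metric compatibility expresses the first derivatives of the metric through the connection,
  -- which vanishes at the point.
  have e := conn_compat d' hGs (h.mul_inv_metric hGi) k
  have e2 := congrArg ev (congrFun (congrFun e i) j)
  have z : ∀ a b, ev (conn d' (Pᵀ * G * P) (Q * Gi * Qᵀ) k a b) = 0 :=
    fun a b => congrFun (congrFun (hC0 k) a) b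
  rw [Matrix.map_apply] at e2
  rw [e2, Matrix.add_apply, Matrix.mul_apply (M := (conn d' _ _ k)ᵀ),
    Matrix.mul_apply (N := conn d' _ _ k)]
  simp [z]

end FrameChange

section Point

variable {A : Type*} [CommRing A] [Algebra ℝ A] {d d' : Fin 3 → Derivation ℝ A A}
  {P Q G Gi H : Matrix (Fin 3) (Fin 3) A} {τ : Derivation ℝ A A} {ev : A →ₐ[ℝ] ℝ}
  (h : FrameChange d d' P Q) (hn : IsNormalAt ev d' (Pᵀ * G * P) (Q * Gi * Qᵀ))
  (hG : Gᵀ = G) (hGi : G * Gi = 1) (hτ : ∀ i f, τ (d i f) = d i (τ f)) (hτQ : Q.map τ = 0)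
  (hflow : ∀ i j, τ (G i j) = (-2 : ℝ) • ricci d (conn d G Gi) i j) (hH : Hᵀ = H)

include h hn hG hGi hH

/-- Symmetry is known in the normal frame and survives conjugation of the matrix by `P` back to the
original frame. -/
theorem ev_lich_symm_of_normal (a b : Fin 3) :
    ev (lich d (conn d G Gi) Gi H a b) = ev (lich d (conn d G Gi) Gi H b a) := by
  have hH' : (Q * H * Qᵀ)ᵀ = Q * H * Qᵀ := by simp [Matrix.transpose_mul, hH, Matrix.mul_assoc]
  have e := hn.ev_lich_symm hH'
  rw [h.lich_eq' (h.mul_conn hG hGi)] at e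
  set L := lich d (conn d G Gi) Gi H
  have mm : ∀ M N : Matrix (Fin 3) (Fin 3) A, (M * N).map ev = M.map ev * N.map ev :=
    fun M N => by ext i j; simp [Matrix.mul_apply]
  have e1 : ((Q * L * Qᵀ).map ev)ᵀ = (Q * L * Qᵀ).map ev := by
    ext i j; exact e j i
  have e2 : (L.map ev)ᵀ = L.map ev := by
    have k : (P * (Q * L * Qᵀ) * Pᵀ).map ev = L.map ev := by rw [h.conj_inv]
    rw [mm, mm] at k
    rw [← k]
    simp only [Matrix.transpose_mul, e1]
    have : Pᵀ.map ev = (P.map ev)ᵀ := rfl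
    rw [this, Matrix.transpose_transpose]
    simp only [Matrix.mul_assoc]
  exact (congrFun (congrFun e2 b) a)

include hτ hτQ hflow

/-- The conjugate operator preserves divergence-free tensors. -/
theorem ev_div_conj_eq_zero (hdiv : ∀ b, div d (conn d G Gi) H b = 0) (b : Fin 3) :
    ev (div d (conn d G Gi) (conj τ d G Gi H) b) = 0 := by
  have hH' : (Q * H * Qᵀ)ᵀ = Q * H * Qᵀ := by simp [Matrix.transpose_mul, hH, Matrix.mul_assoc]
  have hC := h.mul_conn hG hGi
  have e := hn.ev_div_conj (h.tau_comm hτ hτQ) (h.tau_metric hG hGi hτQ hflow) hH'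
  have z : ∀ b, div d' (conn d' (Pᵀ * G * P) (Q * Gi * Qᵀ)) (Q * H * Qᵀ) b = 0 := by
    intro b
    rw [h.div_eq' hC]; simp [hdiv]
  have e' : ∀ b, ev (div d' (conn d' (Pᵀ * G * P) (Q * Gi * Qᵀ))
      (Q * conj τ d G Gi H * Qᵀ) b) = 0 := by
    intro b
    rw [← h.conj_eq hG hGi hτQ, conj, e]
    simp [z]
  have f := h.div_eq hC (Q * conj τ d G Gi H * Qᵀ) b
  rw [h.conj_inv] at f
  rw [← f, map_sum]
  simp [e']

/-- The evolution of the squared norm of the divergence of a solution of the conjugate heat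
equation. -/
theorem ev_energy_of_normal (hconj : conj τ d G Gi H = 0) (u : A)
    (hu : u = ∑ b, ∑ c, G b c * (div d (conn d G Gi) H b * div d (conn d G Gi) H c)) :
    2 * ev (scalar d (conn d G Gi) Gi) * ev u ≤ ev (τ u) + ∑ i, ev (d' i (d' i u)) := by
  have hH' : (Q * H * Qᵀ)ᵀ = Q * H * Qᵀ := by simp [Matrix.transpose_mul, hH, Matrix.mul_assoc]
  have hC := h.mul_conn hG hGi
  have hc' : conj τ d' (Pᵀ * G * P) (Q * Gi * Qᵀ) (Q * H * Qᵀ) = 0 := by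
    rw [h.conj_eq hG hGi hτQ, hconj]; simp
  have e := hn.ev_energy (h.tau_comm hτ hτQ) (h.tau_metric hG hGi hτQ hflow) hH' hc'
  have quad : ∀ (B : Matrix (Fin 3) (Fin 3) A) (w : Fin 3 → A),
      ∑ b, ∑ c, B b c * (w b * w c) = w ⬝ᵥ B.mulVec w := by
    intro B w
    simp only [dotProduct, Matrix.mulVec, Finset.mul_sum]
    exact Finset.sum_congr rfl fun _ _ => Finset.sum_congr rfl fun _ _ => by ring
  have hw : div d' (conn d' (Pᵀ * G * P) (Q * Gi * Qᵀ)) (Q * H * Qᵀ) =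
      Q.mulVec (div d (conn d G Gi) H) := by
    funext b
    rw [h.div_eq' hC]; rfl
  -- The squared norm of the divergence is a scalar, so it is the same ring element in both frames.
  have hu' : ∑ b, ∑ c, (Pᵀ * G * P) b c *
      (div d' (conn d' (Pᵀ * G * P) (Q * Gi * Qᵀ)) (Q * H * Qᵀ) b *
        div d' (conn d' (Pᵀ * G * P) (Q * Gi * Qᵀ)) (Q * H * Qᵀ) c) = u := by
    rw [hu, quad, quad, hw, Matrix.mulVec_mulVec, Matrix.mul_assoc, h.mul_inv, Matrix.mul_one,
      ← Matrix.mulVec_mulVec, Matrix.dotProduct_mulVec, Matrix.vecMul_transpose,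
      Matrix.mulVec_mulVec, h.mul_inv, Matrix.one_mulVec]
  rw [hu', h.scalar_eq hC, h.conj_inv] at e
  rw [e]
  have : 0 ≤ ∑ i, ∑ b, ev (d' i (div d' (conn d' (Pᵀ * G * P) (Q * Gi * Qᵀ))
      (Q * H * Qᵀ) b)) ^ 2 :=
    Finset.sum_nonneg fun _ _ => Finset.sum_nonneg fun _ _ => sq_nonneg _
  linarith

end Point

end FrameCalculus

/-! ### The operators on the manifold, read in an arbitrary chart. -/

section Global

open FrameCalculus Spacetime Matrix

variable {n : ℕ} {M : Type*} [TopologicalSpace M] [ChartedSpace (EuclideanSpace ℝ (Fin n)) M]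
  [IsManifold (𝓡 n) ∞ M] {e : OpenPartialHomeomorph M (EuclideanSpace ℝ (Fin n))}
  (he : e ∈ atlas (EuclideanSpace ℝ (Fin n)) M)
  {T : ℝ} (hT : 0 < T) {g : ℝ → SmoothMetric n M} (hg : SmoothMetricFamily T g)
  {H : ℝ → TensorField n M} (hH : SmoothTensorFamily T H)

include he hT hg

/-- The invariant operators are defined through the preferred chart at each point; chart
independence allows them to be computed in any chart of the atlas, as is needed on a whole chart
domain. -/
theorem SmoothMetric.ricci_frame {t : ℝ} (ht : t ∈ Icc 0 T) {x : M} (hx : x ∈ e.source)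
    (i j : Fin n) :
    (g t).ricci x (frame e x i) (frame e x j) = Coord.ricci ((g t).comp e) i j (e x) :=
  (ricci_change (chart_mem_atlas _ x) he hT hg ht (mem_chart_source _ x) hx i j).symm

theorem SmoothMetric.scalar_eq {t : ℝ} (ht : t ∈ Icc 0 T) {x : M} (hx : x ∈ e.source) :
    (g t).scalar x = Coord.scalar ((g t).comp e) (e x) :=
  (scalar_change (chart_mem_atlas _ x) he hT hg ht (mem_chart_source _ x) hx).symm

include hH

theorem SmoothMetric.coframe_divergence {t : ℝ} (ht : t ∈ Icc 0 T) {x : M} (hx : x ∈ e.source)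
    (b : Fin n) :
    coframe e x b ((g t).divergence (H t) x) =
      Coord.divergence ((g t).comp e) ((H t).comp e) b (e x) := by
  rw [divergence_change (chart_mem_atlas _ x) he hT hg hH ht (mem_chart_source _ x) hx b]
  simp only [SmoothMetric.divergence, map_sum, map_smul, smul_eq_mul]
  exact Finset.sum_congr rfl fun _ _ => mul_comm _ _

theorem SmoothMetric.lichnerowicz_coframe {t : ℝ} (ht : t ∈ Icc 0 T) {x : M}
    (hx : x ∈ e.source) (i j : Fin n) :
    (g t).lichnerowicz (H t) x (coframe e x i) (coframe e x j) =
      Coord.lichnerowicz ((g t).comp e) ((H t).comp e) i j (e x) := by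
  rw [lichnerowicz_change (chart_mem_atlas _ x) he hT hg hH ht (mem_chart_source _ x) hx i j]
  exact tensorOfComp_apply _ _ _ _ _

-- Smoothness of the components makes `derivWithin` in `timeDeriv` a genuine derivative, and
-- bilinearity extends this from coframe entries to all covectors.
omit he hg in
theorem hasDerivWithinAt_tensor {t : ℝ} (ht : t ∈ Icc 0 T) (x : M)
    (ξ θ : Module.Dual ℝ (TangentSpace (𝓡 n) x)) :
    HasDerivWithinAt (fun s => H s x ξ θ) (timeDeriv T H t x ξ θ) (Icc 0 T) t := by
  have hc := chart_mem_atlas (EuclideanSpace ℝ (Fin n)) x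
  have hx := mem_chart_source (EuclideanSpace ℝ (Fin n)) x
  have hd : ∀ a b, HasDerivWithinAt (fun s => H s x (coframe (chartAt _ x) x a)
      (coframe (chartAt _ x) x b)) (derivWithin (fun s => H s x (coframe (chartAt _ x) x a)
      (coframe (chartAt _ x) x b)) (Icc 0 T) t) (Icc 0 T) t := by
    intro a b
    refine (hasDerivWithinAt_slice hT (chartAt (EuclideanSpace ℝ (Fin n)) x).open_target ht
      ⟨_, (chartAt _ x).map_source hx⟩ _ (tensorFn hc le_rfl hH a b) fun s hs => ?_)
      |>.differentiableWithinAt.hasDerivWithinAt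
    rw [← eval_tensorFn, TensorField.comp, Matrix.of_apply, (chartAt _ x).left_inv hx]
  have e1 : (fun s => H s x ξ θ) = fun s => ∑ a, ∑ b, H s x (coframe (chartAt _ x) x a)
      (coframe (chartAt _ x) x b) * (ξ (frame (chartAt _ x) x a) * θ (frame (chartAt _ x) x b)) := by
    funext s
    conv_lhs => rw [dual_eq_sum_coframe hc hx ξ, dual_eq_sum_coframe hc hx θ]
    simp only [map_sum, map_smul, LinearMap.sum_apply, LinearMap.smul_apply, smul_eq_mul,
      Finset.mul_sum]
    rw [Finset.sum_comm]
    exact Finset.sum_congr rfl fun _ _ => Finset.sum_congr rfl fun _ _ => by ring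
  rw [e1, timeDeriv, tensorOfComp_apply]
  exact HasDerivWithinAt.fun_sum fun a _ => HasDerivWithinAt.fun_sum fun b _ =>
    (hd a b).mul_const _

end Global

/-! ### The geometric operators in the ring of smooth functions, and existence of normal frames. -/

section Ring

open FrameCalculus Spacetime Matrix

variable {n : ℕ} {M : Type*} [TopologicalSpace M] [ChartedSpace (EuclideanSpace ℝ (Fin n)) M]
  [IsManifold (𝓡 n) ∞ M] {e : OpenPartialHomeomorph M (EuclideanSpace ℝ (Fin n))}
  (he : e ∈ atlas (EuclideanSpace ℝ (Fin n)) M)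
  {O : Set (EuclideanSpace ℝ (Fin n))} (hO : IsOpen O) (hOe : O ⊆ e.target)
  {T : ℝ} (hT : 0 < T) {g : ℝ → SmoothMetric n M} (hg : SmoothMetricFamily T g)
  {H : ℝ → TensorField n M} (hH : SmoothTensorFamily T H)

/-- Both sides are derivatives within `[0, T]` of the same metric component, and such derivatives
are unique, also at the end times. -/
theorem dt_metricFn (hflow : IsRicciFlow T g) (i j : Fin n) :
    dt hT hO (metricFn he hOe hflow.1 i j) =
      (-2 : ℝ) • FrameCalculus.ricci (dx hT hO) (conn (dx hT hO) (metricFn he hOe hflow.1)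
        (metricFn he hOe hflow.1)⁻¹) i j := by
  ext p
  obtain ⟨⟨t, y⟩, ht, hy⟩ := p
  have hx := e.map_target (hOe hy)
  have h1 := hasDerivWithinAt_slice hT hO ht ⟨y, hy⟩ (fun s => (g s).comp e y i j)
    (metricFn he hOe hflow.1 i j) (fun s hs => rfl)
  have h2 := hflow.2 t ht (e.symm y) (frame e (e.symm y) i) (frame e (e.symm y) j)
  have h3 := (uniqueDiffOn_Icc hT t ht).eq_deriv _ h1 h2
  rw [SmoothMetric.ricci_frame he hT hflow.1 ht hx, e.right_inv (hOe hy)] at h3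
  have h4 := (realizes hT hO ht).ricci_eq (eval_metricFn he hOe hflow.1 ht)
    (metricFn_mul_inv he hOe hflow.1) ⟨y, hy⟩ i j
  rw [map_smul, smul_eq_mul]
  exact h3.trans (congrArg _ h4)

/-- The conjugate operator in the ring of smooth functions. -/
def conjFn : Matrix (Fin n) (Fin n) (SmoothFn (Icc 0 T ×ˢ O)) :=
  conj (dt hT hO) (dx hT hO) (metricFn he hOe hg) (metricFn he hOe hg)⁻¹ (tensorFn he hOe hH)

/-- The divergence in the ring of smooth functions. -/
def divFn (b : Fin n) : SmoothFn (Icc 0 T ×ˢ O) :=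
  FrameCalculus.div (dx hT hO) (conn (dx hT hO) (metricFn he hOe hg) (metricFn he hOe hg)⁻¹)
    (tensorFn he hOe hH) b

/-- The scalar curvature in the ring of smooth functions. -/
def scalarFn : SmoothFn (Icc 0 T ×ˢ O) :=
  FrameCalculus.scalar (dx hT hO) (conn (dx hT hO) (metricFn he hOe hg) (metricFn he hOe hg)⁻¹)
    (metricFn he hOe hg)⁻¹

theorem eval_divFn {t : ℝ} (ht : t ∈ Icc 0 T) (y : O) (b : Fin n) :
    SmoothFn.eval (pt ht y) (divFn he hO hOe hT hg hH b) =
      coframe e (e.symm y) b ((g t).divergence (H t) (e.symm y)) := by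
  rw [SmoothMetric.coframe_divergence he hT hg hH ht (e.map_target (hOe y.2)),
    e.right_inv (hOe y.2)]
  exact ((realizes hT hO ht).divergence_eq (eval_metricFn he hOe hg ht)
    (metricFn_mul_inv he hOe hg) (eval_tensorFn he hOe hH ht) y b).symm

theorem eval_scalarFn {t : ℝ} (ht : t ∈ Icc 0 T) (y : O) :
    SmoothFn.eval (pt ht y) (scalarFn he hO hOe hT hg) = (g t).scalar (e.symm y) := by
  rw [SmoothMetric.scalar_eq he hT hg ht (e.map_target (hOe y.2)), e.right_inv (hOe y.2)]
  exact ((realizes hT hO ht).scalar_eq (eval_metricFn he hOe hg ht)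
    (metricFn_mul_inv he hOe hg) y).symm

theorem eval_dt_tensorFn {t : ℝ} (ht : t ∈ Icc 0 T) (y : O) (i j : Fin n) :
    SmoothFn.eval (pt ht y) (dt hT hO (tensorFn he hOe hH i j)) =
      timeDeriv T H t (e.symm y) (coframe e (e.symm y) i) (coframe e (e.symm y) j) := by
  have h1 := hasDerivWithinAt_slice hT hO ht y (fun s => (H s).comp e y i j)
    (tensorFn he hOe hH i j) (fun s hs => rfl)
  have h2 := hasDerivWithinAt_tensor hT hH ht (e.symm y) (coframe e (e.symm y) i)
    (coframe e (e.symm y) j)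
  exact (uniqueDiffOn_Icc hT t ht).eq_deriv _ h1 h2

theorem eval_conjFn {t : ℝ} (ht : t ∈ Icc 0 T) (y : O) (i j : Fin n) :
    SmoothFn.eval (pt ht y) (conjFn he hO hOe hT hg hH i j) = (conjOp T g H t).comp e y i j := by
  have h1 := SmoothMetric.lichnerowicz_coframe he hT hg hH ht (e.map_target (hOe y.2)) i j
  rw [e.right_inv (hOe y.2)] at h1
  have h2 := (realizes hT hO ht).lichnerowicz_eq (eval_metricFn he hOe hg ht)
    (metricFn_mul_inv he hOe hg) (eval_tensorFn he hOe hH ht) y i j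
  have h3 := eval_scalarFn he hO hOe hT hg ht y
  rw [scalarFn] at h3
  rw [TensorField.comp, Matrix.of_apply, conjOp, conjFn, conj]
  simp only [LinearMap.add_apply, LinearMap.sub_apply, LinearMap.neg_apply, LinearMap.smul_apply,
    Matrix.add_apply, Matrix.sub_apply, Matrix.neg_apply, Matrix.smul_apply, Matrix.map_apply,
    map_add, map_sub, map_neg, smul_eq_mul, _root_.map_mul, h3, h1, eval_dt_tensorFn]
  rw [h2]
  rfl

theorem conjFn_eval_eq_div {t : ℝ} (ht : t ∈ Icc 0 T) (y : O) (b : Fin n) :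
    Coord.divergence ((g t).comp e) ((conjOp T g H t).comp e) b y =
      SmoothFn.eval (pt ht y) (FrameCalculus.div (dx hT hO) (conn (dx hT hO)
        (metricFn he hOe hg) (metricFn he hOe hg)⁻¹) (conjFn he hO hOe hT hg hH) b) :=
  (realizes hT hO ht).divergence_eq (eval_metricFn he hOe hg ht)
    (metricFn_mul_inv he hOe hg) (fun y i j => (eval_conjFn he hO hOe hT hg hH ht y i j).symm) y b

/-- The components of the image are elements of the ring of smooth functions, so their smoothness
needs no further argument. -/
theorem smoothTensorFamily_conjOp (hT : 0 < T) (hg : SmoothMetricFamily T g)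
    (hH : SmoothTensorFamily T H) : SmoothTensorFamily T (conjOp T g H) := by
  intro e he i j
  refine (SmoothFn.contDiffOn (conjFn he e.open_target le_rfl hT hg hH i j)).congr ?_
  intro p hp
  rw [SmoothFn.extendZero_eq_eval _ ⟨p, hp⟩]
  exact (eval_conjFn he e.open_target le_rfl hT hg hH hp.1 ⟨p.2, hp.2⟩ i j).symm

-- The factor provides the linear part of the normal coordinates.
open scoped MatrixOrder in
theorem Matrix.PosDef.exists_transpose_mul_self {B : Matrix (Fin n) (Fin n) ℝ}
    (hB : B.PosDef) : ∃ K : Matrix (Fin n) (Fin n) ℝ, B = Kᵀ * K :=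
  CStarAlgebra.nonneg_iff_eq_star_mul_self.mp hB.posSemidef.nonneg

/-- Near every point of space-time there is a frame of derivations that is normal there. -/
theorem exists_normal_frame {t : ℝ} (ht : t ∈ Icc 0 T) {y : EuclideanSpace ℝ (Fin n)}
    (hy : y ∈ e.target) :
    ∃ (O : Set (EuclideanSpace ℝ (Fin n))) (hO : IsOpen O) (hOe : O ⊆ e.target) (hyO : y ∈ O)
      (P Q : Matrix (Fin n) (Fin n) (SmoothFn (Icc 0 T ×ˢ O))),
      FrameChange (dx hT hO) (newFrame (dx hT hO) P) P Q ∧ Q.map (dt hT hO) = 0 ∧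
      IsNormalAt (SmoothFn.eval (pt ht ⟨y, hyO⟩)) (newFrame (dx hT hO) P)
        (Pᵀ * metricFn he hOe hg * P) (Q * (metricFn he hOe hg)⁻¹ * Qᵀ) := by
  obtain ⟨B, hB'⟩ := (SmoothMetric.comp_posDef he (g t) hy).exists_transpose_mul_self
  have hBdet : B.det ≠ 0 := by
    intro h0
    apply SmoothMetric.det_comp_ne_zero he (g t) hy
    rw [hB', Matrix.det_mul, h0, mul_zero]
  set Γ : Fin n → Fin n → Fin n → ℝ := fun l j k => Coord.christoffel ((g t).comp e) l j k y
    with hΓ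
  -- This is the Jacobian matrix, at `z`, of the quadratic coordinates `X` introduced below.
  let K : EuclideanSpace ℝ (Fin n) → Matrix (Fin n) (Fin n) ℝ := fun z =>
    Matrix.of fun i j => ∑ l, B i l * ((1 : Matrix (Fin n) (Fin n) ℝ) l j +
      ∑ k, Γ l j k * (z k - y k))
  have hK : Continuous fun z => (K z).det := by
    refine Continuous.matrix_det (continuous_matrix fun i j => ?_)
    simp only [K, Matrix.of_apply]
    fun_prop
  have hKy : K y = B := by
    ext i j
    simp [K, Matrix.one_apply]
  -- Only an invertible Jacobian is needed, not injectivity of the coordinates: a frame of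
  -- derivations suffices, so no inverse function theorem enters.
  let O : Set (EuclideanSpace ℝ (Fin n)) := e.target ∩ {z | (K z).det ≠ 0}
  have hO : IsOpen O := e.open_target.inter (isOpen_ne_fun hK continuous_const)
  have hOe : O ⊆ e.target := inter_subset_left
  have hyO : y ∈ O := ⟨hy, by simpa [hKy] using hBdet⟩
  have hΓs : ∀ l j k, Γ l j k = Γ l k j := by
    intro l j k
    have := fun j k => (realizes hT hO ht).christoffel_eq (eval_metricFn he hOe hg ht)
      (metricFn_mul_inv he hOe hg) ⟨y, hyO⟩ l j k
    change Coord.christoffel _ _ _ _ _ = Coord.christoffel _ _ _ _ _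
    exact (this j k).trans ((congrArg _
      (conn_symm _ (metricFn_transpose he hOe hg) _ j l k)).trans (this k j).symm)
  let ξ : Fin n → SmoothFn (Icc 0 T ×ˢ O) := fun l => lift (fun z => z l - y l)
    (by fun_prop)
  have hξ : ∀ l j, dx hT hO j (ξ l) = (1 : Matrix (Fin n) (Fin n) _) l j := by
    intro l j
    ext p
    obtain ⟨⟨s, z⟩, hs, hz⟩ := p
    refine (eval_dx_lift hT hO (fun z => z l - y l) _ hs ⟨z, hz⟩ j).trans ?_
    have : Coord.pd j (fun z : EuclideanSpace ℝ (Fin n) => z l - y l) z =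
        Coord.pd j (fun z => z l) z := by
      rw [Coord.pd, Coord.pd, fderiv_sub_const]
    change Coord.pd j (fun z : EuclideanSpace ℝ (Fin n) => z l - y l) z = _
    rw [this, Coord.pd_coord]
    by_cases h : l = j <;> simp [Matrix.one_apply, h]
  -- The linear part `B` makes the metric the identity at the point, and the quadratic part, built
  -- from the Christoffel symbols there, removes the connection.
  let X : Fin n → SmoothFn (Icc 0 T ×ˢ O) := fun i =>
    ∑ l, B i l • (ξ l + (1 / 2 : ℝ) • ∑ j, ∑ k, Γ l j k • (ξ j * ξ k))
  set Q : Matrix (Fin n) (Fin n) (SmoothFn (Icc 0 T ×ˢ O)) :=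
    Matrix.of fun i j => dx hT hO j (X i) with hQ
  have hQe : ∀ i j, Q i j = ∑ l, B i l • ((1 : Matrix (Fin n) (Fin n) _) l j +
      ∑ k, Γ l j k • ξ k) := by
    intro i j
    have hl : ∀ l, dx hT hO j ((1 / 2 : ℝ) • ∑ a, ∑ b, Γ l a b • (ξ a * ξ b)) =
        ∑ k, Γ l j k • ξ k := by
      intro l
      simp only [map_sum, Derivation.map_smul, hξ, Derivation.leibniz, smul_eq_mul,
        Matrix.one_apply, mul_ite, mul_one, mul_zero, smul_add, smul_ite, smul_zero,
        Finset.sum_add_distrib, Finset.sum_ite_eq', Finset.mem_univ, if_true]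
      rw [Finset.sum_comm (f := fun a b => if a = j then Γ l a b • ξ b else 0)]
      simp only [Finset.sum_ite_eq', Finset.mem_univ, if_true, hΓs l _ j]
      rw [← two_smul ℝ, smul_smul]
      norm_num
    change dx hT hO j (∑ l, B i l • (ξ l + (1 / 2 : ℝ) • ∑ a, ∑ b, Γ l a b • (ξ a * ξ b))) = _
    rw [map_sum]
    exact Finset.sum_congr rfl fun l _ => by rw [Derivation.map_smul, map_add, hξ, hl]
  have hQev : ∀ {s : ℝ} (hs : s ∈ Icc 0 T) (z : O) i j,
      SmoothFn.eval (pt hs z) (Q i j) = K z i j := by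
    intro s hs z i j
    have h1 : ∀ l, SmoothFn.eval (pt hs z) ((1 : Matrix (Fin n) (Fin n) _) l j) =
        (1 : Matrix (Fin n) (Fin n) ℝ) l j := by
      intro l
      by_cases h : l = j <;> simp [Matrix.one_apply, h]
    simp only [hQe, map_sum, map_smul, map_add, h1, K, Matrix.of_apply, smul_eq_mul]
    rfl
  have hdet : IsUnit Q.det := by
    refine SmoothFn.isUnit_of_ne_zero _ fun p => ?_
    obtain ⟨⟨s, z⟩, hs, hz⟩ := p
    rw [AlgHom.map_det]
    have : (SmoothFn.eval (pt hs ⟨z, hz⟩)).mapMatrix Q = K z := by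
      ext i j; exact hQev hs ⟨z, hz⟩ i j
    change ((SmoothFn.eval (pt hs ⟨z, hz⟩)).mapMatrix Q).det ≠ 0
    rw [this]; exact hz.2
  have hF : FrameChange (dx hT hO) (newFrame (dx hT hO) Q⁻¹) Q⁻¹ Q :=
    FrameChange.of_coordinates (dx_comm hT hO) X (Matrix.nonsing_inv_mul _ hdet)
      (newFrame_apply _ _)
  have hdtξ : ∀ l, dt hT hO (ξ l) = 0 := fun l => dt_lift hT hO _ _
  refine ⟨O, hO, hOe, hyO, Q⁻¹, Q, hF, ?_, ?_⟩
  -- `B` and `Γ` are frozen at time `t`, hence `Q` is constant in time.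
  · ext1 i j
    have h1 : ∀ l, dt hT hO ((1 : Matrix (Fin n) (Fin n) _) l j) = 0 := fun l => by
      by_cases h : l = j <;> simp [Matrix.one_apply, h]
    simp [hQe, hdtξ, h1]
  · refine hF.isNormalAt (metricFn_transpose he hOe hg) (metricFn_mul_inv he hOe hg) ?_ ?_
    · have : Q.map (SmoothFn.eval (pt ht ⟨y, hyO⟩)) = B := by
        ext i j
        rw [Matrix.map_apply, hQev, hKy]
      rw [this, ← hB']
      rfl
    · intro p
      have h0 : Q.map (SmoothFn.eval (pt ht ⟨y, hyO⟩)) = B := by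
        ext i j
        rw [Matrix.map_apply, hQev, hKy]
      rw [h0]
      ext i j
      have h1 : ∀ l, dx hT hO p ((1 : Matrix (Fin n) (Fin n) _) l j) = 0 := fun l => by
        by_cases h : l = j <;> simp [Matrix.one_apply, h]
      have h2 : ∀ l k, SmoothFn.eval (pt ht ⟨y, hyO⟩)
          ((1 : Matrix (Fin n) (Fin n) (SmoothFn (Icc 0 T ×ˢ O))) l k) =
            (1 : Matrix (Fin n) (Fin n) ℝ) l k := fun l k => by
        by_cases h : l = k <;> simp [Matrix.one_apply, h]
      have h3 := fun l => (realizes hT hO ht).christoffel_eq (eval_metricFn he hOe hg ht)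
        (metricFn_mul_inv he hOe hg) ⟨y, hyO⟩ l p j
      simp only [Matrix.map_apply, hQe, map_sum, Derivation.map_smul, map_add, h1, hξ, map_smul,
        zero_add, h2, smul_eq_mul, Matrix.mul_apply, ← h3]
      refine Finset.sum_congr rfl fun l _ => ?_
      congr 1
      simp only [Matrix.one_apply, mul_ite, mul_one, mul_zero, Finset.sum_ite_eq',
        Finset.mem_univ, if_true]
      exact hΓs l j p

end Ring

/-! ### Derivative tests at a maximum. -/

section MaximumPrinciple

open Filter Topology

/-- At a local maximum the second derivative in any direction is nonpositive. -/
theorem IsLocalMax.sum_pd_pd_nonpos {n : ℕ} {f : EuclideanSpace ℝ (Fin n) → ℝ}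
    {O : Set (EuclideanSpace ℝ (Fin n))} (hO : IsOpen O) (hf : ContDiffOn ℝ ∞ f O)
    {y : EuclideanSpace ℝ (Fin n)} (hy : y ∈ O) (hmax : IsLocalMax f y) (v : Fin n → ℝ) :
    ∑ p, ∑ q, v p * v q * Coord.pd q (Coord.pd p f) y ≤ 0 := by
  set w : EuclideanSpace ℝ (Fin n) := WithLp.toLp 2 v with hw
  set γ : ℝ → EuclideanSpace ℝ (Fin n) := fun s => y + s • w with hγ
  have hγ0 : γ 0 = y := by simp [hγ]
  have hγd : ∀ s, HasDerivAt γ w s := fun s => by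
    simpa [hγ] using ((hasDerivAt_id s).smul_const w).const_add y
  have hγc : Continuous γ := by rw [hγ]; fun_prop
  have hev : ∀ᶠ s in 𝓝 (0 : ℝ), γ s ∈ O :=
    hγc.continuousAt.preimage_mem_nhds (by rw [hγ0]; exact hO.mem_nhds hy)
  have hd1 : ∀ s, γ s ∈ O → HasDerivAt (f ∘ γ) (∑ p, v p * Coord.pd p f (γ s)) s := by
    intro s hs
    have h1 := ((hf.differentiableOn (by simp)).differentiableAt
      (hO.mem_nhds hs)).hasFDerivAt.comp_hasDerivAt s (hγd s)
    rwa [Coord.fderiv_eq_sum_pd] at h1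
  have hd1' : deriv (f ∘ γ) =ᶠ[𝓝 0] fun s => ∑ p, v p * Coord.pd p f (γ s) := by
    filter_upwards [hev] with s hs using (hd1 s hs).deriv
  have hd2 : HasDerivAt (fun s => ∑ p, v p * Coord.pd p f (γ s))
      (∑ p, ∑ q, v p * v q * Coord.pd q (Coord.pd p f) y) 0 := by
    refine HasDerivAt.fun_sum fun p _ => ?_
    have h1 := (((Coord.contDiffOn_pd hO hf p).differentiableOn (by simp)).differentiableAt
      (hO.mem_nhds (show γ 0 ∈ O by rwa [hγ0]))).hasFDerivAt.comp_hasDerivAt 0 (hγd 0)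
    rw [Coord.fderiv_eq_sum_pd, hγ0] at h1
    have h2 := h1.const_mul (v p)
    rw [Finset.mul_sum] at h2
    simpa [mul_assoc] using h2
  have hdd : deriv (deriv (f ∘ γ)) 0 = ∑ p, ∑ q, v p * v q * Coord.pd q (Coord.pd p f) y := by
    rw [hd1'.deriv_eq, hd2.deriv]
  have hmax' : IsLocalMax (f ∘ γ) 0 := by
    have : Tendsto γ (𝓝 0) (𝓝 y) := by rw [← hγ0]; exact hγc.continuousAt
    have h := this.eventually hmax
    simpa [IsLocalMax, IsMaxFilter, hγ0] using h
  by_contra hpos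
  push Not at hpos
  rw [← hdd] at hpos
  -- A positive second derivative would make the point also a local minimum along the line; the
  -- function would then be locally constant there and its second derivative zero.
  have hmin := isLocalMin_of_deriv_deriv_pos hpos hmax'.deriv_eq_zero
    (hd1 0 (by rwa [hγ0])).continuousAt
  have hconst : f ∘ γ =ᶠ[𝓝 0] fun _ => (f ∘ γ) 0 := by
    filter_upwards [hmin, hmax'] with s h1 h2 using le_antisymm h2 h1
  have h1 : deriv (f ∘ γ) =ᶠ[𝓝 0] fun _ => 0 := by
    filter_upwards [hconst.eventuallyEq_nhds] with s hs
    rw [hs.deriv_eq]; simp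
  rw [h1.deriv_eq] at hpos
  simp at hpos

/-- If a function on `[0, T]` has a maximum at `t < T`, its derivative there is nonpositive. -/
theorem HasDerivWithinAt.nonpos_of_isMaxOn {T t f' : ℝ} (ht : t ∈ Icc 0 T) (htT : t < T)
    {f : ℝ → ℝ} (hf : HasDerivWithinAt f f' (Icc 0 T) t) (hmax : IsMaxOn f (Icc 0 T) t) :
    f' ≤ 0 := by
  -- Only the forward direction is available in the tangent cone when `t = 0`; it is nonzero because
  -- `t < T`.
  have h1 : T - t ∈ posTangentConeAt (Icc 0 T) t :=
    sub_mem_posTangentConeAt_of_segment_subset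
      ((convex_Icc 0 T).segment_subset ht ⟨ht.1.trans htT.le, le_rfl⟩)
  have h2 := hmax.localize.hasFDerivWithinAt_nonpos hf.hasFDerivWithinAt h1
  simp only [ContinuousLinearMap.toSpanSingleton_apply, smul_eq_mul] at h2
  nlinarith

open FrameCalculus Spacetime in
/-- At a spatial maximum, the Laplacian in a frame is nonpositive. -/
theorem Spacetime.sum_frame_nonpos {n : ℕ} {T : ℝ} (hT : 0 < T)
    {O : Set (EuclideanSpace ℝ (Fin n))} (hO : IsOpen O) {t : ℝ} (ht : t ∈ Icc 0 T)
    (u : SmoothFn (Icc 0 T ×ˢ O)) (P : Matrix (Fin n) (Fin n) (SmoothFn (Icc 0 T ×ˢ O)))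
    (y : O) (hmax : ∀ z : O, SmoothFn.eval (pt ht z) u ≤ SmoothFn.eval (pt ht y) u) :
    ∑ i, SmoothFn.eval (pt ht y) (newFrame (dx hT hO) P i (newFrame (dx hT hO) P i u)) ≤ 0 := by
  set f : EuclideanSpace ℝ (Fin n) → ℝ := fun z => extendZero u.1 (t, z) with hfdef
  have hfe : ∀ z : O, f z = SmoothFn.eval (pt ht z) u := fun z =>
    SmoothFn.extendZero_eq_eval u (pt ht z)
  have hf : ContDiffOn ℝ ∞ f O := (SmoothFn.contDiffOn u).comp
    (contDiff_prodMk_right t).contDiffOn fun z hz => ⟨ht, hz⟩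
  have hloc : IsLocalMax f y := by
    filter_upwards [hO.mem_nhds y.2] with z hz
    rw [hfe y, hfe ⟨z, hz⟩]
    exact hmax ⟨z, hz⟩
  have h1 := fun p z => realizes hT hO ht f u hfe p z
  have h2 := fun p q => realizes hT hO ht _ _ (h1 p) q y
  -- First derivatives vanish at the maximum, so the terms that differentiate the frame coefficients
  -- `P` drop out and only a quadratic form in the Hessian remains.
  have h0 : ∀ p, SmoothFn.eval (pt ht y) (dx hT hO p u) = 0 := by
    intro p
    rw [← h1, Coord.pd, hloc.fderiv_eq_zero]
    rfl
  refine Finset.sum_nonpos fun i _ => ?_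
  have h3 := hloc.sum_pd_pd_nonpos hO hf y.2 fun p => SmoothFn.eval (pt ht y) (P p i)
  refine le_trans (le_of_eq ?_) h3
  rw [newFrame_apply (f := u), map_sum, map_sum]
  refine Finset.sum_congr rfl fun p _ => ?_
  rw [Derivation.leibniz, newFrame_apply, map_add, smul_eq_mul, smul_eq_mul, _root_.map_mul,
    _root_.map_mul, h0,
    zero_mul, add_zero, map_sum, Finset.mul_sum]
  refine Finset.sum_congr rfl fun q _ => ?_
  rw [_root_.map_mul, mul_assoc]
  exact congrArg _ (congrArg _ (h2 p q).symm)

end MaximumPrinciple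

/-! ### Preservation of divergence-free families, and the maximum principle for the divergence. -/

section Main

open FrameCalculus Spacetime Matrix Filter Topology

variable {M : Type*} [TopologicalSpace M] [ChartedSpace (EuclideanSpace ℝ (Fin 3)) M]
  [IsManifold (𝓡 3) ∞ M] {T : ℝ} {g : ℝ → SmoothMetric 3 M} {H : ℝ → TensorField 3 M}

theorem SmoothFn.eq_zero_of_eval {n : ℕ} {O : Set (EuclideanSpace ℝ (Fin n))}
    {F : SmoothFn (Icc 0 T ×ˢ O)}
    (h : ∀ (t : ℝ) (ht : t ∈ Icc 0 T) (y : O), SmoothFn.eval (pt ht y) F = 0) : F = 0 := by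
  ext p
  exact h p.1.1 p.2.1 ⟨p.1.2, p.2.2⟩

omit [IsManifold (𝓡 3) ∞ M] in
theorem tensorFn_transpose (hH : SmoothSymFamily T H)
    {e : OpenPartialHomeomorph M (EuclideanSpace ℝ (Fin 3))}
    (he : e ∈ atlas (EuclideanSpace ℝ (Fin 3)) M) {O : Set (EuclideanSpace ℝ (Fin 3))}
    (hOe : O ⊆ e.target) : (tensorFn he hOe hH.1)ᵀ = tensorFn he hOe hH.1 := by
  ext i j p
  exact (hH.2 p.1.1 p.2.1 (e.symm p.1.2)).eq _ _

/-- The conjugate operator preserves smooth symmetric families of tensor fields. -/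
theorem smoothSymFamily_conjOp (hT : 0 < T) (hg : SmoothMetricFamily T g)
    (hH : SmoothSymFamily T H) : SmoothSymFamily T (conjOp T g H) := by
  refine ⟨smoothTensorFamily_conjOp hT hg hH.1, fun t ht x => ?_⟩
  have hc := chart_mem_atlas (EuclideanSpace ℝ (Fin 3)) x
  have hx := mem_chart_source (EuclideanSpace ℝ (Fin 3)) x
  set e := chartAt (EuclideanSpace ℝ (Fin 3)) x
  obtain ⟨O, hO, hOe, hyO, P, Q, hF, hτQ, hn⟩ := exists_normal_frame hc hT hg ht (e.map_source hx)
  have hs := tensorFn_transpose hH hc hOe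
  have key : ∀ i j, conjOp T g H t x (coframe e x i) (coframe e x j) =
      SmoothFn.eval (pt ht ⟨e x, hyO⟩) (conjFn hc hO hOe hT hg hH.1 i j) := by
    intro i j
    refine Eq.trans ?_ (eval_conjFn hc hO hOe hT hg hH.1 ht ⟨e x, hyO⟩ i j).symm
    rw [TensorField.comp, Matrix.of_apply, e.left_inv hx]
  have hl := ev_lich_symm_of_normal hF hn (metricFn_transpose hc hOe hg)
    (metricFn_mul_inv hc hOe hg) hs
  have hs' : ∀ i j, tensorFn hc hOe hH.1 i j = tensorFn hc hOe hH.1 j i :=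
    fun i j => congrFun (congrFun hs j) i
  have : conjOp T g H t x = (conjOp T g H t x).flip := by
    refine ext_bilin hc hx fun i j => ?_
    change conjOp T g H t x (coframe e x i) (coframe e x j) =
      conjOp T g H t x (coframe e x j) (coframe e x i)
    rw [key, key]
    simp only [conjFn, conj, Matrix.add_apply, Matrix.sub_apply, Matrix.neg_apply, Matrix.smul_apply,
      Matrix.map_apply, map_add, map_sub, map_neg, hs' i j, hl i j]
  exact ⟨fun ξ θ => congrArg (fun B => B ξ θ) this⟩

/-- The operator `-∂/∂t - Δ_L + R` along the Ricci flow preserves divergence-free families. -/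
theorem mapsTo_conjOp (hT : 0 < T) (hg : IsRicciFlow T g) :
    Set.MapsTo (conjOp T g) (divFree T g) (divFree T g) := by
  rintro H ⟨hH, hdiv⟩
  refine ⟨smoothSymFamily_conjOp hT hg.1 hH, fun t ht x => ?_⟩
  have hc := chart_mem_atlas (EuclideanSpace ℝ (Fin 3)) x
  have hx := mem_chart_source (EuclideanSpace ℝ (Fin 3)) x
  set e := chartAt (EuclideanSpace ℝ (Fin 3)) x
  obtain ⟨O, hO, hOe, hyO, P, Q, hF, hτQ, hn⟩ :=
    exists_normal_frame hc hT hg.1 ht (e.map_source hx)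
  refine ext_coframe hc hx fun b => ?_
  rw [SmoothMetric.coframe_divergence hc hT hg.1 (smoothTensorFamily_conjOp hT hg.1 hH.1) ht hx,
    map_zero]
  have h1 := conjFn_eval_eq_div hc hO hOe hT hg.1 hH.1 ht ⟨e x, hyO⟩ b
  refine h1.trans (ev_div_conj_eq_zero hF hn (metricFn_transpose hc hOe hg.1)
    (metricFn_mul_inv hc hOe hg.1) (dt_dx hT hO) hτQ (dt_metricFn hc hO hOe hT hg)
    (tensorFn_transpose hH hc hOe) ?_ b)
  -- The divergence has to vanish as a ring element, on all of `[0, T] × O`, since the identity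
  -- involves its time derivative and second space derivatives.
  intro b
  refine SmoothFn.eq_zero_of_eval fun s hs y => ?_
  refine (eval_divFn hc hO hOe hT hg.1 hH.1 hs y b).trans ?_
  rw [hdiv _ hs, map_zero]

/-- The squared norm of the divergence. -/
def divNormSq (g : ℝ → SmoothMetric 3 M) (H : ℝ → TensorField 3 M) (t : ℝ) (x : M) : ℝ :=
  (g t).inner x ((g t).divergence (H t) x) ((g t).divergence (H t) x)

/-- The squared norm of the divergence in the ring of smooth functions. -/
def divNormSqFn {e : OpenPartialHomeomorph M (EuclideanSpace ℝ (Fin 3))}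
    (he : e ∈ atlas (EuclideanSpace ℝ (Fin 3)) M) {O : Set (EuclideanSpace ℝ (Fin 3))}
    (hO : IsOpen O) (hOe : O ⊆ e.target) (hT : 0 < T) (hg : SmoothMetricFamily T g)
    (hH : SmoothTensorFamily T H) : SmoothFn (Icc 0 T ×ˢ O) :=
  ∑ b, ∑ c, metricFn he hOe hg b c * (divFn he hO hOe hT hg hH b * divFn he hO hOe hT hg hH c)

theorem eval_divNormSqFn {e : OpenPartialHomeomorph M (EuclideanSpace ℝ (Fin 3))}
    (he : e ∈ atlas (EuclideanSpace ℝ (Fin 3)) M) {O : Set (EuclideanSpace ℝ (Fin 3))}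
    (hO : IsOpen O) (hOe : O ⊆ e.target) (hT : 0 < T) (hg : SmoothMetricFamily T g)
    (hH : SmoothTensorFamily T H) {t : ℝ} (ht : t ∈ Icc 0 T) (y : O) :
    SmoothFn.eval (pt ht y) (divNormSqFn he hO hOe hT hg hH) = divNormSq g H t (e.symm y) := by
  rw [divNormSq, SmoothMetric.inner_eq_sum he _ (e.map_target (hOe y.2)), divNormSqFn]
  simp only [map_sum, _root_.map_mul, eval_divFn, e.right_inv (hOe y.2)]
  rfl

-- Continuity is local and can be read in a chart around each point. It gives the bound on the
-- scalar curvature and the existence of a space-time maximum on the compact set `[0, T] × M`.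
omit [IsManifold (𝓡 3) ∞ M] in
theorem continuousOn_of_charts {f : ℝ → M → ℝ}
    (h : ∀ e ∈ atlas (EuclideanSpace ℝ (Fin 3)) M, ∃ F : SmoothFn (Icc 0 T ×ˢ e.target),
      ∀ (t : ℝ) (ht : t ∈ Icc 0 T) (y : e.target), SmoothFn.eval (pt ht y) F = f t (e.symm y)) :
    ContinuousOn (fun p : ℝ × M => f p.1 p.2) (Icc 0 T ×ˢ univ) := by
  rintro ⟨t, x⟩ ⟨ht, -⟩
  set e := chartAt (EuclideanSpace ℝ (Fin 3)) x
  have hx : x ∈ e.source := mem_chart_source (EuclideanSpace ℝ (Fin 3)) x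
  obtain ⟨F, hF⟩ := h e (chart_mem_atlas _ x)
  have h1 : ContinuousOn (fun p : ℝ × M => extendZero F.1 (p.1, e p.2)) (Icc 0 T ×ˢ e.source) :=
    (SmoothFn.contDiffOn F).continuousOn.comp
      (continuousOn_fst.prodMk (e.continuousOn.comp continuousOn_snd fun p hp => hp.2))
      fun p hp => ⟨hp.1, e.map_source hp.2⟩
  have h2 : ContinuousOn (fun p : ℝ × M => f p.1 p.2) (Icc 0 T ×ˢ e.source) := by
    refine h1.congr fun p hp => ?_
    have h3 := hF p.1 hp.1 ⟨e p.2, e.map_source hp.2⟩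
    rw [← SmoothFn.extendZero_eq_eval] at h3
    simp only [e.left_inv hp.2] at h3
    exact h3.symm
  refine (h2 (t, x) ⟨ht, hx⟩).mono_of_mem_nhdsWithin ?_
  refine mem_nhdsWithin.mpr ⟨univ ×ˢ e.source, isOpen_univ.prod e.open_source, ⟨mem_univ _, hx⟩, ?_⟩
  rintro p ⟨⟨-, h1⟩, h2, -⟩
  exact ⟨h2, h1⟩

theorem divNormSq_nonneg (g : ℝ → SmoothMetric 3 M) (H : ℝ → TensorField 3 M) (t : ℝ) (x : M) :
    0 ≤ divNormSq g H t x := by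
  by_cases h : (g t).divergence (H t) x = 0
  · simp [divNormSq, h]
  · exact ((g t).pos x _ h).le

/-- The evolution inequality for the squared norm of the divergence at a spatial maximum. -/
theorem exists_hasDerivWithinAt_divNormSq (hT : 0 < T) (hg : IsRicciFlow T g)
    (hH : SmoothSymFamily T H) (hconj : ∀ t ∈ Icc 0 T, ∀ x, conjOp T g H t x = 0) {t : ℝ}
    (ht : t ∈ Icc 0 T) {x : M} (hmax : ∀ z, divNormSq g H t z ≤ divNormSq g H t x) :
    ∃ D, HasDerivWithinAt (fun s => divNormSq g H s x) D (Icc 0 T) t ∧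
      2 * (g t).scalar x * divNormSq g H t x ≤ D := by
  have hc := chart_mem_atlas (EuclideanSpace ℝ (Fin 3)) x
  have hx := mem_chart_source (EuclideanSpace ℝ (Fin 3)) x
  set e := chartAt (EuclideanSpace ℝ (Fin 3)) x
  obtain ⟨O, hO, hOe, hyO, P, Q, hF, hτQ, hn⟩ :=
    exists_normal_frame hc hT hg.1 ht (e.map_source hx)
  have hu := fun {s : ℝ} (hs : s ∈ Icc 0 T) (y : O) =>
    eval_divNormSqFn hc hO hOe hT hg.1 hH.1 hs y
  have hz : conjFn hc hO hOe hT hg.1 hH.1 = 0 := by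
    refine Matrix.ext fun i j => ?_
    refine SmoothFn.eq_zero_of_eval fun s hs y => ?_
    refine (eval_conjFn hc hO hOe hT hg.1 hH.1 hs y i j).trans ?_
    rw [TensorField.comp, Matrix.of_apply, hconj _ hs, LinearMap.zero_apply, LinearMap.zero_apply]
  have hen := ev_energy_of_normal hF hn (metricFn_transpose hc hOe hg.1)
    (metricFn_mul_inv hc hOe hg.1) (dt_dx hT hO) hτQ (dt_metricFn hc hO hOe hT hg)
    (tensorFn_transpose hH hc hOe) hz (divNormSqFn hc hO hOe hT hg.1 hH.1) rfl
  have hsc := eval_scalarFn hc hO hOe hT hg.1 ht ⟨e x, hyO⟩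
  rw [scalarFn] at hsc
  -- At a spatial maximum the Laplacian term in `hen` is nonpositive, so the whole lower bound falls
  -- on the time derivative.
  have hlap := sum_frame_nonpos hT hO ht (divNormSqFn hc hO hOe hT hg.1 hH.1) P ⟨e x, hyO⟩
    (fun z => by
      rw [hu ht, hu ht]
      simp only [e.left_inv hx]
      exact hmax _)
  refine ⟨_, hasDerivWithinAt_slice hT hO ht ⟨e x, hyO⟩ _
    (divNormSqFn hc hO hOe hT hg.1 hH.1) (fun s hs => ?_), ?_⟩
  · rw [hu hs]
    simp only [e.left_inv hx]
  · rw [hsc, hu ht] at hen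
    simp only [e.left_inv hx] at hen
    linarith

/-- A solution of the conjugate heat equation along the Ricci flow that is divergence-free at the
final time is divergence-free. -/
theorem divergence_eq_zero_of_final [CompactSpace M] (hT : 0 < T) (hg : IsRicciFlow T g)
    (hH : SmoothSymFamily T H) (hconj : ∀ t ∈ Icc 0 T, ∀ x, conjOp T g H t x = 0)
    (hfin : ∀ x, (g T).divergence (H T) x = 0) {t : ℝ} (ht : t ∈ Icc 0 T) (x : M) :
    (g t).divergence (H t) x = 0 := by
  have hcomp : IsCompact (Icc 0 T ×ˢ (univ : Set M)) := isCompact_Icc.prod isCompact_univ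
  have hsc : ContinuousOn (fun p : ℝ × M => (g p.1).scalar p.2) (Icc 0 T ×ˢ univ) :=
    continuousOn_of_charts fun e he => ⟨scalarFn he e.open_target le_rfl hT hg.1,
      fun t ht y => eval_scalarFn he e.open_target le_rfl hT hg.1 ht y⟩
  have hcu : ContinuousOn (fun p : ℝ × M => divNormSq g H p.1 p.2) (Icc 0 T ×ˢ univ) :=
    continuousOn_of_charts fun e he => ⟨divNormSqFn he e.open_target le_rfl hT hg.1 hH.1,
      fun t ht y => eval_divNormSqFn he e.open_target le_rfl hT hg.1 hH.1 ht y⟩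
  obtain ⟨B, hB⟩ := hcomp.exists_bound_of_continuousOn hsc
  -- Since the scalar curvature is at least `-B`, this choice makes `c + 2R ≥ 1` everywhere.
  set c : ℝ := 2 * B + 1 with hc
  have hcv : ContinuousOn (fun p : ℝ × M => Real.exp (c * p.1) * divNormSq g H p.1 p.2)
      (Icc 0 T ×ˢ univ) := ContinuousOn.mul (by fun_prop) hcu
  obtain ⟨⟨t₀, x₀⟩, ⟨ht₀, -⟩, hmax⟩ := hcomp.exists_isMaxOn ⟨(t, x), ht, mem_univ x⟩ hcv
  have hmax' : ∀ s ∈ Icc 0 T, ∀ z, Real.exp (c * s) * divNormSq g H s z ≤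
      Real.exp (c * t₀) * divNormSq g H t₀ x₀ := 
    fun s hs z => isMaxOn_iff.mp hmax (s, z) ⟨hs, mem_univ z⟩
  have hzero : divNormSq g H t₀ x₀ = 0 := by
    by_contra hne
    have hpos : 0 < divNormSq g H t₀ x₀ :=
      lt_of_le_of_ne (divNormSq_nonneg g H t₀ x₀) (Ne.symm hne)
    -- A positive maximum cannot sit at the final time, where the divergence vanishes; forward
    -- motion in time is therefore possible at `t₀`, even if `t₀ = 0`.
    have htT : t₀ < T := by
      refine lt_of_le_of_ne ht₀.2 fun h => hne ?_
      rw [h, divNormSq, hfin]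
      simp
    obtain ⟨D, hD, hDle⟩ := exists_hasDerivWithinAt_divNormSq hT hg hH hconj ht₀ (x := x₀)
      fun z => le_of_mul_le_mul_left (hmax' t₀ ht₀ z) (Real.exp_pos _)
    have hexp : HasDerivWithinAt (fun s => Real.exp (c * s)) (Real.exp (c * t₀) * c)
        (Icc 0 T) t₀ := by
      simpa using (((hasDerivAt_id t₀).const_mul c).exp).hasDerivWithinAt
    -- Dividing by the exponential gives `c u + D ≤ 0`, whereas `D ≥ 2R u` and the choice of `c`
    -- give `c u + D ≥ u > 0`.
    have hnon := (hexp.mul hD).nonpos_of_isMaxOn ht₀ htT fun s hs => hmax' s hs x₀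
    have hR := hB (t₀, x₀) ⟨ht₀, mem_univ _⟩
    rw [Real.norm_eq_abs, abs_le] at hR
    have hE := Real.exp_pos (c * t₀)
    have h1 : Real.exp (c * t₀) * (c * divNormSq g H t₀ x₀ + D) ≤ 0 := by
      linarith [hnon]
    have h2 : c * divNormSq g H t₀ x₀ + D ≤ 0 := by
      by_contra h
      push Not at h
      linarith [mul_pos hE h]
    nlinarith [hR.1]
  have h0 : divNormSq g H t x ≤ 0 := by
    have := hmax' t ht x
    rw [hzero, mul_zero] at this
    by_contra h
    push Not at h
    linarith [mul_pos (Real.exp_pos (c * t)) h]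
  by_contra h
  exact absurd ((g t).pos x _ h) (not_lt.mpr h0)

omit [IsManifold (𝓡 3) ∞ M] in
theorem smoothSymFamily_reverse (hH : SmoothSymFamily T H) :
    SmoothSymFamily T fun t => H (T - t) := by
  have hm : ∀ t ∈ Icc 0 T, T - t ∈ Icc 0 T := fun t ht => ⟨by linarith [ht.2], by linarith [ht.1]⟩
  refine ⟨fun e he i j => ?_, fun t ht x => hH.2 _ (hm t ht) x⟩
  exact (hH.1 e he i j).comp
    (f := fun p : ℝ × EuclideanSpace ℝ (Fin 3) => (T - p.1, p.2)) (by fun_prop)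
    fun p hp => ⟨hm _ hp.1, hp.2⟩

/-- In reversed time, a solution of the conjugate flow is annihilated by the conjugate operator. -/
theorem conjOp_reverse_eq_zero (hT : 0 < T) (hH : IsConjugateFlow T (fun η => g (T - η)) H)
    {t : ℝ} (ht : t ∈ Icc 0 T) (x : M) : conjOp T g (fun t => H (T - t)) t x = 0 := by
  have hm : ∀ t ∈ Icc 0 T, T - t ∈ Icc 0 T := fun t ht => ⟨by linarith [ht.2], by linarith [ht.1]⟩
  ext ξ θ
  have h1 := hasDerivWithinAt_tensor hT (H := fun t => H (T - t))
    (smoothSymFamily_reverse hH.1).1 ht x ξ θ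
  have h2 := hH.2 (T - t) (hm t ht) x ξ θ
  -- The factor `-1` from time reversal turns `-∂/∂t` into `∂/∂η`.
  have h3 : HasDerivWithinAt (fun s => T - s) (-1) (Icc 0 T) t := by
    simpa using ((hasDerivAt_id t).const_sub T).hasDerivWithinAt
  have h4 := HasDerivWithinAt.comp t h2 h3 hm
  have h5 := (uniqueDiffOn_Icc hT t ht).eq_deriv _ h1 h4
  simp only [sub_sub_cancel] at h5
  simp only [conjOp, LinearMap.add_apply, LinearMap.sub_apply, LinearMap.neg_apply,
    LinearMap.smul_apply, smul_eq_mul, LinearMap.zero_apply, h5]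
  ring

end Main

end

theorem lemma3p1 {M : Type*} [TopologicalSpace M] [T2Space M] [CompactSpace M]
    [ChartedSpace (EuclideanSpace ℝ (Fin 3)) M] [IsManifold (𝓡 3) ∞ M]
    (T : ℝ) (hT : 0 < T) (g : ℝ → SmoothMetric 3 M) (hg : IsRicciFlow T g) :
    Set.MapsTo (conjOp T g) (divFree T g) (divFree T g) ∧
    ∀ H : ℝ → TensorField 3 M, IsConjugateFlow T (fun η => g (T - η)) H →
      (∀ x, (g T).divergence (H 0) x = 0) →
      ∀ η ∈ Set.Icc 0 T, ∀ x, (g (T - η)).divergence (H η) x = 0 := by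
  refine ⟨mapsTo_conjOp hT hg, fun H hH h0 η hη x => ?_⟩
  -- In reversed time `t = T - η` the condition at `η = 0` becomes the final condition at `t = T`.
  have h := divergence_eq_zero_of_final hT hg (smoothSymFamily_reverse hH.1)
    (fun t ht x => conjOp_reverse_eq_zero hT hH ht x) (fun x => by simpa using h0 x)
    (t := T - η) ⟨by linarith [hη.2], by linarith [hη.1]⟩ x
  simpa using h
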